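/- **Definitions.** Let $H$ be a finite graph with hop metric $d_H$. Every unordered pair of distinct vertices of $H$ in the same component is served by one unit of flow, sent from one of the two vertices (the source) to the other (the destination $w$) along geodesics; at every vertex $v'$ the flow destined for $w$ is split equally among the neighbours $x$ of $v'$ with $d_H(x,w)=d_H(v',w)-1$. For a vertex $v$ let $T(v)$ be the total flow passing through $v$ (flow that starts or ends at $v$ included), and let $M_v(H)=\max_v T(v)$ be the maximum vertex flow. Adding a random matching to a graph $G$ means: repeatedly choose a uniformly random pair of distinct vertices among the remaining candidates (initially all vertices), join them by an edge if they are not already adjacent, and remove both from the candidates, until at most one candidate is left. **Theorem.** For all $\epsilon>0$ and $c>0$ there is a constant $C=C(\epsilon,c)$ such that for every integer $k\ge 3$ the following holds. Let $G$ be a graph on $N$ vertices with all degrees at most $k$ such that for every vertex $x$ and every integer $i$ with $1\le i\le(\tfrac12+\epsilon)\log_{k-1}N$ there are at least $c\,k(k-1)^{i-2}$ vertices at distance exactly $i$ from $x$ in $G$. Let $H$ be the graph obtained from $G$ by adding a random matching. Then, with probability tending to $1$ as $N\to\infty$ (with $\epsilon,c,k$ fixed, uniformly over all such $G$), $$M_v(H)\;\le\;k^{C}N\log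 N\,(\log_k N)^2+o\bigl(N\log N\,(\log_k N)^2\bigr),$$ whatever the choice of the direction in which each pair of vertices is served. -/

import Mathlib

open Filter Asymptotics

noncomputable section

namespace GeodesicFlow

variable {V : Type*} [Fintype V]

open Classical in
/-- The neighbours of `v` through which a geodesic from `v` to `t` may continue: those that are
one step closer to `t` in the hop metric. -/
def nextHops (H : SimpleGraph V) (t v : V) : Finset V :=
  {u | H.Adj v u ∧ H.dist u t + 1 = H.dist v t}

open Classical in
/-- A unit of flow leaves `s` for `t`; at every vertex it is split equally among the next hops
(it stops at `t`).  `stepFlow H s t n v` is the amount that is at `v` after exactly `n` hops. -/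
def stepFlow (H : SimpleGraph V) (s t : V) : ℕ → V → ℝ
  | 0, v => if v = s then 1 else 0
  | n + 1, v => ∑ u : V, if v ∈ nextHops H t u then
      stepFlow H s t n u / ((nextHops H t u).card : ℝ) else 0

open Classical in
/-- The part of the unit geodesic flow from `s` to `t` that passes through `v`, the end points
`s` and `t` included.  A geodesic has fewer than `|V|` hops and visits a vertex at most once.
No flow is sent between vertices in different components. -/
def pairFlow (H : SimpleGraph V) (s t v : V) : ℝ :=
  if H.Reachable s t then ∑ n ∈ Finset.range (Fintype.card V), stepFlow H s t n v else 0

/-- `P` contains every unordered pair of distinct vertices in exactly one of its two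
directions. -/
def IsPairOrientation (P : Finset (V × V)) : Prop :=
  ∀ s t : V, (s, t) ∈ P ↔ s ≠ t ∧ (t, s) ∉ P

/-- The total flow through `v` when every pair `(s, t) ∈ P` sends one unit from `s` to `t`. -/
def vertexFlow (H : SimpleGraph V) (P : Finset (V × V)) (v : V) : ℝ :=
  ∑ p ∈ P, pairFlow H p.1 p.2 v

/-- The maximum vertex flow. -/
def maxVertexFlow (H : SimpleGraph V) (P : Finset (V × V)) : ℝ :=
  ⨆ v : V, vertexFlow H P v

open Classical in
/-- `n` rounds of the following procedure, started at the graph `G` with the set `S` of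
candidates: choose a uniformly random pair of distinct candidates, join the two vertices
by an edge (nothing is added if they are already adjacent), and remove both from the candidates.
The procedure stops when at most one candidate is left. -/
def matchingRounds : ℕ → Finset V → SimpleGraph V → PMF (SimpleGraph V)
  | 0, _, G => PMF.pure G
  | n + 1, S, G =>
    if h : S.offDiag.Nonempty then
      (PMF.uniformOfFinset S.offDiag h).bind fun p =>
        matchingRounds n (S \ {p.1, p.2}) (G ⊔ SimpleGraph.edge p.1 p.2)
    else PMF.pure G

/-- The law of the graph obtained from `G` by adding a random matching: the procedure above is run
with all vertices as candidates until at most one candidate is left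
(every round uses two candidates, so `|V|` rounds are more than enough). -/
def addRandomMatching (G : SimpleGraph V) : PMF (SimpleGraph V) :=
  matchingRounds (Fintype.card V) Finset.univ G

/-- All degrees are at most `k`. -/
def DegreesAtMost (G : SimpleGraph V) (k : ℕ) : Prop :=
  ∀ x : V, (G.neighborSet x).ncard ≤ k

/-- Exponential neighbourhood growth: for every vertex `x` and all
`1 ≤ i ≤ (1/2 + ε) log_{k-1} |V|`, at least `c k (k-1)^(i-2)` vertices are at distance
exactly `i` from `x`. -/
def NeighborhoodGrowth (G : SimpleGraph V) (k : ℕ) (ε c : ℝ) : Prop :=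
  ∀ (x : V) (i : ℕ), 1 ≤ i →
    (i : ℝ) ≤ (1 / 2 + ε) * Real.logb ((k : ℝ) - 1) (Fintype.card V : ℝ) →
    c * (k : ℝ) * ((k : ℝ) - 1) ^ ((i : ℤ) - 2) ≤ ({y : V | G.edist x y = i}.ncard : ℝ)

/-- The order of magnitude `N log N (log_k N)^2`. -/
def flowScale (k N : ℕ) : ℝ :=
  (N : ℝ) * Real.log N * Real.logb k N ^ 2

end GeodesicFlow

end

/-!
Write `k = Δ + 1` for the degree bound of `G`, so that the graph `H` with the random matching has
degrees at most `k + 1`.  The flow through `v` is at most the number of pairs that have a geodesic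
through `v`.  If all distances in `H` were at most `D`, that number would be of order `D kᴰ`, since
for each `i` there are `O(kⁱ) · O(kᴰ⁻ⁱ)` pairs with distances `i` and at most `D - i` from `v`.
With `kᴰ` of order `N log N` this is of order `N (log N)²`, while the scale `N log N (log_k N)²` is
of order `N (log N)³`.  Vertices whose neighbourhoods in `H` are thin can be farther away from each
other, however, and are treated separately (`card_throughPairs_le`).  A vertex is stunted if its
sphere of radius `n ≈ log log N` in `H` has at most half of `kⁿ` vertices.  A stunted vertex on a
sphere around `v` makes the spheres around `v` grow more slowly, so that stunted vertices are rare
on them (`sum_card_stunted_div_le`), and it suffices that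

* two vertices that are not stunted have distance at most `D`, where `kᴰ` is of order `N log N`;
* any two vertices have distance at most `D'`, where the order of `k ^ D'` is at most
  `N (log N) ^ (5 / 2)`.

Both hold with high probability.  The partners of the vertices around `s` and `t` are revealed one
at a time, which is possible because the partner of a given vertex is nearly uniform and the rest
of the matching is again a random matching (`exists_matchingMean_eq_sum`).  If the partner of `u`
is `w`, the ball of `G` around `w` is added to the exploration.  In the `k`-regular tree, that ball
has as many vertices at each distance as are needed for the exploration to grow by a factor `k` per
step.  The growth hypothesis implies that the ball around an average vertex is that of the tree up
to a share of order `1 / log N` (`sum_one_sub_branchWeight_le`): the relative sizes of the spheres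
around `x` drop by a bounded amount in total, so they hardly drop at most radii; hence most
vertices seen from `x` have nearly all possible descendants, and the same holds for the ancestors
of most vertices `y`, whose side branches fill the ball around `y` (`one_sub_branchWeight_le`).
Over `log N` steps, the loss is a constant factor.  The concentration comes from the exponential
supermartingale in `matchingMean_le_of_growth`, once the exploration starts with a constant times
`log N` vertices: for arbitrary `s` and `t` these are spheres of radius `n` in `G`; for vertices
that are not stunted they are the roughly `kⁿ` vertices at distance at most `n` in the partly
revealed graph (`BranchesUpTo.matchingMean_le_of_stunted`).  Once both explorations have more than
`√(8 N log N)` vertices, an edge of the matching joins them (`matchingMean_le_exp_of_disjoint`).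
-/

namespace GeodesicFlow

/-! ### Spheres, balls and descendants in graphs of bounded degree -/

section Spheres

open Classical Finset

variable {V : Type*}

lemma edist_le_add_one_of_adj {Γ : SimpleGraph V} {x y z : V} (h : Γ.Adj y z) :
    Γ.edist x z ≤ Γ.edist x y + 1 := by
  have := Γ.edist_triangle (u := x) (v := y) (w := z)
  rwa [SimpleGraph.edist_eq_one_iff_adj.2 h] at this

lemma exists_adj_edist_eq {Γ : SimpleGraph V} {x z : V} {i : ℕ}
    (h : Γ.edist x z = (i + 1 : ℕ)) : ∃ y, Γ.Adj y z ∧ Γ.edist x y = i := by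
  obtain ⟨p, hp⟩ := SimpleGraph.exists_walk_of_edist_eq_coe h
  have hadj := p.adj_getVert_succ (i := i) (by omega)
  rw [← hp, SimpleGraph.Walk.getVert_length] at hadj
  refine ⟨_, hadj, le_antisymm ?_ ?_⟩
  · refine ((p.take i).edist_le).trans ?_
    simp
  · have := edist_le_add_one_of_adj (x := x) hadj
    rw [h] at this
    push_cast at this
    exact (ENat.add_le_add_iff_right (by simp)).1 this

/-- A geodesic can be cut at any of its positions. -/
lemma exists_edist_eq_add {Γ : SimpleGraph V} {x z : V} {i j : ℕ}
    (h : Γ.edist x z = (i + j : ℕ)) : ∃ y, Γ.edist x y = i ∧ Γ.edist y z = j := by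
  obtain ⟨p, hp⟩ := SimpleGraph.exists_walk_of_edist_eq_coe h
  have h1 : Γ.edist x (p.getVert i) ≤ i := ((p.take i).edist_le).trans (by simp)
  have h2 : Γ.edist (p.getVert i) z ≤ j := ((p.drop i).edist_le).trans (by simp [hp])
  have h3 := Γ.edist_triangle (u := x) (v := p.getVert i) (w := z)
  rw [h] at h3
  refine ⟨_, le_antisymm h1 ?_, le_antisymm h2 ?_⟩
  all_goals
    generalize Γ.edist x (p.getVert i) = a at *
    generalize Γ.edist (p.getVert i) z = b at *
    enat_to_nat
    omega

/-- If every vertex of `T` has a neighbour in `T'` that has at most `Δ` neighbours in `T`, then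
`T` is at most `Δ` times as large as `T'`. -/
lemma card_le_mul_of_forall_exists {T T' : Finset V} {Δ : ℕ} (r : V → V → Prop)
    (h : ∀ z ∈ T, ∃ y ∈ T', r y z) (hr : ∀ y ∈ T', (T.filter (r y)).card ≤ Δ) :
    T.card ≤ T'.card * Δ := by
  have : T ⊆ T'.biUnion fun y => T.filter (r y) := by
    intro z hz
    obtain ⟨y, hy, hyz⟩ := h z hz
    exact mem_biUnion.2 ⟨y, hy, mem_filter.2 ⟨hz, hyz⟩⟩
  exact (card_le_card this).trans (card_biUnion_le_card_mul _ _ _ hr)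

variable [Fintype V]

/-- The vertices at distance exactly `i` from `x`. -/
noncomputable def sphere (Γ : SimpleGraph V) (x : V) (i : ℕ) : Finset V :=
  {y | Γ.edist x y = i}

/-- The descendants of `u` of depth `j`, seen from `x`: the vertices at distance `j` from `u` that
some geodesic from `x` reaches through `u`. -/
noncomputable def fwd (Γ : SimpleGraph V) (x u : V) (j : ℕ) : Finset V :=
  {z | Γ.edist u z = j ∧ Γ.edist x z = Γ.edist x u + j}

/-- The vertices at distance at most `i` from `x`. -/
noncomputable def closedBall (Γ : SimpleGraph V) (x : V) (i : ℕ) : Finset V :=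
  {y | Γ.edist x y ≤ i}

lemma mem_sphere {Γ : SimpleGraph V} {x y : V} {i : ℕ} : y ∈ sphere Γ x i ↔ Γ.edist x y = i := by
  simp [sphere]

lemma mem_fwd {Γ : SimpleGraph V} {x u z : V} {j : ℕ} :
    z ∈ fwd Γ x u j ↔ Γ.edist u z = j ∧ Γ.edist x z = Γ.edist x u + j := by
  simp [fwd]

lemma mem_closedBall {Γ : SimpleGraph V} {x y : V} {i : ℕ} :
    y ∈ closedBall Γ x i ↔ Γ.edist x y ≤ i := by
  simp [closedBall]

lemma card_filter_adj_le {Γ : SimpleGraph V} {Δ : ℕ} (h : DegreesAtMost Γ Δ) (T : Finset V)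
    (y : V) : (T.filter (Γ.Adj y)).card ≤ Δ := by
  have := h y
  rw [← Set.ncard_coe_finset]
  refine (Set.ncard_le_ncard ?_ (Set.toFinite _)).trans this
  intro z hz
  simpa using (mem_filter.1 hz).2

/-- A vertex other than `x` has a neighbour closer to `x`, hence at most `Δ` neighbours
in a set that avoids the vertices closer to `x`. -/
lemma card_filter_adj_le_of_closer {Γ : SimpleGraph V} {Δ : ℕ} (h : DegreesAtMost Γ (Δ + 1))
    {x y : V} {i : ℕ} (hy : Γ.edist x y = (i + 1 : ℕ)) (T : Finset V)
    (hT : ∀ z ∈ T, Γ.edist x z ≠ i) : (T.filter (Γ.Adj y)).card ≤ Δ := by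
  obtain ⟨p, hpy, hp⟩ := exists_adj_edist_eq hy
  have hpT : p ∉ T.filter (Γ.Adj y) := fun hmem => hT p (mem_filter.1 hmem).1 hp
  have := card_filter_adj_le h (insert p T) y
  rw [filter_insert, if_pos hpy.symm, card_insert_of_notMem hpT] at this
  omega

lemma sphere_zero (Γ : SimpleGraph V) (x : V) : sphere Γ x 0 = {x} := by
  ext y
  rw [mem_sphere, Nat.cast_zero, SimpleGraph.edist_eq_zero_iff, mem_singleton, eq_comm]

lemma fwd_zero (Γ : SimpleGraph V) (x u : V) : fwd Γ x u 0 = {u} := by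
  ext y
  simp only [mem_fwd, Nat.cast_zero, SimpleGraph.edist_eq_zero_iff, add_zero, mem_singleton]
  exact ⟨fun h => h.1.symm, fun h => by simp [h]⟩

lemma card_sphere_one_le {Γ : SimpleGraph V} {Δ : ℕ} (h : DegreesAtMost Γ Δ) (x : V) :
    (sphere Γ x 1).card ≤ Δ := by
  refine le_trans (card_le_card ?_) (card_filter_adj_le h univ x)
  intro y hy
  simpa [mem_sphere] using hy

lemma card_sphere_succ_le {Γ : SimpleGraph V} {Δ : ℕ} (h : DegreesAtMost Γ (Δ + 1)) (x : V)
    (i : ℕ) : (sphere Γ x (i + 2)).card ≤ (sphere Γ x (i + 1)).card * Δ := by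
  refine card_le_mul_of_forall_exists Γ.Adj ?_ ?_
  · intro z hz
    obtain ⟨y, hyz, hy⟩ := exists_adj_edist_eq (mem_sphere.1 hz)
    exact ⟨y, mem_sphere.2 hy, hyz⟩
  · intro y hy
    refine card_filter_adj_le_of_closer h (mem_sphere.1 hy) _ ?_
    intro z hz
    rw [mem_sphere.1 hz]
    norm_cast
    omega

lemma card_sphere_le {Γ : SimpleGraph V} {Δ : ℕ} (h : DegreesAtMost Γ (Δ + 1)) (x : V) (i : ℕ) :
    (sphere Γ x (i + 1)).card ≤ (Δ + 1) * Δ ^ i := by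
  induction i with
  | zero => simpa using card_sphere_one_le h x
  | succ i ih =>
    calc _ ≤ _ := card_sphere_succ_le h x i
      _ ≤ (Δ + 1) * Δ ^ i * Δ := Nat.mul_le_mul_right _ ih
      _ = _ := by ring

lemma card_fwd_le {Γ : SimpleGraph V} {Δ : ℕ} (h : DegreesAtMost Γ (Δ + 1)) {x u : V} {i : ℕ}
    (hu : Γ.edist x u = (i + 1 : ℕ)) (j : ℕ) : (fwd Γ x u j).card ≤ Δ ^ j := by
  induction j with
  | zero => simp [fwd_zero]
  | succ j ih =>
    rw [pow_succ]
    refine le_trans (card_le_mul_of_forall_exists (T' := fwd Γ x u j) Γ.Adj ?_ ?_)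
      (Nat.mul_le_mul_right _ ih)
    · intro z hz
      obtain ⟨h1, h2⟩ := mem_fwd.1 hz
      obtain ⟨y, hyz, hy⟩ := exists_adj_edist_eq h1
      refine ⟨y, mem_fwd.2 ⟨hy, ?_⟩, hyz⟩
      have h3 := edist_le_add_one_of_adj (x := x) hyz
      have h4 := Γ.edist_triangle (u := x) (v := u) (w := y)
      rw [hu] at *
      rw [hy] at h4
      rw [h2] at h3
      generalize Γ.edist x y = a at *
      enat_to_nat
      omega
    · intro y hy
      obtain ⟨h1, h2⟩ := mem_fwd.1 hy
      refine card_filter_adj_le_of_closer (x := x) (i := i + j) h ?_ _ ?_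
      · rw [h2, hu]; push_cast; ring
      · intro z hz
        rw [(mem_fwd.1 hz).2, hu]
        norm_cast
        omega

lemma sphere_add_subset (Γ : SimpleGraph V) (x : V) (i j : ℕ) :
    sphere Γ x (i + j) ⊆ (sphere Γ x i).biUnion fun u => fwd Γ x u j := by
  intro z hz
  obtain ⟨y, h1, h2⟩ := exists_edist_eq_add (mem_sphere.1 hz)
  refine mem_biUnion.2 ⟨y, mem_sphere.2 h1, mem_fwd.2 ⟨h2, ?_⟩⟩
  rw [mem_sphere.1 hz, h1]
  push_cast
  rfl

lemma card_sphere_add_le (Γ : SimpleGraph V) (x : V) (i j : ℕ) :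
    (sphere Γ x (i + j)).card ≤ ∑ u ∈ sphere Γ x i, (fwd Γ x u j).card :=
  (card_le_card (sphere_add_subset Γ x i j)).trans card_biUnion_le

lemma card_sphere_le_two_mul_pow {Γ : SimpleGraph V} {Δ : ℕ} (hΔ : 1 ≤ Δ)
    (h : DegreesAtMost Γ (Δ + 1)) (x : V) (i : ℕ) : (sphere Γ x i).card ≤ 2 * Δ ^ i := by
  cases i with
  | zero => simp [sphere_zero]
  | succ i =>
    calc _ ≤ _ := card_sphere_le h x i
      _ ≤ (Δ + Δ) * Δ ^ i := by gcongr
      _ = _ := by ring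

lemma closedBall_eq_biUnion (Γ : SimpleGraph V) (x : V) (i : ℕ) :
    closedBall Γ x i = (range (i + 1)).biUnion fun j => sphere Γ x j := by
  ext y
  simp only [mem_closedBall, mem_biUnion, mem_range, mem_sphere]
  constructor
  · intro hy
    obtain ⟨n, hn⟩ := ENat.ne_top_iff_exists.1 (ne_top_of_le_ne_top (ENat.natCast_ne_top i) hy)
    rw [← hn] at hy ⊢
    exact ⟨n, by have := Nat.cast_le.1 hy; omega, rfl⟩
  · rintro ⟨j, hj, h⟩
    rw [h]
    exact_mod_cast Nat.lt_succ_iff.1 hj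

lemma card_closedBall_le {Γ : SimpleGraph V} {Δ : ℕ} (hΔ : 2 ≤ Δ)
    (h : DegreesAtMost Γ (Δ + 1)) (x : V) (i : ℕ) : (closedBall Γ x i).card ≤ 4 * Δ ^ i := by
  rw [closedBall_eq_biUnion]
  refine card_biUnion_le.trans ?_
  refine (sum_le_sum fun j _ => card_sphere_le_two_mul_pow (by omega) h x j).trans ?_
  rw [← mul_sum]
  have : ∑ j ∈ range (i + 1), Δ ^ j ≤ 2 * Δ ^ i := by
    induction i with
    | zero => simp
    | succ i ih =>
      rw [sum_range_succ, pow_succ]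
      nlinarith [Nat.mul_le_mul_left (Δ ^ i) hΔ]
  omega

end Spheres

/-! ### The flow through a vertex and the pairs with a geodesic through it -/

section Flow

open Classical Finset

variable {V : Type*} [Fintype V]

lemma stepFlow_nonneg (H : SimpleGraph V) (s t : V) (n : ℕ) (v : V) : 0 ≤ stepFlow H s t n v := by
  induction n generalizing v with
  | zero => rw [stepFlow]; split_ifs <;> norm_num
  | succ n ih =>
    rw [stepFlow]
    refine sum_nonneg fun u _ => ?_
    split_ifs
    · exact div_nonneg (ih u) (Nat.cast_nonneg _)
    · exact le_rfl

lemma sum_stepFlow_le_one (H : SimpleGraph V) (s t : V) (n : ℕ) :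
    ∑ v, stepFlow H s t n v ≤ 1 := by
  induction n with
  | zero => simp [stepFlow]
  | succ n ih =>
    refine le_trans ?_ ih
    simp only [stepFlow]
    rw [sum_comm]
    refine sum_le_sum fun u _ => ?_
    rw [← sum_filter, sum_const, filter_mem_eq_inter, univ_inter, nsmul_eq_mul]
    rcases Nat.eq_zero_or_pos (nextHops H t u).card with h | h
    · rw [h]; simpa using stepFlow_nonneg H s t n u
    · rw [mul_div_cancel₀]
      exact_mod_cast h.ne'

/-- The flow moves along geodesics. -/
lemma dist_add_of_stepFlow_ne_zero {H : SimpleGraph V} {s t : V} {n : ℕ} {v : V}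
    (h : stepFlow H s t n v ≠ 0) : H.dist v t + n = H.dist s t ∧ H.edist s v ≤ n := by
  induction n generalizing v with
  | zero =>
    rw [stepFlow] at h
    have : v = s := by by_contra hv; simp [hv] at h
    subst this
    simp
  | succ n ih =>
    rw [stepFlow] at h
    obtain ⟨u, -, hu⟩ := exists_ne_zero_of_sum_ne_zero h
    have hmem : v ∈ nextHops H t u := by by_contra hv; simp [hv] at hu
    rw [if_pos hmem] at hu
    have hu' : stepFlow H s t n u ≠ 0 := fun h0 => hu (by rw [h0, zero_div])
    obtain ⟨h1, h2⟩ := ih hu'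
    obtain ⟨h3, h4⟩ := (mem_filter.1 hmem).2
    refine ⟨by omega, ?_⟩
    refine (edist_le_add_one_of_adj h3).trans ?_
    push_cast
    gcongr

/-- The ordered pairs that have a geodesic through `v`. -/
noncomputable def throughPairs (H : SimpleGraph V) (v : V) : Finset (V × V) :=
  {p | H.edist p.1 v + H.edist v p.2 = H.edist p.1 p.2 ∧ H.edist p.1 p.2 ≠ ⊤}

lemma pairFlow_le_one (H : SimpleGraph V) (s t v : V) : pairFlow H s t v ≤ 1 := by
  rw [pairFlow]
  split_ifs
  · -- only the hop whose number is `dist s t - dist v t` can contribute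
    refine le_trans (b := stepFlow H s t (H.dist s t - H.dist v t) v) ?_ ?_
    · by_cases hm : H.dist s t - H.dist v t ∈ range (Fintype.card V)
      · rw [sum_eq_single_of_mem _ hm]
        intro n _ hn
        by_contra h0
        have := (dist_add_of_stepFlow_ne_zero h0).1
        omega
      · rw [sum_eq_zero]
        · exact stepFlow_nonneg _ _ _ _ _
        · intro n hn
          by_contra h0
          have := (dist_add_of_stepFlow_ne_zero h0).1
          exact hm (by rwa [← this, Nat.add_sub_cancel_left])
    · exact (single_le_sum (fun u _ => stepFlow_nonneg H s t _ u) (mem_univ v)).trans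
        (sum_stepFlow_le_one H s t _)
  · norm_num

lemma mem_throughPairs_of_pairFlow_ne_zero {H : SimpleGraph V} {s t v : V}
    (h : pairFlow H s t v ≠ 0) : (s, t) ∈ throughPairs H v := by
  rw [pairFlow] at h
  have hr : H.Reachable s t := by by_contra hr; simp [hr] at h
  rw [if_pos hr] at h
  obtain ⟨n, -, hn⟩ := exists_ne_zero_of_sum_ne_zero h
  obtain ⟨h1, h2⟩ := dist_add_of_stepFlow_ne_zero hn
  have hsv : H.Reachable s v :=
    SimpleGraph.edist_ne_top_iff_reachable.1 (ne_top_of_le_ne_top (ENat.natCast_ne_top n) h2)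
  have hvt : H.Reachable v t := hsv.symm.trans hr
  refine mem_filter.2 ⟨mem_univ _, ?_, SimpleGraph.edist_ne_top_iff_reachable.2 hr⟩
  refine le_antisymm ?_ H.edist_triangle
  rw [← hr.coe_dist_eq_edist, ← h1, ← hvt.coe_dist_eq_edist, Nat.cast_add, add_comm]
  gcongr

lemma vertexFlow_le_card (H : SimpleGraph V) (P : Finset (V × V)) (v : V) :
    vertexFlow H P v ≤ (throughPairs H v).card := by
  calc vertexFlow H P v ≤ ∑ p ∈ P, if p ∈ throughPairs H v then (1 : ℝ) else 0 := by
        refine sum_le_sum fun p _ => ?_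
        split_ifs with hp
        · exact pairFlow_le_one _ _ _ _
        · by_contra h0
          exact hp (mem_throughPairs_of_pairFlow_ne_zero (by intro h; rw [h] at h0; simp at h0))
    _ ≤ ∑ p, if p ∈ throughPairs H v then (1 : ℝ) else 0 :=
        sum_le_sum_of_subset_of_nonneg (subset_univ _) fun p _ _ => by split_ifs <;> norm_num
    _ = _ := by simp

lemma maxVertexFlow_le_of_forall_card_le [Nonempty V] {H : SimpleGraph V} {B : ℝ}
    (h : ∀ v, ((throughPairs H v).card : ℝ) ≤ B) (P : Finset (V × V)) : maxVertexFlow H P ≤ B :=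
  ciSup_le fun v => (vertexFlow_le_card H P v).trans (h v)

end Flow

/-! ### Counting pairs with a geodesic through a vertex -/

section Counting

open Classical Finset

variable {V : Type*} [Fintype V]

/-- The number of pairs joined through `v` by a path with first part of length `i` and second
part of length `j` is a product, so that short geodesics account for few pairs. -/
lemma card_throughPairs_filter_le {H : SimpleGraph V} {Δ : ℕ} (hΔ : 2 ≤ Δ)
    (h : DegreesAtMost H (Δ + 1)) (v : V) (D : ℕ) :
    ((throughPairs H v).filter fun p => H.edist p.1 p.2 ≤ D).card ≤ 8 * (D + 1) * Δ ^ D := by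
  have hsub : ((throughPairs H v).filter fun p => H.edist p.1 p.2 ≤ D) ⊆
      (range (D + 1)).biUnion fun i => sphere H v i ×ˢ closedBall H v (D - i) := by
    rintro ⟨s, t⟩ hp
    obtain ⟨hp, hD⟩ := mem_filter.1 hp
    obtain ⟨-, h1, -⟩ := mem_filter.1 hp
    simp only at h1 hD
    rw [H.edist_comm (u := s) (v := v)] at h1
    rw [← h1] at hD
    simp only [mem_biUnion, mem_product, mem_sphere, mem_closedBall, mem_range]
    generalize H.edist v s = a at *
    generalize H.edist v t = b at *
    have ha : a ≠ ⊤ := by rintro rfl; simp at hD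
    have hb : b ≠ ⊤ := by rintro rfl; simp at hD
    lift a to ℕ using ha
    lift b to ℕ using hb
    norm_cast at hD ⊢
    exact ⟨a, by omega, rfl, by omega⟩
  refine (card_le_card hsub).trans (card_biUnion_le.trans ?_)
  calc _ ≤ ∑ i ∈ range (D + 1), 8 * Δ ^ D := by
        refine sum_le_sum fun i hi => ?_
        rw [card_product]
        have h1 := card_sphere_le_two_mul_pow (by omega) h v i
        have h2 := card_closedBall_le hΔ h v (D - i)
        calc _ ≤ (2 * Δ ^ i) * (4 * Δ ^ (D - i)) := Nat.mul_le_mul h1 h2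
          _ = 8 * (Δ ^ i * Δ ^ (D - i)) := by ring
          _ = _ := by
            rw [← pow_add]
            congr 3
            have := mem_range.1 hi
            omega
    _ = _ := by rw [sum_const, card_range, smul_eq_mul]; ring

/-- The vertices whose sphere of radius `n` has at most half of the size that the degree bound
`Δ + 1` suggests. -/
noncomputable def stuntedVertices (H : SimpleGraph V) (Δ n : ℕ) : Finset V :=
  {s | 2 * (sphere H s n).card ≤ Δ ^ n}

/-- Every stunted vertex in a sphere around `v` is paid for by the growth of the spheres:
the relative size of the sphere drops by half of its relative share after `n` further steps. -/
lemma card_sphere_add_le_of_stunted {H : SimpleGraph V} {Δ : ℕ}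
    (h : DegreesAtMost H (Δ + 1)) (v : V) (n i : ℕ) :
    2 * (sphere H v (i + 1 + n)).card +
      (sphere H v (i + 1) ∩ stuntedVertices H Δ n).card * Δ ^ n ≤
        2 * ((sphere H v (i + 1)).card * Δ ^ n) := by
  have h1 := card_sphere_add_le H v (i + 1) n
  have h2 : ∑ u ∈ sphere H v (i + 1), (2 * (fwd H v u n).card +
      if u ∈ stuntedVertices H Δ n then Δ ^ n else 0) ≤
        ∑ u ∈ sphere H v (i + 1), 2 * Δ ^ n := by
    refine sum_le_sum fun u hu => ?_
    have h3 := card_fwd_le h (mem_sphere.1 hu) n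
    split_ifs with hs
    · have h4 : (fwd H v u n).card ≤ (sphere H u n).card :=
        card_le_card fun z hz => mem_sphere.2 (mem_fwd.1 hz).1
      have h5 := (mem_filter.1 hs).2
      omega
    · omega
  rw [sum_add_distrib, ← mul_sum, sum_const, ← sum_filter, sum_const, filter_mem_eq_inter,
    smul_eq_mul, smul_eq_mul] at h2
  linarith

/-- The drops of a bounded sequence over `n` steps telescope. -/
lemma sum_sub_shift_le {α : ℕ → ℝ} (h0 : ∀ i, 0 ≤ α i) (h2 : ∀ i, α i ≤ 2) (n I : ℕ) :
    ∑ i ∈ range I, (α i - α (i + n)) ≤ 2 * n := by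
  have htel : ∑ i ∈ range I, (α i - α (i + n)) + ∑ i ∈ range n, α (I + i) =
      ∑ i ∈ range n, α i := by
    induction I with
    | zero => simp
    | succ I ih =>
      rw [← ih, sum_range_succ]
      have h1 := sum_range_succ (fun i => α (I + i)) n
      have h2 := sum_range_succ' (fun i => α (I + i)) n
      have h3 : ∑ i ∈ range n, α (I + 1 + i) = ∑ i ∈ range n, α (I + (i + 1)) :=
        sum_congr rfl fun i _ => by congr 1; ring
      rw [h3]
      simp only [add_zero] at h2
      linarith
  have h3 : 0 ≤ ∑ i ∈ range n, α (I + i) := sum_nonneg fun i _ => h0 _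
  have h4 : ∑ i ∈ range n, α i ≤ n * 2 := by
    refine (sum_le_card_nsmul _ _ 2 fun i _ => h2 i).trans ?_
    simp
  linarith

/-- The shares that stunted vertices have in the spheres around `v` add up to `O(n)`. -/
lemma sum_card_stunted_div_le {H : SimpleGraph V} {Δ : ℕ} (hΔ : 1 ≤ Δ)
    (h : DegreesAtMost H (Δ + 1)) (v : V) (n I : ℕ) :
    ∑ i ∈ range (I + 1), ((sphere H v i ∩ stuntedVertices H Δ n).card : ℝ) / (Δ : ℝ) ^ i ≤
      1 + 4 * n := by
  have hΔ0 : (0 : ℝ) < Δ := by exact_mod_cast hΔ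
  set α : ℕ → ℝ := fun i => ((sphere H v (i + 1)).card : ℝ) / (Δ : ℝ) ^ (i + 1) with hα
  have hα0 : ∀ i, 0 ≤ α i := fun i => by positivity
  have hα2 : ∀ i, α i ≤ 2 := fun i => by
    rw [hα]
    simp only
    rw [div_le_iff₀ (by positivity)]
    exact_mod_cast card_sphere_le_two_mul_pow hΔ h v (i + 1)
  have hstep : ∀ i, ((sphere H v (i + 1) ∩ stuntedVertices H Δ n).card : ℝ) / (Δ : ℝ) ^ (i + 1) ≤
      2 * (α i - α (i + n)) := fun i => by
    have h1 : (2 * (sphere H v (i + 1 + n)).card +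
      (sphere H v (i + 1) ∩ stuntedVertices H Δ n).card * (Δ : ℝ) ^ n) ≤
        2 * ((sphere H v (i + 1)).card * (Δ : ℝ) ^ n) := by
      exact_mod_cast card_sphere_add_le_of_stunted h v n i
    have h2 : α (i + n) =
        ((sphere H v (i + 1 + n)).card : ℝ) / ((Δ : ℝ) ^ (i + 1) * (Δ : ℝ) ^ n) := by
      rw [hα]
      simp only
      rw [← pow_add, show i + n + 1 = i + 1 + n by ring]
    rw [h2, hα]
    simp only
    rw [div_le_iff₀ (by positivity)]
    have h3 : (0 : ℝ) < (Δ : ℝ) ^ n := by positivity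
    field_simp
    linarith
  rw [sum_range_succ']
  have hz : ((sphere H v 0 ∩ stuntedVertices H Δ n).card : ℝ) / (Δ : ℝ) ^ 0 ≤ 1 := by
    rw [pow_zero, div_one, sphere_zero]
    exact_mod_cast (card_le_card inter_subset_left).trans (by simp)
  have hsum := sum_sub_shift_le hα0 hα2 n I
  have hmain := sum_le_sum fun i (_ : i ∈ range I) => hstep i
  rw [← mul_sum] at hmain
  linarith

/-- Pairs that have a stunted vertex in the first place and are joined through `v`. -/
lemma card_throughPairs_stunted_le {H : SimpleGraph V} {Δ : ℕ} (hΔ : 2 ≤ Δ)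
    (h : DegreesAtMost H (Δ + 1)) (v : V) (n D : ℕ) :
    (((throughPairs H v).filter fun p =>
      H.edist p.1 p.2 ≤ D ∧ p.1 ∈ stuntedVertices H Δ n).card : ℝ) ≤
        4 * (1 + 4 * n) * (Δ : ℝ) ^ D := by
  have hΔ0 : (0 : ℝ) < Δ := by exact_mod_cast (by omega : 0 < Δ)
  have hsub : ((throughPairs H v).filter fun p =>
      H.edist p.1 p.2 ≤ D ∧ p.1 ∈ stuntedVertices H Δ n) ⊆
      (range (D + 1)).biUnion fun i =>
        (sphere H v i ∩ stuntedVertices H Δ n) ×ˢ closedBall H v (D - i) := by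
    rintro ⟨s, t⟩ hp
    obtain ⟨hp, hD, hb⟩ := mem_filter.1 hp
    obtain ⟨-, h1, -⟩ := mem_filter.1 hp
    simp only at h1 hD hb
    rw [H.edist_comm (u := s) (v := v)] at h1
    rw [← h1] at hD
    simp only [mem_biUnion, mem_product, mem_inter, mem_sphere, mem_closedBall, mem_range]
    generalize H.edist v s = a at *
    generalize H.edist v t = b at *
    have ha : a ≠ ⊤ := by rintro rfl; simp at hD
    have hb : b ≠ ⊤ := by rintro rfl; simp at hD
    lift a to ℕ using ha
    lift b to ℕ using hb
    norm_cast at hD ⊢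
    exact ⟨a, by omega, ⟨rfl, by assumption⟩, by omega⟩
  have hcard : (((throughPairs H v).filter fun p =>
      H.edist p.1 p.2 ≤ D ∧ p.1 ∈ stuntedVertices H Δ n).card : ℝ) ≤
      ∑ i ∈ range (D + 1), ((sphere H v i ∩ stuntedVertices H Δ n) ×ˢ
        closedBall H v (D - i)).card := by
    exact_mod_cast (card_le_card hsub).trans card_biUnion_le
  refine hcard.trans ?_
  rw [Nat.cast_sum]
  calc _ ≤ ∑ i ∈ range (D + 1), 4 * (Δ : ℝ) ^ D *
          (((sphere H v i ∩ stuntedVertices H Δ n).card : ℝ) / (Δ : ℝ) ^ i) := by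
        refine sum_le_sum fun i hi => ?_
        rw [card_product, Nat.cast_mul]
        have h2 : ((closedBall H v (D - i)).card : ℝ) ≤ 4 * (Δ : ℝ) ^ (D - i) := by
          exact_mod_cast card_closedBall_le hΔ h v (D - i)
        have h3 : (Δ : ℝ) ^ D = (Δ : ℝ) ^ (D - i) * (Δ : ℝ) ^ i := by
          rw [← pow_add, Nat.sub_add_cancel (by have := mem_range.1 hi; omega)]
        calc _ ≤ ((sphere H v i ∩ stuntedVertices H Δ n).card : ℝ) * (4 * (Δ : ℝ) ^ (D - i)) := by
              gcongr
          _ = _ := by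
              rw [h3]
              field_simp
    _ ≤ 4 * (Δ : ℝ) ^ D * (1 + 4 * n) := by
        rw [← mul_sum]
        gcongr
        exact sum_card_stunted_div_le (by omega) h v n D
    _ = _ := by ring

/-- If all distances are at most `D'`, and those between two vertices that are not stunted even at
most `D`, then few pairs have a geodesic through a given vertex `v`.  For a pair at distance at
most `D`, there are `D + 1` positions for `v` on the geodesic.  A pair at a greater distance has a
stunted end, and as stunted vertices are rare, the factor `1 + 4 * n` replaces the number of
positions. -/
lemma card_throughPairs_le {H : SimpleGraph V} {Δ : ℕ} (hΔ : 2 ≤ Δ)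
    (h : DegreesAtMost H (Δ + 1)) {n D D' : ℕ} (hD' : ∀ s t, H.edist s t ≤ D')
    (hD : ∀ s t, s ∉ stuntedVertices H Δ n → t ∉ stuntedVertices H Δ n → H.edist s t ≤ D) (v : V) :
    ((throughPairs H v).card : ℝ) ≤
      8 * (D + 1) * (Δ : ℝ) ^ D + 8 * (1 + 4 * n) * (Δ : ℝ) ^ D' := by
  set A := (throughPairs H v).filter fun p => H.edist p.1 p.2 ≤ D
  set B := (throughPairs H v).filter fun p =>
    H.edist p.1 p.2 ≤ D' ∧ p.1 ∈ stuntedVertices H Δ n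
  have hsub : throughPairs H v ⊆ A ∪ (B ∪ B.image Prod.swap) := by
    rintro ⟨s, t⟩ hp
    by_cases hs : s ∈ stuntedVertices H Δ n
    · exact mem_union_right _ (mem_union_left _ (mem_filter.2 ⟨hp, hD' _ _, hs⟩))
    by_cases ht : t ∈ stuntedVertices H Δ n
    · refine mem_union_right _ (mem_union_right _ (mem_image.2 ⟨(t, s), ?_, rfl⟩))
      refine mem_filter.2 ⟨?_, hD' _ _, ht⟩
      obtain ⟨-, h1, h2⟩ := mem_filter.1 hp
      refine mem_filter.2 ⟨mem_univ _, ?_, ?_⟩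
      · simp only at h1 ⊢
        rw [H.edist_comm (u := t) (v := v), H.edist_comm (u := v) (v := s),
          H.edist_comm (u := t) (v := s), add_comm, h1]
      · simp only at h2 ⊢
        rwa [H.edist_comm]
    · exact mem_union_left _ (mem_filter.2 ⟨hp, hD _ _ hs ht⟩)
  have h1 : (throughPairs H v).card ≤ A.card + (B.card + B.card) := by
    refine (card_le_card hsub).trans ((card_union_le _ _).trans (Nat.add_le_add_left ?_ _))
    exact (card_union_le _ _).trans (Nat.add_le_add_left card_image_le _)
  have hA : (A.card : ℝ) ≤ 8 * (D + 1) * (Δ : ℝ) ^ D := by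
    exact_mod_cast card_throughPairs_filter_le hΔ h v D
  have hB := card_throughPairs_stunted_le hΔ h v n D'
  have h1' : ((throughPairs H v).card : ℝ) ≤ A.card + (B.card + B.card) := by exact_mod_cast h1
  change (B.card : ℝ) ≤ _ at hB
  linarith

end Counting

/-! ### Revealing the random matching one partner at a time -/

section Exposure

open Classical Finset

variable {V : Type*}

/-- The mean of `f` over the graphs that `n` rounds of `matchingRounds` produce. -/
noncomputable def roundsMean (f : SimpleGraph V → ℝ) : ℕ → Finset V → SimpleGraph V → ℝ
  | 0, _, G => f G
  | n + 1, S, G =>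
    if S.offDiag.Nonempty then
      (∑ p ∈ S.offDiag, roundsMean f n (S \ {p.1, p.2}) (G ⊔ SimpleGraph.edge p.1 p.2)) /
        (S.offDiag.card : ℝ)
    else f G

/-- The mean of `f` over the graph obtained from `G` by adding a random matching of `S`. -/
noncomputable def matchingMean (f : SimpleGraph V → ℝ) (S : Finset V) (G : SimpleGraph V) : ℝ :=
  roundsMean f S.card S G

lemma card_sdiff_pair_of_mem_offDiag {S : Finset V} {p : V × V} (hp : p ∈ S.offDiag) :
    (S \ {p.1, p.2}).card + 2 = S.card := by
  obtain ⟨h1, h2, h3⟩ := mem_offDiag.1 hp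
  have hsub : ({p.1, p.2} : Finset V) ⊆ S := by
    intro x hx
    rcases mem_insert.1 hx with rfl | hx
    · exact h1
    · rwa [mem_singleton.1 hx]
  have h4 := card_sdiff_add_card_eq_card hsub
  rwa [card_pair h3] at h4

lemma roundsMean_succ_eq (f : SimpleGraph V → ℝ) {n : ℕ} {S : Finset V} (h : S.card ≤ n)
    (G : SimpleGraph V) : roundsMean f (n + 1) S G = roundsMean f n S G := by
  induction n generalizing S G with
  | zero =>
    have : S = ∅ := card_eq_zero.1 (by omega)
    subst this
    simp [roundsMean]
  | succ n ih =>
    rw [roundsMean, roundsMean]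
    split_ifs with hS
    · congr 1
      refine sum_congr rfl fun p hp => ih ?_ _
      have := card_sdiff_pair_of_mem_offDiag hp
      omega
    · rfl

lemma roundsMean_eq_matchingMean (f : SimpleGraph V → ℝ) {n : ℕ} {S : Finset V}
    (h : S.card ≤ n) (G : SimpleGraph V) : roundsMean f n S G = matchingMean f S G := by
  induction n, h using Nat.le_induction with
  | base => rfl
  | succ n hn ih => rw [roundsMean_succ_eq f hn, ih]

lemma matchingMean_of_card_le_one (f : SimpleGraph V → ℝ) {S : Finset V} (h : S.card ≤ 1)
    (G : SimpleGraph V) : matchingMean f S G = f G := by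
  rw [← roundsMean_eq_matchingMean f (n := 2) (by omega), roundsMean, if_neg]
  rintro ⟨p, hp⟩
  have := card_sdiff_pair_of_mem_offDiag hp
  omega

lemma card_mul_matchingMean (f : SimpleGraph V → ℝ) (S : Finset V) (G : SimpleGraph V) :
    (S.card : ℝ) * (S.card - 1) * matchingMean f S G =
      ∑ p ∈ S.offDiag, matchingMean f (S \ {p.1, p.2}) (G ⊔ SimpleGraph.edge p.1 p.2) := by
  have hcard : (S.offDiag.card : ℝ) = S.card * (S.card - 1) := by
    rw [offDiag_card, Nat.cast_sub (Nat.le_mul_self _)]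
    push_cast
    ring
  rcases S.offDiag.eq_empty_or_nonempty with h | h
  · rw [← hcard, h]
    simp
  · rw [← roundsMean_eq_matchingMean f (Nat.le_succ _), roundsMean, if_pos h, ← hcard,
      mul_div_cancel₀]
    · refine sum_congr rfl fun p hp => roundsMean_eq_matchingMean f ?_ _
      have := card_sdiff_pair_of_mem_offDiag hp
      omega
    · exact_mod_cast h.card_ne_zero

lemma sum_offDiag_eq (S : Finset V) (φ : V × V → ℝ) :
    ∑ p ∈ S.offDiag, φ p = ∑ a ∈ S, ∑ b ∈ S, if a ≠ b then φ (a, b) else 0 := by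
  rw [← sum_product (s := S) (t := S) (f := fun a : V × V => if a.1 ≠ a.2 then φ (a.1, a.2) else 0),
    ← sum_filter]
  refine sum_congr ?_ fun _ _ => rfl
  ext p
  simp [mem_offDiag, and_assoc]

/-- The probability that the random matching of a set of `t + 1` vertices leaves a given vertex
alone. -/
noncomputable def aloneProb (t : ℕ) : ℝ := if Even t then 1 / (t + 1) else 0

/-- The probability that the random matching of a set of `t + 1` vertices joins two given
vertices. -/
noncomputable def partnerProb (t : ℕ) : ℝ := if Even t then 1 / (t + 1) else 1 / t

/-- The partner of a given vertex `u` may be revealed first: it is uniformly distributed, and the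
rest of the matching is a random matching of the remaining vertices. -/
lemma matchingMean_insert (f : SimpleGraph V → ℝ) (T : Finset V) {u : V} (hu : u ∉ T)
    (G : SimpleGraph V) :
    matchingMean f (insert u T) G = aloneProb T.card * matchingMean f T G +
      partnerProb T.card * ∑ w ∈ T, matchingMean f (T.erase w) (G ⊔ SimpleGraph.edge u w) := by
  induction hT : T.card using Nat.strong_induction_on generalizing T G with
  | _ t IH =>
  rcases Nat.eq_zero_or_pos t with rfl | ht
  · have : T = ∅ := card_eq_zero.1 hT
    subst this
    rw [matchingMean_of_card_le_one _ (by simp), matchingMean_of_card_le_one _ (by simp)]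
    simp [aloneProb]
  set X := ∑ w ∈ T, matchingMean f (T.erase w) (G ⊔ SimpleGraph.edge u w) with hX
  have hne : ∀ a ∈ T, a ≠ u := fun a ha h => hu (h ▸ ha)
  -- sort the first pairs by whether they contain `u`
  have hsplit : ((t : ℝ) + 1) * t * matchingMean f (insert u T) G = 2 * X +
      ∑ p ∈ T.offDiag,
        matchingMean f (insert u (T \ {p.1, p.2})) (G ⊔ SimpleGraph.edge p.1 p.2) := by
    have h0 := card_mul_matchingMean f (insert u T) G
    rw [card_insert_of_notMem hu, hT, sum_offDiag_eq, sum_insert hu, sum_insert hu] at h0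
    rw [sum_offDiag_eq]
    push_cast at h0
    have h1 : ∑ b ∈ T, (if u ≠ b then matchingMean f (insert u T \ {u, b})
        (G ⊔ SimpleGraph.edge u b) else 0) = X := by
      refine sum_congr rfl fun b hb => ?_
      rw [if_pos (hne b hb).symm]
      congr 1
      ext x
      simp only [Finset.mem_sdiff, mem_insert, mem_singleton, mem_erase]
      have := fun h : x ∈ T => hne x h
      tauto
    have h2 : ∑ a ∈ T, ∑ b ∈ insert u T, (if a ≠ b then matchingMean f (insert u T \ {a, b})
        (G ⊔ SimpleGraph.edge a b) else 0) = X + ∑ a ∈ T, ∑ b ∈ T, (if a ≠ b then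
          matchingMean f (insert u (T \ {a, b})) (G ⊔ SimpleGraph.edge a b) else 0) := by
      rw [hX, ← sum_add_distrib]
      refine sum_congr rfl fun a ha => ?_
      rw [sum_insert hu, if_pos (hne a ha)]
      congr 1
      · rw [SimpleGraph.edge_comm]
        congr 1
        ext x
        simp only [Finset.mem_sdiff, mem_insert, mem_singleton, mem_erase]
        have := fun h : x ∈ T => hne x h
        tauto
      · refine sum_congr rfl fun b hb => ?_
        split_ifs
        · congr 1
          ext x
          simp only [Finset.mem_sdiff, mem_insert, mem_singleton]
          have h3 := (hne a ha).symm
          have h4 := (hne b hb).symm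
          constructor
          · tauto
          · rintro (rfl | h)
            · exact ⟨.inl rfl, by tauto⟩
            · tauto
        · rfl
    simp only [ne_eq, not_true_eq_false, if_false, zero_add] at h0 h1 h2 ⊢
    rw [h1, h2] at h0
    linarith
  -- in the pairs without `u`, the partner of `u` is revealed next
  have hIH : ∀ p ∈ T.offDiag,
      matchingMean f (insert u (T \ {p.1, p.2})) (G ⊔ SimpleGraph.edge p.1 p.2) =
      aloneProb (t - 2) * matchingMean f (T \ {p.1, p.2}) (G ⊔ SimpleGraph.edge p.1 p.2) +
      partnerProb (t - 2) * ∑ w ∈ T \ {p.1, p.2}, matchingMean f ((T \ {p.1, p.2}).erase w)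
        (G ⊔ SimpleGraph.edge p.1 p.2 ⊔ SimpleGraph.edge u w) := by
    intro p hp
    have hc := card_sdiff_pair_of_mem_offDiag hp
    have hc' : (T \ {p.1, p.2}).card = t - 2 := by omega
    exact IH (t - 2) (by omega) _ (fun h => hu (Finset.mem_sdiff.1 h).1) _ hc'
  have hZ := card_mul_matchingMean f T G
  have hY : ∑ p ∈ T.offDiag, ∑ w ∈ T \ {p.1, p.2}, matchingMean f ((T \ {p.1, p.2}).erase w)
        (G ⊔ SimpleGraph.edge p.1 p.2 ⊔ SimpleGraph.edge u w) =
      ((t : ℝ) - 1) * (t - 2) * X := by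
    have h1 : ((t : ℝ) - 1) * (t - 2) * X = ∑ w ∈ T, ∑ p ∈ (T.erase w).offDiag,
        matchingMean f (T.erase w \ {p.1, p.2})
          (G ⊔ SimpleGraph.edge u w ⊔ SimpleGraph.edge p.1 p.2) := by
      rw [hX, mul_sum]
      refine sum_congr rfl fun w hw => ?_
      rw [← card_mul_matchingMean, card_erase_of_mem hw, hT, Nat.cast_sub ht]
      push_cast
      ring
    rw [h1, sum_sigma', sum_sigma']
    refine sum_bij' (fun x _ => ⟨x.2, x.1⟩) (fun x _ => ⟨x.2, x.1⟩) ?_ ?_ ?_ ?_ ?_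
    · rintro ⟨⟨a, b⟩, w⟩ h
      simp only [mem_sigma, mem_offDiag, Finset.mem_sdiff, mem_insert, mem_singleton,
        mem_erase] at h ⊢
      grind
    · rintro ⟨w, a, b⟩ h
      simp only [mem_sigma, mem_offDiag, Finset.mem_sdiff, mem_insert, mem_singleton,
        mem_erase] at h ⊢
      grind
    · intro x _; rfl
    · intro x _; rfl
    · rintro ⟨⟨a, b⟩, w⟩ h
      simp only
      rw [sup_right_comm]
      congr 1
      ext x
      simp only [Finset.mem_sdiff, mem_insert, mem_singleton, mem_erase]
      tauto
  rw [sum_congr rfl hIH, sum_add_distrib, ← mul_sum, ← mul_sum, hY, ← hZ, hT] at hsplit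
  have ht0 : (0 : ℝ) < t := by exact_mod_cast ht
  refine mul_left_cancel₀ (a := ((t : ℝ) + 1) * t) (by positivity) ?_
  rw [hsplit]
  generalize matchingMean f T G = Z
  rcases Nat.even_or_odd t with he | ho
  · have h2 : 2 ≤ t := by
      obtain ⟨r, rfl⟩ := he
      omega
    have he' : Even (t - 2) := by
      rw [Nat.even_sub h2]
      simpa using he
    have hr : ((t - 2 : ℕ) : ℝ) + 1 = t - 1 := by
      rw [Nat.cast_sub h2]; push_cast; ring
    have hr1 : (t : ℝ) - 1 ≠ 0 := by
      have : (2 : ℝ) ≤ t := by exact_mod_cast h2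
      intro h
      linarith
    rw [aloneProb, partnerProb, aloneProb, partnerProb, if_pos he', if_pos he', if_pos he,
      if_pos he, hr]
    field_simp
    ring
  · have hne' : ¬ Even t := Nat.not_even_iff_odd.2 ho
    rcases (by omega : t = 1 ∨ 3 ≤ t ∨ t = 2) with rfl | h3 | rfl
    · norm_num [aloneProb, partnerProb]
    · have hne2 : ¬ Even (t - 2) := by
        rw [Nat.even_sub (by omega)]
        simpa using hne'
      have hr : ((t - 2 : ℕ) : ℝ) = t - 2 := by
        rw [Nat.cast_sub (by omega)]; push_cast; ring
      have hr1 : (t : ℝ) - 2 ≠ 0 := by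
        have : (3 : ℝ) ≤ t := by exact_mod_cast h3
        intro h
        linarith
      rw [aloneProb, partnerProb, aloneProb, partnerProb, if_neg hne', if_neg hne', if_neg hne2,
        if_neg hne2, hr]
      field_simp
      ring
    · exact absurd (by decide) hne'

/-- Revealing the partner `w` of `u ∈ S`, where `w = u` stands for the event that `u` is left alone.
Every vertex has probability at most `1 / (|S| - 1)`, and every vertex other than `u` at least
`1 / |S|`; whether `|S|` is even decides which of the two it is. -/
lemma exists_matchingMean_eq_sum {S : Finset V} {u : V} (hu : u ∈ S) :
    ∃ p : V → ℝ, (∀ w, 0 ≤ p w) ∧ ∑ w ∈ S, p w = 1 ∧ (∀ w, p w * (S.card - 1) ≤ 1) ∧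
      (∀ w, w ≠ u → 1 ≤ p w * S.card) ∧ ∀ (f : SimpleGraph V → ℝ) (G : SimpleGraph V),
        matchingMean f S G =
          ∑ w ∈ S, p w * matchingMean f (S \ {u, w}) (G ⊔ SimpleGraph.edge u w) := by
  obtain ⟨T, hT, rfl⟩ : ∃ T, u ∉ T ∧ insert u T = S := ⟨S.erase u, by simp, insert_erase hu⟩
  have hc : ((insert u T).card : ℝ) = T.card + 1 := by
    rw [card_insert_of_notMem hT]; push_cast; ring
  have hne : ∀ w ∈ T, w ≠ u := fun a ha h => hT (h ▸ ha)
  set t := T.card with ht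
  refine ⟨fun w => if w = u then aloneProb t else partnerProb t, ?_, ?_, ?_, ?_, ?_⟩
  · intro w
    simp only [aloneProb, partnerProb]
    split_ifs <;> positivity
  · rw [sum_insert hT, if_pos rfl, sum_congr rfl fun w hw => if_neg (hne w hw), sum_const,
      nsmul_eq_mul, ← ht, aloneProb, partnerProb]
    split_ifs with h
    · field_simp
      ring
    · have : (t : ℝ) ≠ 0 := by
        intro h0
        exact h (by rw [Nat.cast_eq_zero.1 h0]; exact Even.zero)
      field_simp
      simp
  · intro w
    rw [hc, add_sub_cancel_right]
    have h1 : 1 / ((t : ℝ) + 1) * t ≤ 1 := by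
      rw [div_mul_eq_mul_div, div_le_one (by positivity)]
      linarith
    simp only [aloneProb, partnerProb]
    split_ifs
    · exact h1
    · simp
    · exact h1
    · rcases eq_or_ne (t : ℝ) 0 with h0 | h0
      · simp [h0]
      · rw [div_mul_cancel₀ _ h0]
  · intro w hw
    simp only [hc, if_neg hw, partnerProb]
    split_ifs with h
    · field_simp
      simp
    · have : (0 : ℝ) < t := by
        rcases Nat.eq_zero_or_pos t with h0 | h0
        · exact absurd (by rw [h0]; exact Even.zero) h
        · exact_mod_cast h0
      rw [div_mul_eq_mul_div, le_div_iff₀ this]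
      linarith
  · intro f G
    rw [matchingMean_insert f T hT, sum_insert hT, mul_sum]
    simp only [if_true]
    congr 1
    · congr 2
      · ext x
        simp only [Finset.mem_sdiff, mem_insert, mem_singleton]
        have := fun h : x ∈ T => hne x h
        tauto
      · simp
    · refine sum_congr rfl fun w hw => ?_
      simp only [if_neg (hne w hw)]
      congr 2
      ext x
      simp only [Finset.mem_sdiff, mem_insert, mem_singleton, mem_erase]
      have := fun h : x ∈ T => hne x h
      tauto

end Exposure

/-! ### Graphs with an added matching -/

section MatchingMean

open Classical Finset

variable {V : Type*}

/-- `H` arises from `G` by adding a matching of vertices in `S`. -/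
def IsMatchingExtension (S : Finset V) (G H : SimpleGraph V) : Prop :=
  G ≤ H ∧ (∀ x ∉ S, ∀ y, H.Adj x y → G.Adj x y) ∧
    ∀ x y z, H.Adj x y → ¬ G.Adj x y → H.Adj x z → ¬ G.Adj x z → y = z

lemma isMatchingExtension_self (S : Finset V) (G : SimpleGraph V) : IsMatchingExtension S G G :=
  ⟨le_rfl, fun _ _ _ h => h, fun _ _ _ h h' => absurd h h'⟩

lemma IsMatchingExtension.of_step {S : Finset V} {G H : SimpleGraph V} {a b : V} (ha : a ∈ S)
    (hb : b ∈ S) (h : IsMatchingExtension (S \ {a, b}) (G ⊔ SimpleGraph.edge a b) H) :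
    IsMatchingExtension S G H := by
  obtain ⟨h1, h2, h3⟩ := h
  refine ⟨le_sup_left.trans h1, ?_, ?_⟩
  · intro x hx y hxy
    have := h2 x (fun h => hx (Finset.mem_sdiff.1 h).1) y hxy
    rw [SimpleGraph.sup_adj, SimpleGraph.edge_adj] at this
    rcases this with h | ⟨⟨rfl, -⟩ | ⟨rfl, -⟩, -⟩
    · exact h
    · exact absurd ha hx
    · exact absurd hb hx
  · intro x y z hy hy' hz hz'
    by_cases hx : x ∈ ({a, b} : Finset V)
    · have hxS : x ∉ S \ {a, b} := fun h => (Finset.mem_sdiff.1 h).2 hx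
      have e1 := h2 x hxS y hy
      have e2 := h2 x hxS z hz
      rw [SimpleGraph.sup_adj, SimpleGraph.edge_adj] at e1 e2
      grind
    · have key : ∀ y, ¬ G.Adj x y → ¬ (G ⊔ SimpleGraph.edge a b).Adj x y := by
        intro y hy
        rw [SimpleGraph.sup_adj, SimpleGraph.edge_adj]
        simp only [mem_insert, mem_singleton, not_or] at hx
        tauto
      exact h3 x y z hy (key y hy') hz (key z hz')

lemma IsMatchingExtension.degreesAtMost [Fintype V] {S : Finset V} {G H : SimpleGraph V} {k : ℕ}
    (h : IsMatchingExtension S G H) (hG : DegreesAtMost G k) : DegreesAtMost H (k + 1) := by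
  intro x
  have hsub : H.neighborSet x ⊆ G.neighborSet x ∪ (H.neighborSet x \ G.neighborSet x) := by
    intro y hy
    by_cases hy' : y ∈ G.neighborSet x
    · exact .inl hy'
    · exact .inr ⟨hy, hy'⟩
  have hone : (H.neighborSet x \ G.neighborSet x).ncard ≤ 1 := by
    refine (Set.ncard_le_one (Set.toFinite _)).2 ?_
    rintro y ⟨hy, hy'⟩ z ⟨hz, hz'⟩
    exact h.2.2 x y z hy hy' hz hz'
  calc _ ≤ _ := Set.ncard_le_ncard hsub (Set.toFinite _)
    _ ≤ _ := Set.ncard_union_le _ _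
    _ ≤ k + 1 := Nat.add_le_add (hG x) hone

lemma roundsMean_mono {f g : SimpleGraph V → ℝ} {n : ℕ} {S : Finset V} {G : SimpleGraph V}
    (h : ∀ H, IsMatchingExtension S G H → f H ≤ g H) :
    roundsMean f n S G ≤ roundsMean g n S G := by
  induction n generalizing S G with
  | zero => exact h G (isMatchingExtension_self S G)
  | succ n ih =>
    rw [roundsMean, roundsMean]
    split_ifs with hS
    · refine div_le_div_of_nonneg_right (sum_le_sum fun p hp => ih fun H hH => ?_)
        (Nat.cast_nonneg _)
      obtain ⟨h1, h2, -⟩ := mem_offDiag.1 hp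
      exact h H (hH.of_step h1 h2)
    · exact h G (isMatchingExtension_self S G)

/-- Only the graphs that extend `G` by a matching of `S` matter for the mean. -/
lemma matchingMean_mono {f g : SimpleGraph V → ℝ} {S : Finset V} {G : SimpleGraph V}
    (h : ∀ H, IsMatchingExtension S G H → f H ≤ g H) :
    matchingMean f S G ≤ matchingMean g S G :=
  roundsMean_mono h

lemma roundsMean_one_sub_sum {ι : Type*} (I : Finset ι) (f : ι → SimpleGraph V → ℝ) (n : ℕ)
    (S : Finset V) (G : SimpleGraph V) :
    roundsMean (fun H => 1 - ∑ i ∈ I, f i H) n S G = 1 - ∑ i ∈ I, roundsMean (f i) n S G := by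
  induction n generalizing S G with
  | zero => rfl
  | succ n ih =>
    simp only [roundsMean]
    split_ifs with hS
    · have h0 : (S.offDiag.card : ℝ) ≠ 0 := by exact_mod_cast hS.card_ne_zero
      simp only [ih]
      rw [sum_sub_distrib, sum_comm, ← sum_div, sub_div, sum_const, nsmul_eq_mul, mul_one,
        div_self h0]
    · rfl

lemma matchingMean_one_sub_sum {ι : Type*} (I : Finset ι) (f : ι → SimpleGraph V → ℝ)
    (S : Finset V) (G : SimpleGraph V) :
    matchingMean (fun H => 1 - ∑ i ∈ I, f i H) S G = 1 - ∑ i ∈ I, matchingMean (f i) S G :=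
  roundsMean_one_sub_sum I f _ S G

lemma roundsMean_const (c : ℝ) (n : ℕ) (S : Finset V) (G : SimpleGraph V) :
    roundsMean (fun _ => c) n S G = c := by
  induction n generalizing S G with
  | zero => rfl
  | succ n ih =>
    simp only [roundsMean]
    split_ifs with hS
    · have h0 : (S.offDiag.card : ℝ) ≠ 0 := by exact_mod_cast hS.card_ne_zero
      simp only [ih]
      rw [sum_const, nsmul_eq_mul, mul_div_cancel_left₀ _ h0]
    · rfl

lemma matchingMean_const (c : ℝ) (S : Finset V) (G : SimpleGraph V) :
    matchingMean (fun _ => c) S G = c :=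
  roundsMean_const c _ S G

lemma matchingMean_eq_zero {f : SimpleGraph V → ℝ} {S : Finset V} {G : SimpleGraph V}
    (h : ∀ H, IsMatchingExtension S G H → f H = 0) : matchingMean f S G = 0 :=
  le_antisymm ((matchingMean_mono fun H hH => (h H hH).le).trans_eq (matchingMean_const 0 S G))
    ((matchingMean_const 0 S G).symm.trans_le (matchingMean_mono fun H hH => (h H hH).ge))

/-- `roundsMean` is the expectation with respect to the law `matchingRounds`. -/
lemma toOuterMeasure_matchingRounds (A : Set (SimpleGraph V)) (n : ℕ) (S : Finset V)
    (G : SimpleGraph V) :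
    (matchingRounds n S G).toOuterMeasure A =
      ENNReal.ofReal (roundsMean (A.indicator 1) n S G) := by
  have hpure : ∀ G : SimpleGraph V, (PMF.pure G).toOuterMeasure A =
      ENNReal.ofReal (A.indicator 1 G) := by
    intro G
    rw [PMF.toOuterMeasure_pure_apply, Set.indicator_apply]
    split_ifs <;> simp
  have hnonneg : ∀ n (S : Finset V) (G : SimpleGraph V),
      0 ≤ roundsMean (A.indicator 1) n S G := by
    intro n S G
    rw [← roundsMean_const 0 n S G]
    exact roundsMean_mono fun H _ => Set.indicator_nonneg (fun _ _ => zero_le_one) _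
  induction n generalizing S G with
  | zero => exact hpure G
  | succ n ih =>
    rw [matchingRounds, roundsMean]
    split_ifs with hS
    · rw [PMF.toOuterMeasure_bind_apply, tsum_eq_sum (s := S.offDiag)]
      · rw [sum_div, ENNReal.ofReal_sum_of_nonneg]
        · refine sum_congr rfl fun p hp => ?_
          have h0 : (0 : ℝ) < S.offDiag.card := by exact_mod_cast hS.card_pos
          rw [PMF.uniformOfFinset_apply, if_pos hp, ih, div_eq_inv_mul,
            ENNReal.ofReal_mul (by positivity), ENNReal.ofReal_inv_of_pos h0,
            ENNReal.ofReal_natCast]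
        · intro p _
          exact div_nonneg (hnonneg _ _ _) (Nat.cast_nonneg _)
      · intro p hp
        rw [PMF.uniformOfFinset_apply, if_neg hp, zero_mul]
    · exact hpure G

variable [Fintype V]

/-- If every event of a finite family is unlikely, then with high probability none of them happens
to the graph obtained by adding a random matching. -/
lemma ofReal_le_addRandomMatching {ι : Type*} (I : Finset ι) (F : ι → SimpleGraph V → Prop)
    (A : Set (SimpleGraph V)) (G : SimpleGraph V)
    (hA : ∀ H, IsMatchingExtension univ G H → (∀ i ∈ I, ¬ F i H) → H ∈ A) {δ η : ℝ}
    (hF : ∀ i ∈ I, matchingMean (fun H => if F i H then 1 else 0) univ G ≤ δ)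
    (hη : I.card * δ ≤ η) :
    ENNReal.ofReal (1 - η) ≤ (addRandomMatching G).toOuterMeasure A := by
  rw [addRandomMatching, toOuterMeasure_matchingRounds]
  refine ENNReal.ofReal_le_ofReal ?_
  calc 1 - η ≤ 1 - ∑ i ∈ I, matchingMean (fun H => if F i H then 1 else 0) univ G := by
        have := sum_le_card_nsmul _ _ _ hF
        rw [nsmul_eq_mul] at this
        linarith
    _ = matchingMean (fun H => 1 - ∑ i ∈ I, if F i H then (1 : ℝ) else 0) univ G :=
        (matchingMean_one_sub_sum I _ univ G).symm
    _ ≤ matchingMean (A.indicator 1) univ G := by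
        refine matchingMean_mono fun H hH => ?_
        by_cases h : ∀ i ∈ I, ¬ F i H
        · rw [Set.indicator_of_mem (hA H hH h), Pi.one_apply, sub_le_self_iff]
          exact sum_nonneg fun i _ => by split_ifs <;> norm_num
        · push Not at h
          obtain ⟨i, hi, hFi⟩ := h
          have h1 : (1 : ℝ) ≤ ∑ i ∈ I, if F i H then (1 : ℝ) else 0 := by
            have := single_le_sum (f := fun i => if F i H then (1 : ℝ) else 0)
              (fun i _ => by split_ifs <;> norm_num) hi
            simpa [hFi] using this
          have h2 : (0 : ℝ) ≤ A.indicator 1 H :=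
            Set.indicator_nonneg (fun _ _ => zero_le_one) _
          linarith
    _ = _ := by
        rw [matchingMean, card_univ]

end MatchingMean

/-! ### How far a ball is from a ball of the regular tree -/

section Branching

open Classical Finset

variable {V : Type*} [Fintype V]

/-- The sum of `k⁻⁽ᵈ⁺¹⁾` over the vertices at distance `1 ≤ d ≤ R` from `w`, where `k = Δ + 1`.
If `w` is the partner of `u` in the matching, a vertex at distance `d` from `w` is reached from `u`
in `d + 1` steps; with weight `k⁻ⁿ` for a vertex reached in `n` steps, `branchWeight` is the weight
that replaces the weight `1` of `u`.  It is at most `1`, with near equality if the ball is nearly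
a ball of the `k`-regular tree and `R` is large. -/
noncomputable def branchWeight (Γ : SimpleGraph V) (Δ R : ℕ) (w : V) : ℝ :=
  ∑ d ∈ range R, ((sphere Γ w (d + 1)).card : ℝ) / ((Δ : ℝ) + 1) ^ (d + 2)

/-- The weighted number of descendants of `u`, seen from `x`, that are missing in comparison with
the `(Δ + 1)`-regular tree. -/
noncomputable def deficit (Γ : SimpleGraph V) (Δ J : ℕ) (x u : V) : ℝ :=
  ∑ i ∈ range (J + 1), ((Δ : ℝ) ^ i - ((fwd Γ x u i).card : ℝ)) / ((Δ : ℝ) + 1) ^ (i + 1)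

lemma sum_pow_div_pow_succ (Δ n : ℕ) :
    ∑ i ∈ range n, (Δ : ℝ) ^ i / ((Δ : ℝ) + 1) ^ (i + 1) = 1 - ((Δ : ℝ) / (Δ + 1)) ^ n := by
  have h0 : (Δ : ℝ) + 1 ≠ 0 := by positivity
  induction n with
  | zero => simp
  | succ n ih =>
    rw [sum_range_succ, ih, div_pow, div_pow]
    field_simp
    ring

lemma branchWeight_nonneg (Γ : SimpleGraph V) (Δ R : ℕ) (w : V) : 0 ≤ branchWeight Γ Δ R w :=
  sum_nonneg fun _ _ => by positivity

lemma branchWeight_le_one {Γ : SimpleGraph V} {Δ : ℕ} (h : DegreesAtMost Γ (Δ + 1)) (R : ℕ)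
    (w : V) : branchWeight Γ Δ R w ≤ 1 := by
  calc branchWeight Γ Δ R w ≤ ∑ d ∈ range R, (Δ : ℝ) ^ d / ((Δ : ℝ) + 1) ^ (d + 1) := by
        refine sum_le_sum fun d _ => ?_
        have h1 : ((sphere Γ w (d + 1)).card : ℝ) ≤ (Δ + 1) * (Δ : ℝ) ^ d := by
          exact_mod_cast card_sphere_le h w d
        rw [div_le_div_iff₀ (by positivity) (by positivity), pow_succ _ (d + 1)]
        have h2 : (0 : ℝ) ≤ ((Δ : ℝ) + 1) ^ (d + 1) := by positivity
        nlinarith [mul_le_mul_of_nonneg_right h1 h2]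
    _ = 1 - ((Δ : ℝ) / (Δ + 1)) ^ R := sum_pow_div_pow_succ Δ R
    _ ≤ 1 := by
        have : 0 ≤ ((Δ : ℝ) / (Δ + 1)) ^ R := by positivity
        linarith

lemma deficit_nonneg {Γ : SimpleGraph V} {Δ : ℕ} (h : DegreesAtMost Γ (Δ + 1)) (J : ℕ) {x u : V}
    {i : ℕ} (hu : Γ.edist x u = (i + 1 : ℕ)) : 0 ≤ deficit Γ Δ J x u := by
  refine sum_nonneg fun j _ => div_nonneg ?_ (by positivity)
  rw [sub_nonneg]
  exact_mod_cast card_fwd_le h hu j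

/-- The vertex before `y` on a chosen geodesic from `x` to `y`. -/
noncomputable def parent (Γ : SimpleGraph V) (x y : V) : V :=
  if h : ∃ u, Γ.Adj u y ∧ Γ.edist x y = Γ.edist x u + 1 then h.choose else y

lemma parent_spec {Γ : SimpleGraph V} {x y : V} {i : ℕ} (h : Γ.edist x y = (i + 1 : ℕ)) :
    Γ.Adj (parent Γ x y) y ∧ Γ.edist x (parent Γ x y) = i := by
  have hex : ∃ u, Γ.Adj u y ∧ Γ.edist x y = Γ.edist x u + 1 := by
    obtain ⟨u, hu, hu'⟩ := exists_adj_edist_eq h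
    exact ⟨u, hu, by rw [h, hu']; push_cast; rfl⟩
  rw [parent, dif_pos hex]
  refine ⟨hex.choose_spec.1, ?_⟩
  have h1 := h.symm.trans hex.choose_spec.2
  push_cast at h1
  generalize Γ.edist x hex.choose = a at *
  enat_to_nat
  omega

lemma edist_parent_iterate {Γ : SimpleGraph V} {x y : V} {m : ℕ} (l : ℕ)
    (h : Γ.edist x y = (m + l : ℕ)) : Γ.edist x ((parent Γ x)^[l] y) = m := by
  induction l generalizing y with
  | zero => simpa using h
  | succ l ih =>
    rw [Function.iterate_succ_apply]
    exact ih (parent_spec (i := m + l) h).2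

lemma edist_parent_iterate_le {Γ : SimpleGraph V} {x y : V} {m : ℕ} (l : ℕ)
    (h : Γ.edist x y = (m + l : ℕ)) : Γ.edist ((parent Γ x)^[l] y) y ≤ l := by
  induction l generalizing y with
  | zero => simp
  | succ l ih =>
    rw [Function.iterate_succ_apply]
    have h1 := parent_spec (i := m + l) h
    refine (edist_le_add_one_of_adj h1.1).trans ?_
    push_cast
    gcongr
    exact ih h1.2

/-- Descendants of `y` are descendants of the vertex before `y`. -/
lemma fwd_subset_fwd_parent {Γ : SimpleGraph V} {x y : V} {m : ℕ}
    (h : Γ.edist x y = (m + 1 : ℕ)) (i : ℕ) : fwd Γ x y i ⊆ fwd Γ x (parent Γ x y) (i + 1) := by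
  intro z hz
  obtain ⟨h1, h2⟩ := mem_fwd.1 hz
  obtain ⟨h3, h4⟩ := parent_spec h
  have h5 := Γ.edist_triangle (u := parent Γ x y) (v := y) (w := z)
  have h6 := Γ.edist_triangle (u := x) (v := parent Γ x y) (w := z)
  rw [SimpleGraph.edist_eq_one_iff_adj.2 h3, h1] at h5
  rw [mem_fwd]
  rw [h4] at *
  rw [h2, h] at *
  generalize Γ.edist (parent Γ x y) z = a at *
  enat_to_nat
  omega

lemma fwd_subset_fwd_parent_iterate {Γ : SimpleGraph V} {x y : V} {m : ℕ} (l : ℕ)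
    (h : Γ.edist x y = (m + l : ℕ)) (i : ℕ) :
    fwd Γ x y i ⊆ fwd Γ x ((parent Γ x)^[l] y) (i + l) := by
  induction l generalizing y i with
  | zero => simp
  | succ l ih =>
    rw [Function.iterate_succ_apply]
    refine (fwd_subset_fwd_parent (m := m + l) h i).trans ?_
    have := ih (parent_spec (i := m + l) h).2 (i + 1)
    rwa [show i + (l + 1) = i + 1 + l by ring]

/-- The descendants of the `l`-th ancestor of `y` of depth `i` that are not descendants of the
ancestor before: in a tree, these are the vertices whose geodesic to `y` turns at the `l`-th
ancestor. -/
noncomputable def sideBranch (Γ : SimpleGraph V) (x y : V) (l i : ℕ) : Finset V :=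
  if l = 0 then fwd Γ x y i
  else fwd Γ x ((parent Γ x)^[l] y) i \ fwd Γ x ((parent Γ x)^[l - 1] y) (i - 1)

lemma sideBranch_subset (Γ : SimpleGraph V) (x y : V) (l i : ℕ) :
    sideBranch Γ x y l i ⊆ fwd Γ x ((parent Γ x)^[l] y) i := by
  rw [sideBranch]
  split_ifs with h
  · subst h; exact subset_rfl
  · exact sdiff_subset

lemma disjoint_sideBranch {Γ : SimpleGraph V} {x y : V} {m J : ℕ}
    (h : Γ.edist x y = (m + J : ℕ)) {l l' i i' : ℕ} (hl : l ≤ J) (hl' : l' ≤ J)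
    (hne : (l, i) ≠ (l', i')) : Disjoint (sideBranch Γ x y l i) (sideBranch Γ x y l' i') := by
  wlog hlt : l ≤ l' generalizing l l' i i'
  · exact (this hl' hl hne.symm (by omega)).symm
  rw [disjoint_left]
  intro z hz hz'
  have hd := edist_parent_iterate (m := m + J - l) l (by rw [h]; congr 1; omega)
  have hd' := edist_parent_iterate (m := m + J - l') l' (by rw [h]; congr 1; omega)
  have h1 := (mem_fwd.1 (sideBranch_subset _ _ _ _ _ hz)).2
  have h2 := (mem_fwd.1 (sideBranch_subset _ _ _ _ _ hz')).2
  rw [hd] at h1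
  rw [hd', h1] at h2
  norm_cast at h2
  have hll : l < l' := by
    rcases hlt.lt_or_eq with h | rfl
    · exact h
    · exact absurd (by rw [Prod.mk.injEq]; exact ⟨rfl, by omega⟩) hne
  rw [sideBranch, if_neg (by omega)] at hz'
  refine (Finset.mem_sdiff.1 hz').2 ?_
  have h3 := fwd_subset_fwd_parent_iterate (m := m + J - l' + 1) (l' - 1 - l)
    (y := (parent Γ x)^[l] y) (x := x) (Γ := Γ) (by rw [hd]; congr 1; omega) i
    (sideBranch_subset _ _ _ _ _ hz)
  rw [← Function.iterate_add_apply] at h3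
  rwa [show l' - 1 - l + l = l' - 1 by omega, show i + (l' - 1 - l) = i' - 1 by omega] at h3

lemma le_card_sideBranch {Γ : SimpleGraph V} {Δ : ℕ} (hdeg : DegreesAtMost Γ (Δ + 1)) {x y : V}
    {m J : ℕ} (h : Γ.edist x y = (m + J + 1 : ℕ)) {l : ℕ} (hl : l < J) (i : ℕ) :
    ((fwd Γ x ((parent Γ x)^[l + 1] y) i).card : ℝ) -
      (if i = 0 then 0 else (Δ : ℝ) ^ (i - 1)) ≤ (sideBranch Γ x y (l + 1) i).card := by
  have hd := edist_parent_iterate (m := m + (J - l)) (l + 1) (by rw [h]; congr 1; omega)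
  have hd' := edist_parent_iterate (m := m + (J - l) + 1) l (by rw [h]; congr 1; omega)
  rw [sideBranch, if_neg (Nat.succ_ne_zero l), Nat.add_sub_cancel]
  split_ifs with hi
  · subst hi
    rw [sdiff_eq_self_of_disjoint]
    · simp
    · rw [fwd_zero, fwd_zero, disjoint_singleton]
      intro h0
      rw [h0, hd'] at hd
      norm_cast at hd
      omega
  · have h1 : ((fwd Γ x ((parent Γ x)^[l] y) (i - 1)).card : ℝ) ≤ (Δ : ℝ) ^ (i - 1) := by
      exact_mod_cast card_fwd_le hdeg hd' (i - 1)
    have h2 : ((fwd Γ x ((parent Γ x)^[l + 1] y) i).card : ℝ) ≤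
        (fwd Γ x ((parent Γ x)^[l + 1] y) i \ fwd Γ x ((parent Γ x)^[l] y) (i - 1)).card +
          (fwd Γ x ((parent Γ x)^[l] y) (i - 1)).card := by
      exact_mod_cast card_le_card_sdiff_add_card
    linarith

lemma sum_closedBall_eq (Γ : SimpleGraph V) (y : V) (R : ℕ) (g : ℕ → ℝ) :
    ∑ z ∈ closedBall Γ y R, g (Γ.edist y z).toNat =
      ∑ d ∈ range (R + 1), ((sphere Γ y d).card : ℝ) * g d := by
  rw [closedBall_eq_biUnion, sum_biUnion]
  · refine sum_congr rfl fun d _ => ?_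
    rw [sum_congr rfl (g := fun _ => g d), sum_const, nsmul_eq_mul]
    intro z hz
    rw [mem_sphere.1 hz]
    rfl
  · intro d _ d' _ hne
    rw [Function.onFun, disjoint_left]
    intro z hz hz'
    have := (mem_sphere.1 hz).symm.trans (mem_sphere.1 hz')
    exact hne (by exact_mod_cast this)

lemma add_branchWeight_eq (Γ : SimpleGraph V) (Δ R : ℕ) (y : V) :
    1 / ((Δ : ℝ) + 1) + branchWeight Γ Δ R y =
      ∑ z ∈ closedBall Γ y R, 1 / ((Δ : ℝ) + 1) ^ ((Γ.edist y z).toNat + 1) := by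
  rw [sum_closedBall_eq Γ y R fun d => 1 / ((Δ : ℝ) + 1) ^ (d + 1), sum_range_succ', add_comm,
    branchWeight, sphere_zero]
  simp [div_eq_mul_inv]

/-- The weight of the ball around `y` is at least the weight of the side branches of a geodesic
from a distant vertex `x` to `y`.  This bounds what is missing in the ball in all directions,
the one towards `x` included, by what is missing among descendants seen from `x`. -/
lemma one_sub_branchWeight_le {Γ : SimpleGraph V} {Δ : ℕ} (hΔ : 2 ≤ Δ)
    (hdeg : DegreesAtMost Γ (Δ + 1)) {x y : V} {m J : ℕ} (h : Γ.edist x y = (m + J + 1 : ℕ)) :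
    1 - branchWeight Γ Δ (2 * J) y ≤ 3 * ((Δ : ℝ) / (Δ + 1)) ^ J +
      ∑ l ∈ range (J + 1), deficit Γ Δ J x ((parent Γ x)^[l] y) / ((Δ : ℝ) + 1) ^ l := by
  have hΔ' : (2 : ℝ) ≤ Δ := by exact_mod_cast hΔ
  set K : ℝ := (Δ : ℝ) + 1 with hK
  have hK0 : 0 < K := by positivity
  set I := range (J + 1) ×ˢ range (J + 1) with hI
  have h' : Γ.edist x y = (m + 1 + J : ℕ) := by rw [h]; congr 1; omega
  -- the side branches are disjoint parts of the ball of radius `2 * J`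
  have h1 : ∑ p ∈ I, ((sideBranch Γ x y p.1 p.2).card : ℝ) / K ^ (p.1 + p.2 + 1) ≤
      1 / K + branchWeight Γ Δ (2 * J) y := by
    rw [add_branchWeight_eq]
    have hdisj : Set.PairwiseDisjoint (I : Set (ℕ × ℕ))
        fun p => sideBranch Γ x y p.1 p.2 := by
      rintro ⟨l, i⟩ hp ⟨l', i'⟩ hp' hne
      have e1 := mem_range.1 (mem_product.1 (mem_coe.1 hp)).1
      have e2 := mem_range.1 (mem_product.1 (mem_coe.1 hp')).1
      exact disjoint_sideBranch h' (Nat.lt_succ_iff.1 e1) (Nat.lt_succ_iff.1 e2) hne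
    have hdist : ∀ p ∈ I, ∀ z ∈ sideBranch Γ x y p.1 p.2,
        Γ.edist y z ≤ (p.1 + p.2 : ℕ) ∧ p.1 + p.2 ≤ 2 * J := by
      rintro ⟨l, i⟩ hp z hz
      have e1 := mem_range.1 (mem_product.1 hp).1
      have e2 := mem_range.1 (mem_product.1 hp).2
      have e3 := (mem_fwd.1 (sideBranch_subset _ _ _ _ _ hz)).1
      have e4 := edist_parent_iterate_le (m := m + 1 + J - l) l (by rw [h']; congr 1; omega)
      have e5 := Γ.edist_triangle (u := y) (v := (parent Γ x)^[l] y) (w := z)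
      rw [e3] at e5
      rw [Γ.edist_comm] at e4
      refine ⟨e5.trans ?_, by simp only at e1 e2 ⊢; omega⟩
      push_cast
      gcongr
    calc _ = ∑ p ∈ I, ∑ z ∈ sideBranch Γ x y p.1 p.2, 1 / K ^ (p.1 + p.2 + 1) := by
          refine sum_congr rfl fun p _ => ?_
          rw [sum_const, nsmul_eq_mul, mul_one_div]
      _ ≤ ∑ p ∈ I, ∑ z ∈ sideBranch Γ x y p.1 p.2, 1 / K ^ ((Γ.edist y z).toNat + 1) := by
          refine sum_le_sum fun p hp => sum_le_sum fun z hz => ?_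
          have e1 : (Γ.edist y z).toNat ≤ p.1 + p.2 :=
            ENat.toNat_le_of_le_natCast (hdist p hp z hz).1
          refine one_div_le_one_div_of_le (by positivity) ?_
          exact pow_le_pow_right₀ (by linarith) (by omega)
      _ = ∑ z ∈ I.biUnion fun p => sideBranch Γ x y p.1 p.2,
            1 / K ^ ((Γ.edist y z).toNat + 1) := (sum_biUnion hdisj).symm
      _ ≤ _ := by
          refine sum_le_sum_of_subset_of_nonneg ?_ fun z _ _ => by positivity
          intro z hz
          obtain ⟨p, hp, hz⟩ := mem_biUnion.1 hz
          obtain ⟨e1, e2⟩ := hdist p hp z hz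
          exact mem_closedBall.2 (e1.trans (by exact_mod_cast e2))
  set r : ℝ := (Δ : ℝ) / K with hr
  have hr0 : 0 ≤ r := by positivity
  -- the branches at the `l`-th ancestor
  have h2 : ∀ l, ∑ i ∈ range (J + 1), ((fwd Γ x ((parent Γ x)^[l] y) i).card : ℝ) / K ^ (i + 1) =
      1 - r ^ (J + 1) - deficit Γ Δ J x ((parent Γ x)^[l] y) := by
    intro l
    rw [hr, ← sum_pow_div_pow_succ, deficit, ← sum_sub_distrib]
    refine sum_congr rfl fun i _ => ?_
    rw [← hK]
    ring
  have h3 : ∀ l ∈ range (J + 1), (1 - r ^ (J + 1) - deficit Γ Δ J x ((parent Γ x)^[l] y) -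
      (if l = 0 then 0 else 1 / K)) / K ^ l ≤
      ∑ i ∈ range (J + 1), ((sideBranch Γ x y l i).card : ℝ) / K ^ (l + i + 1) := by
    intro l hl
    rw [div_le_iff₀ (by positivity), sum_mul]
    have e0 : ∀ i, ((sideBranch Γ x y l i).card : ℝ) / K ^ (l + i + 1) * K ^ l =
        ((sideBranch Γ x y l i).card : ℝ) / K ^ (i + 1) := by
      intro i
      rw [add_assoc, pow_add]
      field_simp
    rw [sum_congr rfl fun i _ => e0 i, ← h2]
    rcases l with _ | l
    · simp [sideBranch]
    · have e1 : ∑ i ∈ range (J + 1), (if i = 0 then 0 else (Δ : ℝ) ^ (i - 1)) / K ^ (i + 1) ≤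
          1 / K := by
        rw [sum_range_succ']
        have e2 : ∀ i, (if i + 1 = 0 then 0 else (Δ : ℝ) ^ (i + 1 - 1)) / K ^ (i + 1 + 1) =
            (Δ : ℝ) ^ i / K ^ (i + 1) * (1 / K) := by
          intro i
          rw [if_neg (by omega), Nat.add_sub_cancel, pow_succ K (i + 1)]
          field_simp
        rw [sum_congr rfl fun i _ => e2 i, ← sum_mul, sum_pow_div_pow_succ]
        have e3 : 0 ≤ ((Δ : ℝ) / (Δ + 1)) ^ J := by positivity
        have e4 : 0 < 1 / K := by positivity
        simp only [if_true, zero_div, add_zero]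
        nlinarith
      rw [if_neg (by omega)]
      have e5 : ∑ i ∈ range (J + 1),
          (((fwd Γ x ((parent Γ x)^[l + 1] y) i).card : ℝ) / K ^ (i + 1) -
            (if i = 0 then 0 else (Δ : ℝ) ^ (i - 1)) / K ^ (i + 1)) ≤
          ∑ i ∈ range (J + 1), ((sideBranch Γ x y (l + 1) i).card : ℝ) / K ^ (i + 1) := by
        refine sum_le_sum fun i _ => ?_
        rw [← sub_div]
        refine div_le_div_of_nonneg_right ?_ (by positivity)
        exact le_card_sideBranch hdeg h (by have := mem_range.1 hl; omega) i
      rw [sum_sub_distrib] at e5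
      linarith
  have h4 := (sum_le_sum h3).trans_eq (sum_product' (range (J + 1)) (range (J + 1))
    fun l i => ((sideBranch Γ x y l i).card : ℝ) / K ^ (l + i + 1)).symm
  -- geometric sums over the ancestors
  have h5 : ∀ n : ℕ, 1 + 1 / K - 1 / K ^ (n + 1) - 2 * r ^ (J + 1) + r ^ (J + 1) / K ^ n ≤
      ∑ l ∈ range (n + 1), (1 - r ^ (J + 1) - (if l = 0 then 0 else 1 / K)) / K ^ l := by
    intro n
    have hrJ : 0 ≤ r ^ (J + 1) := by positivity
    induction n with
    | zero => simp; linarith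
    | succ n ih =>
      rw [sum_range_succ, if_neg (by omega)]
      have e1 : (1 - r ^ (J + 1) - 1 / K) / K ^ (n + 1) =
          1 / K ^ (n + 1) - 1 / K ^ (n + 2) - r ^ (J + 1) / K ^ (n + 1) := by
        rw [pow_succ K (n + 1)]
        field_simp
        ring
      have e2 : 2 * (r ^ (J + 1) / K ^ (n + 1)) ≤ r ^ (J + 1) / K ^ n := by
        rw [pow_succ K n, ← div_div, mul_div_assoc', div_le_iff₀ hK0]
        have : 0 ≤ r ^ (J + 1) / K ^ n := by positivity
        nlinarith
      linarith
  have h6 : ∑ l ∈ range (J + 1), (1 - r ^ (J + 1) - deficit Γ Δ J x ((parent Γ x)^[l] y) -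
      (if l = 0 then 0 else 1 / K)) / K ^ l =
      ∑ l ∈ range (J + 1), (1 - r ^ (J + 1) - (if l = 0 then 0 else 1 / K)) / K ^ l -
        ∑ l ∈ range (J + 1), deficit Γ Δ J x ((parent Γ x)^[l] y) / K ^ l := by
    rw [← sum_sub_distrib]
    exact sum_congr rfl fun l _ => by ring
  have h7 : 1 / K ^ (J + 1) ≤ r ^ J := by
    rw [hr, div_pow, pow_succ, div_le_div_iff₀ (by positivity) (by positivity)]
    have e1 : (1 : ℝ) ≤ (Δ : ℝ) ^ J := one_le_pow₀ (by linarith)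
    have e2 : (0 : ℝ) < K ^ J := by positivity
    nlinarith [mul_le_mul e1 (by linarith : (1 : ℝ) ≤ K) zero_le_one (by positivity)]
  have h8 : r ^ (J + 1) ≤ r ^ J := by
    refine pow_le_pow_of_le_one hr0 ?_ (Nat.le_succ J)
    rw [hr, div_le_one hK0]
    linarith
  have h9 : 0 ≤ r ^ (J + 1) / K ^ J := by positivity
  have h10 := h5 J
  rw [h6] at h4
  simp only [hI] at h1
  linarith

end Branching

/-! ### The mean defect of the balls -/

section AverageBranching

open Classical Finset

variable {V : Type*} [Fintype V]

/-- A vertex `u` is the `l`-th ancestor of at most `Δ ^ l` vertices. -/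
lemma sum_deficit_parent_iterate_le {Γ : SimpleGraph V} {Δ : ℕ} (hdeg : DegreesAtMost Γ (Δ + 1))
    (x : V) (m J l : ℕ) :
    ∑ y ∈ sphere Γ x (m + 1 + l), deficit Γ Δ J x ((parent Γ x)^[l] y) ≤
      (Δ : ℝ) ^ l * ∑ u ∈ sphere Γ x (m + 1), deficit Γ Δ J x u := by
  have hmaps : ∀ y ∈ sphere Γ x (m + 1 + l), (parent Γ x)^[l] y ∈ sphere Γ x (m + 1) :=
    fun y hy => mem_sphere.2 (edist_parent_iterate l (mem_sphere.1 hy))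
  rw [← sum_fiberwise_of_maps_to hmaps, mul_sum]
  refine sum_le_sum fun u hu => ?_
  rw [sum_congr rfl (g := fun _ => deficit Γ Δ J x u)
    (fun y hy => by rw [(mem_filter.1 hy).2]), sum_const, nsmul_eq_mul]
  refine mul_le_mul_of_nonneg_right ?_ (deficit_nonneg hdeg J (mem_sphere.1 hu))
  have hsub : ((sphere Γ x (m + 1 + l)).filter fun y => (parent Γ x)^[l] y = u) ⊆
      fwd Γ x u l := by
    intro y hy
    obtain ⟨h1, h2⟩ := mem_filter.1 hy
    have h3 := mem_sphere.1 h1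
    have h4 := edist_parent_iterate_le l h3
    have h5 := mem_sphere.1 hu
    have h6 := Γ.edist_triangle (u := x) (v := u) (w := y)
    rw [h2] at h4
    rw [mem_fwd]
    rw [h3, h5] at h6 ⊢
    refine ⟨?_, by push_cast; rfl⟩
    generalize Γ.edist u y = a at *
    enat_to_nat
    omega
  exact_mod_cast (card_le_card hsub).trans (card_fwd_le hdeg (mem_sphere.1 hu) l)

/-- What is missing among the descendants is missing in the later spheres. -/
lemma sum_deficit_le (Γ : SimpleGraph V) (Δ J : ℕ) (x : V) (p : ℕ) :
    ∑ u ∈ sphere Γ x p, deficit Γ Δ J x u ≤ ∑ i ∈ range (J + 1),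
      ((Δ : ℝ) ^ i * (sphere Γ x p).card - (sphere Γ x (p + i)).card) /
        ((Δ : ℝ) + 1) ^ (i + 1) := by
  simp only [deficit]
  rw [sum_comm]
  refine sum_le_sum fun i _ => ?_
  rw [← sum_div, sum_sub_distrib, sum_const, nsmul_eq_mul, mul_comm]
  refine div_le_div_of_nonneg_right (sub_le_sub_left ?_ _) (by positivity)
  exact_mod_cast card_sphere_add_le Γ x p i

lemma sum_mul_pow_le {r : ℝ} (h0 : 0 ≤ r) (h1 : r < 1) (n : ℕ) :
    ∑ i ∈ range n, (i : ℝ) * r ^ i ≤ 1 / (1 - r) ^ 2 := by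
  have hr : ‖r‖ < 1 := by rwa [Real.norm_of_nonneg h0]
  have h := hasSum_coe_mul_geometric_of_norm_lt_one hr
  refine (sum_le_hasSum _ (fun i _ => by positivity) h).trans ?_
  exact div_le_div_of_nonneg_right h1.le (by positivity)

lemma sum_one_div_pow_le_two {K : ℝ} (hK : 2 ≤ K) (n : ℕ) :
    ∑ l ∈ range n, 1 / K ^ l ≤ 2 := by
  have h : ∀ n : ℕ, ∑ l ∈ range n, 1 / K ^ l ≤ 2 - 2 * (1 / K ^ n) := by
    intro n
    induction n with
    | zero => norm_num
    | succ n ih =>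
      rw [sum_range_succ]
      have h1 : 2 * (1 / K ^ (n + 1)) ≤ 1 / K ^ n := by
        rw [mul_one_div, pow_succ, div_le_div_iff₀ (by positivity) (by positivity)]
        have : 0 < K ^ n := by positivity
        nlinarith
      linarith
  have h2 : 0 ≤ 1 / K ^ n := by positivity
  linarith [h n]

/-- What is missing in the balls around the vertices at distance `J + 1, …, J + M` from `x`.
Each missing descendant makes the relative size of the spheres around `x` drop, and the total drop
is bounded, whatever `M` is. -/
lemma sum_range_one_sub_branchWeight_le {Γ : SimpleGraph V} {Δ : ℕ} (hΔ : 2 ≤ Δ)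
    (hdeg : DegreesAtMost Γ (Δ + 1)) (x : V) (J M : ℕ) :
    ∑ m ∈ range M, (∑ y ∈ sphere Γ x (m + J + 1), (1 - branchWeight Γ Δ (2 * J) y)) /
      (Δ : ℝ) ^ (m + J + 1) ≤ 6 * ((Δ : ℝ) / (Δ + 1)) ^ J * M + 4 * (Δ + 1) := by
  have hΔ' : (2 : ℝ) ≤ Δ := by exact_mod_cast hΔ
  have hΔ0 : (0 : ℝ) < Δ := by linarith
  set K : ℝ := (Δ : ℝ) + 1 with hK
  have hK0 : 0 < K := by positivity
  set r : ℝ := (Δ : ℝ) / K with hr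
  have hr0 : 0 ≤ r := by positivity
  set σ : ℕ → ℝ := fun p => ((sphere Γ x p).card : ℝ) / (Δ : ℝ) ^ p with hσ
  have hσ0 : ∀ p, 0 ≤ σ p := fun p => by positivity
  have hσ2 : ∀ p, σ p ≤ 2 := fun p => by
    simp only [hσ]
    rw [div_le_iff₀ (by positivity)]
    exact_mod_cast card_sphere_le_two_mul_pow (by omega) hdeg x p
  have hlevel : ∀ m l, l ≤ J → (∑ y ∈ sphere Γ x (m + J + 1),
      deficit Γ Δ J x ((parent Γ x)^[l] y)) / (Δ : ℝ) ^ (m + J + 1) ≤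
      ∑ i ∈ range (J + 1), r ^ i / K * (σ (m + (J - l) + 1) - σ (m + (J - l) + 1 + i)) := by
    intro m l hl
    have e1 := sum_deficit_parent_iterate_le hdeg x (m + (J - l)) J l
    rw [show m + (J - l) + 1 + l = m + J + 1 by omega] at e1
    have e2 := sum_deficit_le Γ Δ J x (m + (J - l) + 1)
    rw [div_le_iff₀ (by positivity)]
    refine e1.trans ((mul_le_mul_of_nonneg_left e2 (by positivity)).trans_eq ?_)
    rw [mul_sum, sum_mul]
    refine sum_congr rfl fun i _ => ?_
    simp only [hσ]
    rw [show m + J + 1 = (m + (J - l) + 1) + l by omega]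
    generalize m + (J - l) + 1 = p
    rw [hr, div_pow, pow_add, pow_add, pow_succ, ← hK]
    field_simp
    ring
  have hm : ∀ m, (∑ y ∈ sphere Γ x (m + J + 1), (1 - branchWeight Γ Δ (2 * J) y)) /
      (Δ : ℝ) ^ (m + J + 1) ≤ 6 * r ^ J + ∑ l ∈ range (J + 1), ∑ i ∈ range (J + 1),
        1 / K ^ l * (r ^ i / K) * (σ (m + (J - l) + 1) - σ (m + (J - l) + 1 + i)) := by
    intro m
    have e1 := sum_le_sum fun y (hy : y ∈ sphere Γ x (m + J + 1)) =>
      one_sub_branchWeight_le hΔ hdeg (mem_sphere.1 hy)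
    rw [sum_add_distrib, sum_const, nsmul_eq_mul, sum_comm] at e1
    refine (div_le_div_of_nonneg_right e1 (by positivity)).trans ?_
    rw [add_div]
    refine add_le_add ?_ ?_
    · have e2 := mul_le_mul_of_nonneg_right (hσ2 (m + J + 1))
        (by positivity : 0 ≤ 3 * r ^ J)
      rw [mul_div_right_comm]
      linarith
    · rw [sum_div]
      refine sum_le_sum fun l hl => ?_
      have e3 := hlevel m l (Nat.lt_succ_iff.1 (mem_range.1 hl))
      rw [← sum_div, div_right_comm, div_le_iff₀ (by positivity)]
      refine e3.trans_eq ?_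
      rw [sum_mul]
      refine sum_congr rfl fun i _ => ?_
      rw [← hK]
      field_simp
  refine (sum_le_sum fun m _ => hm m).trans ?_
  rw [sum_add_distrib, sum_const, card_range, nsmul_eq_mul, mul_comm (M : ℝ)]
  refine add_le_add le_rfl ?_
  rw [sum_comm]
  calc _ = ∑ l ∈ range (J + 1), ∑ i ∈ range (J + 1), 1 / K ^ l * (r ^ i / K) *
          ∑ m ∈ range M, (σ (m + (J - l) + 1) - σ (m + (J - l) + 1 + i)) := by
        refine sum_congr rfl fun l _ => ?_
        rw [sum_comm]
        exact sum_congr rfl fun i _ => (mul_sum _ _ _).symm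
    _ ≤ ∑ l ∈ range (J + 1), ∑ i ∈ range (J + 1), 1 / K ^ l * (r ^ i / K) * (2 * i) := by
        refine sum_le_sum fun l _ => sum_le_sum fun i _ => ?_
        refine mul_le_mul_of_nonneg_left ?_ (by positivity)
        have e1 := sum_sub_shift_le (α := fun m => σ (m + (J - l) + 1)) (fun _ => hσ0 _)
          (fun _ => hσ2 _) i M
        refine le_trans (le_of_eq ?_) e1
        refine sum_congr rfl fun m _ => ?_
        congr 2
        omega
    _ = 2 / K * (∑ l ∈ range (J + 1), 1 / K ^ l) * ∑ i ∈ range (J + 1), (i : ℝ) * r ^ i := by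
        rw [mul_assoc, sum_mul_sum, mul_sum]
        refine sum_congr rfl fun l _ => ?_
        rw [mul_sum]
        refine sum_congr rfl fun i _ => ?_
        ring
    _ ≤ 2 / K * 2 * K ^ 2 := by
        have e1 := sum_one_div_pow_le_two (K := K) (by linarith) (J + 1)
        have hr1 : 1 - r = 1 / K := by
          rw [hr, hK]
          field_simp
          ring
        have e2 := sum_mul_pow_le hr0 (by
          have : 0 < 1 / K := by positivity
          linarith) (J + 1)
        rw [hr1, div_pow, one_pow, one_div_one_div] at e2
        have e3 : 0 ≤ ∑ i ∈ range (J + 1), (i : ℝ) * r ^ i := sum_nonneg fun i _ => by positivity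
        gcongr
    _ = 4 * K := by
        field_simp
        norm_num

/-- In a graph in which the spheres up to a radius of order `M` have the size of those in the
`(Δ + 1)`-regular tree up to a constant factor, the ball of radius `2 * J` around an average vertex
misses only a share of order `1 / M` of the ball in the tree, up to an error that is exponentially
small in `J`. -/
lemma sum_one_sub_branchWeight_le {Γ : SimpleGraph V} {Δ : ℕ} (hΔ : 2 ≤ Δ)
    (hdeg : DegreesAtMost Γ (Δ + 1)) {J M : ℕ} (hM : 0 < M) {b : ℝ} (hb : 0 < b)
    (hgrow : ∀ x m, m < M → b * (Δ : ℝ) ^ (m + J + 1) ≤ (sphere Γ x (m + J + 1)).card) :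
    ∑ y, (1 - branchWeight Γ Δ (2 * J) y) ≤
      Fintype.card V * ((6 * ((Δ : ℝ) / (Δ + 1)) ^ J * M + 4 * (Δ + 1)) / (M * b)) := by
  have hΔ0 : (0 : ℝ) < Δ := by exact_mod_cast (by omega : 0 < Δ)
  have hM0 : (0 : ℝ) < M := by exact_mod_cast hM
  set g : V → ℝ := fun y => 1 - branchWeight Γ Δ (2 * J) y with hg
  have hg0 : ∀ y, 0 ≤ g y := fun y => sub_nonneg.2 (branchWeight_le_one hdeg _ y)
  set B := 6 * ((Δ : ℝ) / (Δ + 1)) ^ J * M + 4 * (Δ + 1)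
  have h1 : ∑ x, ∑ m ∈ range M, (∑ y ∈ sphere Γ x (m + J + 1), g y) / (Δ : ℝ) ^ (m + J + 1) ≤
      Fintype.card V * B := by
    refine (sum_le_card_nsmul _ _ B fun x _ =>
      sum_range_one_sub_branchWeight_le hΔ hdeg x J M).trans ?_
    rw [nsmul_eq_mul, card_univ]
  -- by symmetry of the distance, each `y` is counted once for every vertex of its own spheres
  have h2 : ∑ x, ∑ m ∈ range M, (∑ y ∈ sphere Γ x (m + J + 1), g y) / (Δ : ℝ) ^ (m + J + 1) =
      ∑ y, g y * ∑ m ∈ range M, ((sphere Γ y (m + J + 1)).card : ℝ) / (Δ : ℝ) ^ (m + J + 1) := by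
    simp only [mul_sum]
    rw [sum_comm, sum_comm (s := univ) (t := range M)]
    refine sum_congr rfl fun m _ => ?_
    rw [← sum_div]
    have e1 : ∀ x, ∑ y ∈ sphere Γ x (m + J + 1), g y =
        ∑ y, if Γ.edist x y = (m + J + 1 : ℕ) then g y else 0 := fun x => by
      rw [← sum_filter]; rfl
    simp only [e1]
    rw [sum_comm, sum_div]
    refine sum_congr rfl fun y _ => ?_
    have e2 : (univ.filter fun x => Γ.edist x y = (m + J + 1 : ℕ)) = sphere Γ y (m + J + 1) := by
      ext x
      rw [mem_sphere, Γ.edist_comm, mem_filter]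
      simp
    rw [← sum_filter, sum_const, nsmul_eq_mul, mul_comm, mul_div_assoc, e2]
  have h3 : ∑ y, g y * (M * b) ≤
      ∑ y, g y * ∑ m ∈ range M, ((sphere Γ y (m + J + 1)).card : ℝ) / (Δ : ℝ) ^ (m + J + 1) := by
    refine sum_le_sum fun y _ => mul_le_mul_of_nonneg_left ?_ (hg0 y)
    have := card_nsmul_le_sum (range M)
      (fun m => ((sphere Γ y (m + J + 1)).card : ℝ) / (Δ : ℝ) ^ (m + J + 1)) b fun m hm => by
        rw [le_div_iff₀ (by positivity)]
        exact hgrow y m (mem_range.1 hm)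
    rwa [card_range, nsmul_eq_mul] at this
  rw [← sum_mul] at h3
  rw [← mul_div_assoc, le_div_iff₀ (by positivity)]
  linarith

end AverageBranching

/-! ### The weight of an explored ball -/

section Weights

open Classical Finset

variable {V : Type*} [Fintype V]

/-- The weight of a vertex that an exploration has reached in `l ≤ a + 1` steps, where `x` is
slightly more than `1 / (Δ + 1)`.  No vertex beyond the horizon `a + 1` is explored; the factor
`Δ + 1` at the horizon makes up for them. -/
noncomputable def labelWeight (Δ : ℕ) (x : ℝ) (a l : ℕ) : ℝ :=
  if l = a + 1 then (Δ + 1) * x ^ l else x ^ l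

lemma labelWeight_of_le {Δ : ℕ} {x : ℝ} {a l : ℕ} (h : l ≤ a) : labelWeight Δ x a l = x ^ l :=
  if_neg (by omega)

lemma pow_le_labelWeight {Δ : ℕ} {x : ℝ} (hx : 0 ≤ x) (a l : ℕ) :
    x ^ l ≤ labelWeight Δ x a l := by
  rw [labelWeight]
  split_ifs
  · have : 0 ≤ x ^ l := by positivity
    have : (0 : ℝ) ≤ Δ := Nat.cast_nonneg _
    nlinarith
  · exact le_rfl

lemma labelWeight_nonneg {Δ : ℕ} {x : ℝ} (hx : 0 ≤ x) (a l : ℕ) : 0 ≤ labelWeight Δ x a l :=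
  (pow_nonneg hx l).trans (pow_le_labelWeight hx a l)

/-- The vertices at distance more than `h + 1` weigh at most `Δ` times as much as those at
distance `h + 1`. -/
lemma branchWeight_le_add {Γ : SimpleGraph V} {Δ : ℕ} (hdeg : DegreesAtMost Γ (Δ + 1)) {h R : ℕ}
    (hR : h + 1 ≤ R) (w : V) :
    branchWeight Γ Δ R w ≤ branchWeight Γ Δ (h + 1) w +
      Δ * ((sphere Γ w (h + 1)).card : ℝ) / ((Δ : ℝ) + 1) ^ (h + 2) := by
  have key : branchWeight Γ Δ R w + Δ * ((sphere Γ w R).card : ℝ) / ((Δ : ℝ) + 1) ^ (R + 1) ≤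
      branchWeight Γ Δ (h + 1) w +
        Δ * ((sphere Γ w (h + 1)).card : ℝ) / ((Δ : ℝ) + 1) ^ (h + 2) := by
    induction R, hR using Nat.le_induction with
    | base => exact le_rfl
    | succ R hR ih =>
      refine le_trans ?_ ih
      obtain ⟨R, rfl⟩ : ∃ R', R = R' + 1 := ⟨R - 1, by omega⟩
      have h1 : ((sphere Γ w (R + 2)).card : ℝ) ≤ (sphere Γ w (R + 1)).card * Δ := by
        exact_mod_cast card_sphere_succ_le hdeg w R
      rw [branchWeight, sum_range_succ, ← branchWeight, add_assoc]
      gcongr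
      rw [← add_div, show R + 1 + 1 + 1 = R + 1 + 2 by ring, pow_succ _ (R + 1 + 1),
        div_le_div_iff₀ (by positivity) (by positivity)]
      have h2 : (0 : ℝ) ≤ ((Δ : ℝ) + 1) ^ (R + 1 + 1) * (Δ + 1) := by positivity
      have h3 := mul_le_mul_of_nonneg_right h1 h2
      rw [show R + 1 + 1 = R + 2 by ring] at h3 ⊢
      linarith
  refine le_trans ?_ key
  have : 0 ≤ Δ * ((sphere Γ w R).card : ℝ) / ((Δ : ℝ) + 1) ^ (R + 1) := by positivity
  linarith

/-- The weight that a new root `w` with label `b` brings in, if its ball is added up to the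
horizon. -/
lemma le_sum_labelWeight {Γ : SimpleGraph V} {Δ : ℕ} (hdeg : DegreesAtMost Γ (Δ + 1)) {g ρ : ℝ}
    (hg : 1 ≤ g) (hρ0 : 0 ≤ ρ) (hρ : ρ ≤ g ^ 2) {a b : ℕ} (hb : b + 1 ≤ a) (R : ℕ) (w : V) :
    (g / (Δ + 1)) ^ b * (ρ * branchWeight Γ Δ R w) ≤
      ∑ z ∈ (closedBall Γ w R).filter fun z => z ≠ w ∧ b + 1 + (Γ.edist w z).toNat ≤ a + 1,
        labelWeight Δ (g / (Δ + 1)) a (b + 1 + (Γ.edist w z).toNat) := by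
  set x : ℝ := g / (Δ + 1) with hx
  have hx0 : 0 ≤ x := by positivity
  have hK0 : (0 : ℝ) < (Δ : ℝ) + 1 := by positivity
  -- sort the vertices by their distance from `w`
  have h1 : ∑ z ∈ (closedBall Γ w R).filter fun z => z ≠ w ∧
        b + 1 + (Γ.edist w z).toNat ≤ a + 1, labelWeight Δ x a (b + 1 + (Γ.edist w z).toNat) =
      ∑ d ∈ range R, ((sphere Γ w (d + 1)).card : ℝ) *
        if b + 1 + (d + 1) ≤ a + 1 then labelWeight Δ x a (b + 1 + (d + 1)) else 0 := by
    have e1 := sum_closedBall_eq Γ w R fun d : ℕ =>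
      (if d ≠ 0 ∧ b + 1 + d ≤ a + 1 then labelWeight Δ x a (b + 1 + d) else 0 : ℝ)
    rw [sum_range_succ'] at e1
    simp only [ne_eq, not_true_eq_false, false_and, if_false, mul_zero, add_zero,
      Nat.add_eq_zero_iff, one_ne_zero, and_false, not_false_eq_true, true_and] at e1
    rw [← e1, sum_filter]
    refine sum_congr rfl fun z hz => ?_
    have e2 : (Γ.edist w z).toNat = 0 ↔ z = w := by
      rw [ENat.toNat_eq_zero, SimpleGraph.edist_eq_zero_iff]
      have : Γ.edist w z ≠ ⊤ := ne_top_of_le_ne_top (ENat.natCast_ne_top R) (mem_closedBall.1 hz)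
      exact ⟨fun h => h.elim Eq.symm fun h => absurd h this, fun h => .inl h.symm⟩
    simp only [e2, ne_eq]
  rw [h1]
  have hterm : ∀ d : ℕ, x ^ b * (ρ / ((Δ : ℝ) + 1) ^ (d + 2)) ≤ x ^ (b + 1 + (d + 1)) := by
    intro d
    rw [show b + 1 + (d + 1) = b + (d + 2) by ring, pow_add x]
    refine mul_le_mul_of_nonneg_left ?_ (pow_nonneg hx0 b)
    rw [hx, div_pow]
    refine div_le_div_of_nonneg_right (hρ.trans ?_) (by positivity)
    exact pow_le_pow_right₀ hg (by omega)
  obtain ⟨h, rfl⟩ : ∃ h, a = b + 1 + h := ⟨a - (b + 1), by omega⟩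
  rcases Nat.lt_or_ge R (h + 1) with hR | hR
  · rw [branchWeight, mul_sum, mul_sum]
    refine sum_le_sum fun d hd => ?_
    have hd := mem_range.1 hd
    rw [if_pos (by omega)]
    calc _ = ((sphere Γ w (d + 1)).card : ℝ) * (x ^ b * (ρ / ((Δ : ℝ) + 1) ^ (d + 2))) := by ring
      _ ≤ _ := mul_le_mul_of_nonneg_left ((hterm d).trans (pow_le_labelWeight hx0 _ _))
        (Nat.cast_nonneg _)
  · calc _ ≤ x ^ b * (ρ * (branchWeight Γ Δ (h + 1) w +
          Δ * ((sphere Γ w (h + 1)).card : ℝ) / ((Δ : ℝ) + 1) ^ (h + 2))) := by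
          gcongr
          exact branchWeight_le_add hdeg hR w
      _ ≤ ∑ d ∈ range (h + 1), ((sphere Γ w (d + 1)).card : ℝ) *
          if b + 1 + (d + 1) ≤ b + 1 + h + 1 then
            labelWeight Δ x (b + 1 + h) (b + 1 + (d + 1)) else 0 := by
          rw [branchWeight, sum_range_succ, sum_range_succ, if_pos (by omega), labelWeight,
            if_pos (by omega), add_assoc, mul_add, mul_add, mul_sum, mul_sum]
          refine add_le_add (sum_le_sum fun d hd => ?_) ?_
          · have hd := mem_range.1 hd
            rw [if_pos (by omega)]
            calc _ = ((sphere Γ w (d + 1)).card : ℝ) *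
                  (x ^ b * (ρ / ((Δ : ℝ) + 1) ^ (d + 2))) := by ring
              _ ≤ _ := mul_le_mul_of_nonneg_left ((hterm d).trans (pow_le_labelWeight hx0 _ _))
                (Nat.cast_nonneg _)
          · calc _ = ((sphere Γ w (h + 1)).card : ℝ) * (((Δ : ℝ) + 1) *
                  (x ^ b * (ρ / ((Δ : ℝ) + 1) ^ (h + 2)))) := by ring
              _ ≤ _ := by
                gcongr
                exact hterm h
      _ ≤ _ := by
          refine sum_le_sum_of_subset_of_nonneg (range_mono hR) fun d _ _ => ?_
          refine mul_nonneg (Nat.cast_nonneg _) ?_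
          split_ifs
          · exact labelWeight_nonneg hx0 _ _
          · exact le_rfl

end Weights

/-! ### Single steps of an exploration -/

section Steps

open Classical Finset

variable {V : Type*}

lemma edist_sup_edge_le {G' : SimpleGraph V} {s u : V} {i : ℕ} (h : G'.edist s u ≤ i) (w : V) :
    (G' ⊔ SimpleGraph.edge u w).edist s w ≤ (i + 1 : ℕ) := by
  have h1 : (G' ⊔ SimpleGraph.edge u w).edist s u ≤ i :=
    (SimpleGraph.edist_anti le_sup_left).trans h
  by_cases huw : u = w
  · subst huw
    exact h1.trans (by exact_mod_cast Nat.le_succ i)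
  · have hadj : (G' ⊔ SimpleGraph.edge u w).Adj u w := by
      rw [SimpleGraph.sup_adj, SimpleGraph.edge_adj]
      tauto
    refine (edist_le_add_one_of_adj hadj).trans ?_
    push_cast
    gcongr

/-- The event is decided once the revealed part of the graph joins `s` and `t` by a short path. -/
lemma matchingMean_eq_zero_of_edist_le {f : SimpleGraph V → ℝ} {s t : V} {D : ℕ}
    (hf : ∀ H : SimpleGraph V, H.edist s t ≤ D → f H = 0) {S : Finset V} {G' : SimpleGraph V}
    {w : V} {i j : ℕ} (hs : G'.edist s w ≤ i) (ht : G'.edist t w ≤ j) (hD : i + j ≤ D) :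
    matchingMean f S G' = 0 := by
  refine matchingMean_eq_zero fun H hH => hf H ?_
  have h1 := H.edist_triangle (u := s) (v := w) (w := t)
  have h2 : H.edist s w ≤ i := (SimpleGraph.edist_anti hH.1).trans hs
  have h3 : H.edist w t ≤ j := by
    rw [H.edist_comm]
    exact (SimpleGraph.edist_anti hH.1).trans ht
  calc _ ≤ _ := h1
    _ ≤ (i : ℕ∞) + j := add_le_add h2 h3
    _ ≤ D := by exact_mod_cast hD

lemma matchingMean_le_one {f : SimpleGraph V → ℝ} (hf : ∀ H, f H ≤ 1) (S : Finset V)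
    (G' : SimpleGraph V) : matchingMean f S G' ≤ 1 :=
  (matchingMean_mono fun H _ => hf H).trans_eq (matchingMean_const 1 S G')

variable [Fintype V]

/-- If a matching edge is revealed between two vertices without one, the graph still arises
from `G` by adding a matching. -/
lemma IsMatchingExtension.sup_edge {S : Finset V} {G G' : SimpleGraph V} {u w : V}
    (h : IsMatchingExtension Sᶜ G G') (hu : u ∈ S) (hw : w ∈ S) :
    IsMatchingExtension (S \ {u, w})ᶜ G (G' ⊔ SimpleGraph.edge u w) := by
  obtain ⟨h1, h2, h3⟩ := h
  refine ⟨h1.trans le_sup_left, ?_, ?_⟩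
  · intro x hx y hxy
    rw [mem_compl, not_not, Finset.mem_sdiff, mem_insert, mem_singleton, not_or] at hx
    rw [SimpleGraph.sup_adj, SimpleGraph.edge_adj] at hxy
    have h4 := h2 x (by simpa using hx.1) y
    tauto
  · intro x y z hy hy' hz hz'
    rw [SimpleGraph.sup_adj, SimpleGraph.edge_adj] at hy hz
    by_cases hx : x ∈ S
    · have h4 := h2 x (by simpa using hx)
      have h5 := h4 y
      have h6 := h4 z
      grind
    · have h4 : x ≠ u := fun h => hx (h ▸ hu)
      have h5 : x ≠ w := fun h => hx (h ▸ hw)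
      exact h3 x y z (by tauto) hy' (by tauto) hz'

/-- Two sets `A` and `B` of vertices close to `s` and to `t` whose partners are not yet revealed:
unless the matching joins them, the vertices of `B` all have their partners elsewhere. -/
lemma matchingMean_le_exp_of_disjoint {f : SimpleGraph V → ℝ} {s t : V} {a : ℕ}
    (hf1 : ∀ H, f H ≤ 1) (hf : ∀ H : SimpleGraph V, H.edist s t ≤ (2 * a + 3 : ℕ) → f H = 0)
    {S : Finset V} {G' : SimpleGraph V} {A B : Finset V} (hA : A ⊆ S) (hB : B ⊆ S)
    (hAB : Disjoint A B) (hAs : ∀ z ∈ A, G'.edist s z ≤ (a + 1 : ℕ))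
    (hBt : ∀ z ∈ B, G'.edist t z ≤ (a + 1 : ℕ)) :
    matchingMean f S G' ≤ Real.exp (-(A.card * B.card / (2 * Fintype.card V))) := by
  induction hS : S.card using Nat.strong_induction_on generalizing S G' B with
  | _ c IH =>
  rcases B.eq_empty_or_nonempty with rfl | ⟨u, hu⟩
  · simpa using matchingMean_le_one hf1 S G'
  obtain ⟨p, hp0, hp1, -, hpl, hmean⟩ := exists_matchingMean_eq_sum (hB hu)
  have hN : (0 : ℝ) < Fintype.card V := by exact_mod_cast Fintype.card_pos_iff.2 ⟨u⟩
  set N : ℝ := (Fintype.card V : ℝ)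
  set E := Real.exp (-(A.card * ((B.card : ℝ) - 2) / (2 * N))) with hE
  have hstep : ∀ w ∈ S, p w * matchingMean f (S \ {u, w}) (G' ⊔ SimpleGraph.edge u w) ≤
      (p w - if w ∈ A then p w else 0) * E := by
    intro w hw
    split_ifs with hwA
    · rw [matchingMean_eq_zero_of_edist_le (s := s) (t := t) hf (w := w) (i := a + 1)
        (j := a + 1 + 1) ((SimpleGraph.edist_anti le_sup_left).trans (hAs w hwA))
        (edist_sup_edge_le (hBt u hu) w) (by omega)]
      simp
    · rw [sub_zero]
      refine mul_le_mul_of_nonneg_left ?_ (hp0 w)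
      have hlt : (S \ {u, w}).card < c := by
        rw [← hS]
        exact card_lt_card ⟨sdiff_subset, fun h => by
          have := h (hB hu)
          simp at this⟩
      have hAu : u ∉ A := fun h => disjoint_left.1 hAB h hu
      have hcard : (B.card : ℝ) - 2 ≤ (B \ {u, w}).card := by
        have h1 : B.card ≤ (B \ {u, w}).card + ({u, w} : Finset V).card :=
          card_le_card_sdiff_add_card
        have h2 : ({u, w} : Finset V).card ≤ 2 := card_le_two
        have h3 : (B.card : ℝ) ≤ (B \ {u, w}).card + 2 := by exact_mod_cast (by omega)
        linarith
      refine (IH _ hlt (B := B \ {u, w}) ?_ ?_ ?_ ?_ ?_ rfl).trans ?_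
      · intro z hz
        rw [Finset.mem_sdiff, mem_insert, mem_singleton, not_or]
        exact ⟨hA hz, fun h => hAu (h ▸ hz), fun h => hwA (h ▸ hz)⟩
      · exact sdiff_subset_sdiff hB subset_rfl
      · exact hAB.mono_right sdiff_subset
      · exact fun z hz => (SimpleGraph.edist_anti le_sup_left).trans (hAs z hz)
      · exact fun z hz => (SimpleGraph.edist_anti le_sup_left).trans
          (hBt z (Finset.mem_sdiff.1 hz).1)
      · rw [hE, Real.exp_le_exp]
        gcongr
  rw [hmean]
  refine (sum_le_sum hstep).trans ?_
  rw [← sum_mul, sum_sub_distrib, hp1, ← sum_filter, filter_mem_eq_inter,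
    inter_eq_right.2 hA]
  have hsum : (A.card : ℝ) / N ≤ ∑ w ∈ A, p w := by
    have := card_nsmul_le_sum A p (1 / N) fun w hw => by
      have h1 := hpl w fun h => disjoint_left.1 hAB hw (h ▸ hu)
      have h2 : (S.card : ℝ) ≤ N := Nat.cast_le.2 (card_le_univ S)
      rw [div_le_iff₀ hN]
      exact h1.trans (mul_le_mul_of_nonneg_left h2 (hp0 w))
    rwa [nsmul_eq_mul, mul_one_div] at this
  calc (1 - ∑ w ∈ A, p w) * E ≤ Real.exp (-(A.card / N)) * E := by
        refine mul_le_mul_of_nonneg_right ?_ (Real.exp_pos _).le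
        have := Real.add_one_le_exp (-((A.card : ℝ) / N))
        linarith
    _ = _ := by
        rw [hE, ← Real.exp_add]
        congr 1
        field_simp
        ring

end Steps

/-! ### The drift of the weight -/

section Drift

open Finset

variable {V : Type*}

lemma exp_le_one_add_two_mul {y : ℝ} (h0 : 0 ≤ y) (h1 : y ≤ 1) : Real.exp y ≤ 1 + 2 * y := by
  have h := Real.abs_exp_sub_one_le (x := y) (by rwa [abs_of_nonneg h0])
  rw [abs_of_nonneg h0] at h
  linarith [le_abs_self (Real.exp y - 1)]

/-- The exponential of the weight of an exploration is a supermartingale: a typical partner `w`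
multiplies the weight of the revealed vertex by `(1 + 10 μ) P w`, where `1 - P w` is at most `μ` on
average, and the few remaining partners cost at most twice that weight. -/
lemma sum_mul_exp_le_one {S B : Finset V} {p P : V → ℝ} {τ μ N : ℝ} (hN : 0 < N)
    (hp0 : ∀ w, 0 ≤ p w) (hp1 : ∑ w ∈ S, p w = 1) (hpN : ∀ w, p w ≤ 2 / N)
    (hP1 : ∀ w, P w ≤ 1) (hP0 : ∀ w, 0 ≤ P w) (hτ0 : 0 ≤ τ) (hτ : τ ≤ 1 / 8) (hμ0 : 0 ≤ μ)
    (hμ : μ ≤ 1 / 10) (hP : ∑ w ∈ S, (1 - P w) ≤ μ * N / 2) (hB : (B.card : ℝ) ≤ μ * N / 2)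
    {F : V → ℝ} (hF : ∀ w ∈ S, w ∉ B → F w ≤ Real.exp (-(τ * ((1 + 10 * μ) * P w - 1))))
    (hFB : ∀ w ∈ S, w ∈ B → F w ≤ Real.exp (2 * τ)) :
    ∑ w ∈ S, p w * F w ≤ 1 := by
  classical
  set e := Real.exp (-(10 * μ * τ)) with he
  have he0 : 0 < e := Real.exp_pos _
  have key : ∀ w ∈ S, F w ≤ e * (1 + 4 * τ * (1 - P w) + 6 * τ * if w ∈ B then 1 else 0) := by
    intro w hw
    have h1 : 0 ≤ 1 - P w := sub_nonneg.2 (hP1 w)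
    split_ifs with h
    · refine (hFB w hw h).trans ?_
      rw [show 2 * τ = -(10 * μ * τ) + τ * (2 + 10 * μ) by ring, Real.exp_add, ← he]
      refine mul_le_mul_of_nonneg_left ?_ he0.le
      have h2 := exp_le_one_add_two_mul (y := τ * (2 + 10 * μ)) (by positivity) (by nlinarith)
      have h3 : 0 ≤ τ * (1 - P w) := by positivity
      nlinarith
    · refine (hF w hw h).trans ?_
      rw [show -(τ * ((1 + 10 * μ) * P w - 1)) =
        -(10 * μ * τ) + τ * ((1 + 10 * μ) * (1 - P w)) by ring, Real.exp_add, ← he]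
      refine mul_le_mul_of_nonneg_left ?_ he0.le
      have h3 : (1 + 10 * μ) * (1 - P w) ≤ 2 * (1 - P w) :=
        mul_le_mul_of_nonneg_right (by linarith) h1
      have h4 := hP0 w
      have h2 := exp_le_one_add_two_mul (y := τ * ((1 + 10 * μ) * (1 - P w))) (by positivity)
        (by nlinarith)
      nlinarith
  have h2N : 0 ≤ 2 / N := by positivity
  have h1 : ∑ w ∈ S, p w * (1 - P w) ≤ μ := by
    calc _ ≤ ∑ w ∈ S, 2 / N * (1 - P w) := by
          refine sum_le_sum fun w _ => mul_le_mul_of_nonneg_right (hpN w) ?_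
          exact sub_nonneg.2 (hP1 w)
      _ ≤ 2 / N * (μ * N / 2) := by
          rw [← mul_sum]
          exact mul_le_mul_of_nonneg_left hP h2N
      _ = μ := by field_simp
  have h2 : ∑ w ∈ S, p w * (if w ∈ B then 1 else 0) ≤ μ := by
    calc _ = ∑ w ∈ S ∩ B, p w := by
          simp only [mul_ite, mul_one, mul_zero, ← sum_filter, filter_mem_eq_inter]
      _ ≤ ∑ w ∈ B, p w :=
          sum_le_sum_of_subset_of_nonneg inter_subset_right fun w _ _ => hp0 w
      _ ≤ ∑ w ∈ B, 2 / N := sum_le_sum fun w _ => hpN w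
      _ ≤ 2 / N * (μ * N / 2) := by
          rw [sum_const, nsmul_eq_mul, mul_comm]
          exact mul_le_mul_of_nonneg_left hB h2N
      _ = μ := by field_simp
  calc ∑ w ∈ S, p w * F w
      ≤ ∑ w ∈ S, e * (p w + 4 * τ * (p w * (1 - P w)) +
          6 * τ * (p w * if w ∈ B then 1 else 0)) := by
        refine sum_le_sum fun w hw => ?_
        refine (mul_le_mul_of_nonneg_left (key w hw) (hp0 w)).trans_eq ?_
        ring
    _ ≤ e * (1 + 4 * τ * μ + 6 * τ * μ) := by
        rw [← mul_sum, sum_add_distrib, sum_add_distrib, hp1, ← mul_sum, ← mul_sum]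
        gcongr
    _ ≤ e * Real.exp (10 * μ * τ) := by
        refine mul_le_mul_of_nonneg_left ?_ he0.le
        have := Real.add_one_le_exp (10 * μ * τ)
        linarith
    _ = 1 := by rw [he, ← Real.exp_add]; simp

end Drift

/-! ### Growth of an exploration -/

section Growth

open Classical Finset

variable {V : Type*} [Fintype V]

/-- A stage of the exploration of the matching from `s` and `t`: the matching has been revealed
outside `S`, which turned `G` into `G'`, and only vertices within distance `a + 1` of `s` or `t`
have been revealed. -/
structure IsExploration (G : SimpleGraph V) (s t : V) (a : ℕ) (S : Finset V)
    (G' : SimpleGraph V) : Prop where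
  isMatchingExtension : IsMatchingExtension Sᶜ G G'
  near : ∀ x ∉ S, G'.edist s x ≤ (a + 1 : ℕ) ∨ G'.edist t x ≤ (a + 1 : ℕ)

variable {G G' : SimpleGraph V} {s t : V} {a : ℕ} {S : Finset V}

lemma IsExploration.symm (h : IsExploration G s t a S G') : IsExploration G t s a S G' :=
  ⟨h.1, fun x hx => (h.2 x hx).symm⟩

lemma IsExploration.sup_edge (h : IsExploration G s t a S G') {u w : V} (hu : u ∈ S) (hw : w ∈ S)
    (hs : G'.edist s u ≤ a) :
    IsExploration G s t a (S \ {u, w}) (G' ⊔ SimpleGraph.edge u w) := by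
  refine ⟨h.1.sup_edge hu hw, fun x hx => ?_⟩
  rw [Finset.mem_sdiff, mem_insert, mem_singleton, not_and_not_right] at hx
  by_cases hxS : x ∈ S
  · left
    rcases hx hxS with rfl | rfl
    · exact ((SimpleGraph.edist_anti le_sup_left).trans hs).trans (by exact_mod_cast a.le_succ)
    · exact edist_sup_edge_le hs _
  · exact (h.2 x hxS).imp (SimpleGraph.edist_anti le_sup_left).trans
      (SimpleGraph.edist_anti le_sup_left).trans

/-- Few vertices have been touched by an exploration. -/
lemma IsExploration.card_le {Δ : ℕ} (hΔ : 2 ≤ Δ) (hdeg : DegreesAtMost G (Δ + 1))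
    (h : IsExploration G s t a S G') {U : Finset V}
    (hU : ∀ x ∈ U, x ∈ S → G'.edist s x ≤ (a + 1 : ℕ) ∨ G'.edist t x ≤ (a + 1 : ℕ)) :
    U.card ≤ 8 * (Δ + 1) ^ (a + 1) := by
  have hdeg' : DegreesAtMost G' (Δ + 1 + 1) := h.1.degreesAtMost hdeg
  have hsub : U ⊆ closedBall G' s (a + 1) ∪ closedBall G' t (a + 1) := by
    intro x hx
    rw [mem_union, mem_closedBall, mem_closedBall]
    by_cases hxS : x ∈ S
    · exact hU x hx hxS
    · exact h.2 x hxS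
  have h1 := card_closedBall_le (by omega : 2 ≤ Δ + 1) hdeg' s (a + 1)
  have h2 := card_closedBall_le (by omega : 2 ≤ Δ + 1) hdeg' t (a + 1)
  have h3 := (card_le_card hsub).trans (card_union_le _ _)
  omega

/-- Few vertices have a ball that meets a given set. -/
lemma card_filter_not_disjoint_closedBall_le {Δ : ℕ} (hΔ : 2 ≤ Δ)
    (hdeg : DegreesAtMost G (Δ + 1)) (U : Finset V) (R : ℕ) :
    (univ.filter fun w => ¬ Disjoint (closedBall G w R) U).card ≤ U.card * (4 * Δ ^ R) := by
  have hsub : (univ.filter fun w => ¬ Disjoint (closedBall G w R) U) ⊆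
      U.biUnion fun y => closedBall G y R := by
    intro w hw
    obtain ⟨y, hy, hyU⟩ := not_disjoint_iff.1 (mem_filter.1 hw).2
    refine mem_biUnion.2 ⟨y, hyU, ?_⟩
    rw [mem_closedBall] at hy ⊢
    rwa [G.edist_comm]
  refine (card_le_card hsub).trans (card_biUnion_le_card_mul _ _ _ fun y _ => ?_)
  exact card_closedBall_le hΔ hdeg y R

lemma labelWeight_le_pow {Δ : ℕ} (hΔ : 2 ≤ Δ) {g : ℝ} (hg0 : 0 ≤ g) (hg : g ≤ 3 / 2) {b l : ℕ}
    (hb : b < a) (hbl : b ≤ l) :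
    labelWeight Δ (g / (Δ + 1)) a l ≤ (g / (Δ + 1)) ^ b := by
  have hΔ' : (2 : ℝ) ≤ Δ := by exact_mod_cast hΔ
  have hx0 : 0 ≤ g / ((Δ : ℝ) + 1) := by positivity
  have hx1 : g / ((Δ : ℝ) + 1) ≤ 1 := (div_le_one (by positivity)).2 (by linarith)
  rw [labelWeight]
  split_ifs with h
  · rw [h, pow_succ]
    calc _ = (g / ((Δ : ℝ) + 1)) ^ a * g := by field_simp
      _ ≤ (g / ((Δ : ℝ) + 1)) ^ (b + 1) * g := by
          exact mul_le_mul_of_nonneg_right (pow_le_pow_of_le_one hx0 hx1 hb) hg0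
      _ = (g / ((Δ : ℝ) + 1)) ^ b * (g * g / (Δ + 1)) := by ring
      _ ≤ (g / ((Δ : ℝ) + 1)) ^ b * 1 := by
          refine mul_le_mul_of_nonneg_left ?_ (by positivity)
          rw [div_le_one (by positivity)]
          nlinarith
      _ = _ := mul_one _
  · exact pow_le_pow_of_le_one hx0 hx1 hbl

/-- The exploration from `s`.  The vertices of `Q` are those reached whose partners are not yet
revealed, `l` is the number of steps in which they were reached, and `T` is a set of vertices close
to `t` that must be preserved.  The partner of a vertex of `Q` with minimal label is revealed, and
if the ball around the partner is untouched, it is added to `Q`.  As the weight is a supermartingale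
after exponentiation, it falls below `W` with exponentially small probability only; otherwise
the exploration ends with at least `W / (2 * xᵃ)` vertices, where `x = (1 + 5 * μ) / (Δ + 1)`. -/
lemma matchingMean_le_of_growth {Δ : ℕ} (hΔ : 2 ≤ Δ) (hdeg : DegreesAtMost G (Δ + 1))
    {f : SimpleGraph V → ℝ} (hf1 : ∀ H, f H ≤ 1)
    (hf : ∀ H : SimpleGraph V, H.edist s t ≤ (2 * a + 3 : ℕ) → f H = 0) {n m R : ℕ}
    (hm : m ≤ a + 1) {μ θ W δ : ℝ} (hμ0 : 0 ≤ μ) (hμ : μ ≤ 1 / 10)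
    (hP : ∑ y, (1 - branchWeight G Δ R y) ≤ μ * Fintype.card V / 2)
    (hused : 8 * ((Δ : ℝ) + 1) ^ (a + 1) * (4 * Δ ^ R) ≤ μ * Fintype.card V / 2)
    (hθ0 : 0 ≤ θ) (hθ : θ * ((1 + 5 * μ) / (Δ + 1)) ^ n ≤ 1 / 8) (hδ : 0 ≤ δ) {T : Finset V}
    (hend : ∀ (S : Finset V) (G' : SimpleGraph V) (Q : Finset V), IsExploration G s t a S G' →
      T ⊆ S → Q ⊆ S → Disjoint Q T → (∀ z ∈ T, G'.edist t z ≤ m) →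
      (∀ z ∈ Q, G'.edist s z ≤ (a + 1 : ℕ)) →
      W ≤ 2 * ((1 + 5 * μ) / (Δ + 1)) ^ a * Q.card → matchingMean f S G' ≤ δ)
    (hE : IsExploration G s t a S G') (hTS : T ⊆ S) {Q : Finset V} (hQS : Q ⊆ S)
    (hQT : Disjoint Q T) (hT : ∀ z ∈ T, G'.edist t z ≤ m) {l : V → ℕ}
    (hln : ∀ z ∈ Q, n ≤ l z) (hla : ∀ z ∈ Q, l z ≤ a + 1) (hQ : ∀ z ∈ Q, G'.edist s z ≤ l z) :
    matchingMean f S G' ≤ δ + Real.exp (-(θ *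
      (∑ z ∈ Q, labelWeight Δ ((1 + 5 * μ) / (Δ + 1)) a (l z) - W))) := by
  induction hS : S.card using Nat.strong_induction_on generalizing S G' Q l with
  | _ c IH =>
  set g : ℝ := 1 + 5 * μ with hg
  set x : ℝ := g / (Δ + 1) with hx
  have hΔ' : (2 : ℝ) ≤ Δ := by exact_mod_cast hΔ
  have hg1 : 1 ≤ g := by linarith
  have hg2 : g ≤ 3 / 2 := by linarith
  have hx0 : 0 ≤ x := by positivity
  have hx1 : x ≤ 1 := (div_le_one (by positivity)).2 (by linarith)
  by_cases hall : ∃ z ∈ Q, l z < a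
  swap
  -- the exploration has ended: all weights are between `x ^ a` and `2 * x ^ a`
  · push Not at hall
    by_cases hWQ : W ≤ 2 * x ^ a * Q.card
    · have h1 := hend S G' Q hE hTS hQS hQT hT (fun z hz => (hQ z hz).trans
        (by exact_mod_cast hla z hz)) hWQ
      linarith [Real.exp_pos (-(θ * (∑ z ∈ Q, labelWeight Δ x a (l z) - W)))]
    · have h1 : ∑ z ∈ Q, labelWeight Δ x a (l z) ≤ Q.card • (2 * x ^ a) := by
        refine sum_le_card_nsmul _ _ _ fun z hz => ?_
        have h2 : 0 ≤ x ^ a := by positivity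
        rcases (hall z hz).eq_or_lt with h | h
        · rw [labelWeight_of_le h.ge, ← h]
          linarith
        · rw [labelWeight, if_pos (by have := hla z hz; omega),
            show l z = a + 1 by have := hla z hz; omega, pow_succ]
          have h3 : ((Δ : ℝ) + 1) * x = g := by rw [hx]; field_simp
          calc _ = x ^ a * (((Δ : ℝ) + 1) * x) := by ring
            _ ≤ x ^ a * 2 := by
              rw [h3]
              exact mul_le_mul_of_nonneg_left (by linarith) h2
            _ = _ := mul_comm _ _
      rw [nsmul_eq_mul] at h1
      have h2 : 1 ≤ Real.exp (-(θ * (∑ z ∈ Q, labelWeight Δ x a (l z) - W))) := by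
        rw [Real.one_le_exp_iff]
        nlinarith
      linarith [matchingMean_le_one hf1 S G']
  obtain ⟨u, huQ, hmin⟩ := exists_min_image Q l ⟨_, hall.choose_spec.1⟩
  have hua : l u < a := by
    obtain ⟨z, hz, hza⟩ := hall
    exact (hmin z hz).trans_lt hza
  have huS := hQS huQ
  have huT : u ∉ T := disjoint_left.1 hQT huQ
  set b := l u with hb
  obtain ⟨p, hp0, hp1, hpu, -, hmean⟩ := exists_matchingMean_eq_sum huS
  set N : ℝ := (Fintype.card V : ℝ) with hNdef
  have hN : 0 < N := Nat.cast_pos.2 (Fintype.card_pos_iff.2 ⟨u⟩)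
  -- the vertices touched so far, and the partners whose balls meet them
  set U : Finset V := Sᶜ ∪ Q ∪ T with hU
  have hUcard : (U.card : ℝ) ≤ 8 * ((Δ : ℝ) + 1) ^ (a + 1) := by
    have : U.card ≤ 8 * (Δ + 1) ^ (a + 1) := by
      refine hE.card_le hΔ hdeg fun z hz hzS => ?_
      rw [hU, mem_union, mem_union, mem_compl] at hz
      rcases hz with (hz | hz) | hz
      · exact absurd hzS hz
      · exact .inl ((hQ z hz).trans (by exact_mod_cast hla z hz))
      · exact .inr ((hT z hz).trans (by exact_mod_cast hm))
    exact_mod_cast this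
  set B : Finset V := univ.filter fun w => ¬ Disjoint (closedBall G w R) U with hB
  have hR1 : (1 : ℝ) ≤ Δ ^ R := one_le_pow₀ (by linarith)
  have hBcard : (B.card : ℝ) ≤ μ * N / 2 := by
    refine le_trans ?_ hused
    have : (B.card : ℝ) ≤ U.card * (4 * Δ ^ R) := by
      exact_mod_cast card_filter_not_disjoint_closedBall_le hΔ hdeg U R
    refine this.trans ?_
    gcongr
  have hScard : N / 2 ≤ (S.card : ℝ) - 1 := by
    have h1 : N = S.card + (Sᶜ).card := by
      rw [hNdef]
      exact_mod_cast (card_add_card_compl S).symm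
    have h2 : ((Sᶜ).card : ℝ) ≤ U.card := by
      exact_mod_cast card_le_card (subset_union_left.trans subset_union_left)
    have h3 : 1 ≤ ((Δ : ℝ) + 1) ^ (a + 1) := one_le_pow₀ (by linarith)
    nlinarith
  have hpN : ∀ w, p w ≤ 2 / N := by
    intro w
    rw [le_div_iff₀ hN]
    nlinarith [hpu w, hp0 w]
  set τ : ℝ := θ * x ^ b with hτ
  have hxb : 0 ≤ x ^ b := by positivity
  have hτ0 : 0 ≤ τ := by positivity
  have hτ8 : τ ≤ 1 / 8 := by
    refine le_trans ?_ hθ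
    exact mul_le_mul_of_nonneg_left (pow_le_pow_of_le_one hx0 hx1 (hln u huQ)) hθ0
  set Wt : ℝ := ∑ z ∈ Q, labelWeight Δ x a (l z) with hWt
  set E : ℝ := Real.exp (-(θ * (Wt - W))) with hEdef
  have hsu : G'.edist s u ≤ b := hQ u huQ
  have hlt : ∀ w, (S \ {u, w}).card < c := by
    intro w
    rw [← hS]
    exact card_lt_card ⟨sdiff_subset, fun h => by
      have := h huS
      simp at this⟩
  have hE' : ∀ w ∈ S, IsExploration G s t a (S \ {u, w}) (G' ⊔ SimpleGraph.edge u w) :=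
    fun w hw => hE.sup_edge huS hw (hsu.trans (by exact_mod_cast hua.le))
  have hT' : ∀ w, ∀ z ∈ T, (G' ⊔ SimpleGraph.edge u w).edist t z ≤ m :=
    fun w z hz => (SimpleGraph.edist_anti le_sup_left).trans (hT z hz)
  have hQ' : ∀ w, ∀ z ∈ Q, (G' ⊔ SimpleGraph.edge u w).edist s z ≤ l z :=
    fun w z hz => (SimpleGraph.edist_anti le_sup_left).trans (hQ z hz)
  have hTS' : ∀ w ∉ T, T ⊆ S \ {u, w} := by
    intro w hw z hz
    rw [Finset.mem_sdiff, mem_insert, mem_singleton, not_or]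
    exact ⟨hTS hz, fun h => huT (h ▸ hz), fun h => hw (h ▸ hz)⟩
  -- the partner `w` lies in `T`, close to `t`
  have hzero : ∀ w ∈ T, matchingMean f (S \ {u, w}) (G' ⊔ SimpleGraph.edge u w) = 0 := by
    intro w hw
    refine matchingMean_eq_zero_of_edist_le (s := s) (t := t) hf (w := w) (i := b + 1) (j := m)
      (edist_sup_edge_le hsu w) (hT' w w hw) (by omega)
  -- the weight after the revelation controls the conditional mean
  have hred : ∀ w ∈ S, w ∉ T → ∀ (Q' : Finset V) (l' : V → ℕ) (y : ℝ), Q' ⊆ S \ {u, w} →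
      Disjoint Q' T → (∀ z ∈ Q', n ≤ l' z) → (∀ z ∈ Q', l' z ≤ a + 1) →
      (∀ z ∈ Q', (G' ⊔ SimpleGraph.edge u w).edist s z ≤ l' z) →
      Wt + y ≤ ∑ z ∈ Q', labelWeight Δ x a (l' z) →
      matchingMean f (S \ {u, w}) (G' ⊔ SimpleGraph.edge u w) ≤
        δ + E * Real.exp (-(θ * y)) := by
    intro w hwS hwT Q' l' y h1 h2 h3 h4 h5 h6
    refine (IH _ (hlt w) (hE' w hwS) (hTS' w hwT) h1 h2 (hT' w) h3 h4 h5 rfl).trans ?_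
    rw [hEdef, ← Real.exp_add]
    gcongr
    nlinarith
  set F : V → ℝ := fun w => if w ∈ B then Real.exp (2 * τ) else
    Real.exp (-(τ * ((1 + 10 * μ) * branchWeight G Δ R w - 1))) with hF
  have hF0 : ∀ w, 0 < F w := fun w => by
    simp only [hF]
    split_ifs <;> exact Real.exp_pos _
  have hstep : ∀ w ∈ S, matchingMean f (S \ {u, w}) (G' ⊔ SimpleGraph.edge u w) ≤
      δ + E * F w := by
    intro w hwS
    by_cases hwT : w ∈ T
    · rw [hzero w hwT]
      have := (hF0 w).le
      positivity
    by_cases hwB : w ∈ B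
    -- the ball around `w` is not used, and `u` and `w` leave `Q`
    · simp only [hF, if_pos hwB]
      rw [show 2 * τ = -(θ * (-(2 * x ^ b))) by rw [hτ]; ring]
      refine hred w hwS hwT (Q \ {u, w}) l _ (sdiff_subset_sdiff hQS subset_rfl)
        (hQT.mono_left sdiff_subset) (fun z hz => hln z (Finset.mem_sdiff.1 hz).1)
        (fun z hz => hla z (Finset.mem_sdiff.1 hz).1)
        (fun z hz => hQ' w z (Finset.mem_sdiff.1 hz).1) ?_
      have h1 : Wt = ∑ z ∈ Q \ {u, w}, labelWeight Δ x a (l z) +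
          ∑ z ∈ Q ∩ {u, w}, labelWeight Δ x a (l z) := by
        rw [hWt, add_comm, sum_inter_add_sum_sdiff]
      have h2 : ∑ z ∈ Q ∩ {u, w}, labelWeight Δ x a (l z) ≤ (Q ∩ {u, w}).card • x ^ b := by
        refine sum_le_card_nsmul _ _ _ fun z hz => ?_
        exact labelWeight_le_pow hΔ (by linarith) hg2 hua (hmin z (mem_inter.1 hz).1)
      have h3 : ((Q ∩ {u, w}).card : ℝ) ≤ 2 := by
        exact_mod_cast (card_le_card inter_subset_right).trans card_le_two
      rw [nsmul_eq_mul] at h2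
      nlinarith
    -- `u` is replaced by the vertices of the ball around `w`, except `w` itself
    · have hdisj : Disjoint (closedBall G w R) U := by
        simpa [hB] using hwB
      have hball : ∀ z ∈ closedBall G w R, z ∈ S ∧ z ∉ Q ∧ z ∉ T := by
        intro z hz
        have := disjoint_left.1 hdisj hz
        rw [hU, mem_union, mem_union, mem_compl, not_or, not_or, not_not] at this
        exact ⟨this.1.1, this.1.2, this.2⟩
      have hwQ : w ∉ Q := (hball w (by rw [mem_closedBall]; simp)).2.1
      set A : Finset V := (closedBall G w R).filter fun z =>
        z ≠ w ∧ b + 1 + (G.edist w z).toNat ≤ a + 1 with hA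
      have hAb : ∀ z ∈ A, z ∈ closedBall G w R ∧ z ≠ w ∧
          b + 1 + (G.edist w z).toNat ≤ a + 1 := fun z hz => mem_filter.1 hz
      set l' : V → ℕ := fun z => if z ∈ A then b + 1 + (G.edist w z).toNat else l z with hl'
      have hl'A : ∀ z ∈ A, l' z = b + 1 + (G.edist w z).toNat := fun z hz => if_pos hz
      have hAQ : ∀ z ∈ Q, z ∉ A := fun z hz hzA => (hball z (hAb z hzA).1).2.1 hz
      have hl'Q : ∀ z ∈ Q, l' z = l z := fun z hz => if_neg (hAQ z hz)
      simp only [hF, if_neg hwB]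
      rw [show -(τ * ((1 + 10 * μ) * branchWeight G Δ R w - 1)) =
        -(θ * (x ^ b * ((1 + 10 * μ) * branchWeight G Δ R w) - x ^ b)) by rw [hτ]; ring]
      refine hred w hwS hwT (Q.erase u ∪ A) l' _ ?_ ?_ ?_ ?_ ?_ ?_
      · intro z hz
        rw [Finset.mem_sdiff, mem_insert, mem_singleton, not_or]
        rcases mem_union.1 hz with hz | hz
        · have := mem_erase.1 hz
          exact ⟨hQS this.2, this.1, fun h => hwQ (h ▸ this.2)⟩
        · exact ⟨(hball z (hAb z hz).1).1, fun h => (hball z (hAb z hz).1).2.1 (h ▸ huQ),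
            (hAb z hz).2.1⟩
      · refine disjoint_union_left.2 ⟨hQT.mono_left (erase_subset _ _), ?_⟩
        exact disjoint_left.2 fun z hz => (hball z (hAb z hz).1).2.2
      · intro z hz
        rcases mem_union.1 hz with hz | hz
        · rw [hl'Q z (mem_of_mem_erase hz)]
          exact hln z (mem_of_mem_erase hz)
        · rw [hl'A z hz]
          have := hln u huQ
          omega
      · intro z hz
        rcases mem_union.1 hz with hz | hz
        · rw [hl'Q z (mem_of_mem_erase hz)]
          exact hla z (mem_of_mem_erase hz)
        · rw [hl'A z hz]
          exact (hAb z hz).2.2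
      · intro z hz
        rcases mem_union.1 hz with hz | hz
        · rw [hl'Q z (mem_of_mem_erase hz)]
          exact hQ' w z (mem_of_mem_erase hz)
        · rw [hl'A z hz]
          have h1 : (G' ⊔ SimpleGraph.edge u w).edist w z ≤ ((G.edist w z).toNat : ℕ) := by
            rw [ENat.natCast_toNat (ne_top_of_le_ne_top (ENat.natCast_ne_top R)
              (mem_closedBall.1 (hAb z hz).1))]
            exact SimpleGraph.edist_anti (hE.1.1.trans le_sup_left)
          refine (SimpleGraph.edist_triangle (v := w)).trans ?_
          push_cast
          exact add_le_add (by exact_mod_cast edist_sup_edge_le hsu w) h1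
      · rw [sum_union (disjoint_left.2 fun z hz => hAQ z (mem_of_mem_erase hz))]
        have h1 : ∑ z ∈ Q.erase u, labelWeight Δ x a (l' z) + x ^ b = Wt := by
          rw [hWt, ← sum_erase_add _ _ huQ, labelWeight_of_le hua.le]
          congr 1
          exact sum_congr rfl fun z hz => by rw [hl'Q z (mem_of_mem_erase hz)]
        have h2 := le_sum_labelWeight hdeg (g := g) (ρ := 1 + 10 * μ) hg1 (by positivity)
          (by nlinarith) (Nat.succ_le_of_lt hua) R w
        have h3 : ∑ z ∈ A, labelWeight Δ x a (l' z) =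
            ∑ z ∈ A, labelWeight Δ x a (b + 1 + (G.edist w z).toNat) :=
          sum_congr rfl fun z hz => by rw [hl'A z hz]
        rw [h3]
        linarith
  rw [hmean]
  have hdrift : ∑ w ∈ S, p w * F w ≤ 1 := by
    refine sum_mul_exp_le_one (B := B) (P := branchWeight G Δ R) hN hp0 hp1 hpN
      (branchWeight_le_one hdeg R) (branchWeight_nonneg G Δ R) hτ0 hτ8 hμ0 hμ ?_ hBcard ?_ ?_
    · refine le_trans (sum_le_sum_of_subset_of_nonneg (subset_univ S) fun w _ _ => ?_) hP
      exact sub_nonneg.2 (branchWeight_le_one hdeg R w)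
    · intro w _ hw
      simp only [hF, if_neg hw, le_refl]
    · intro w _ hw
      simp only [hF, if_pos hw, le_refl]
  calc ∑ w ∈ S, p w * matchingMean f (S \ {u, w}) (G' ⊔ SimpleGraph.edge u w)
      ≤ ∑ w ∈ S, (p w * δ + E * (p w * F w)) := by
        refine sum_le_sum fun w hw => ?_
        refine (mul_le_mul_of_nonneg_left (hstep w hw) (hp0 w)).trans_eq ?_
        ring
    _ = δ + E * ∑ w ∈ S, p w * F w := by
        rw [sum_add_distrib, ← sum_mul, hp1, ← mul_sum, one_mul]
    _ ≤ δ + E := by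
        have : 0 < E := Real.exp_pos _
        nlinarith

end Growth

/-! ### The distance of two vertices -/

section Pairs

open Classical Finset

variable {V : Type*} [Fintype V]

/-- The hypotheses of an exploration up to distance `a + 1`: the balls of radius `R` in `G` are
those of the `(Δ + 1)`-regular tree up to a mean defect `μ / 2`, and the vertices whose balls meet
an exploration up to that distance are a share of at most `μ / 2` of all vertices. -/
structure BranchesUpTo (G : SimpleGraph V) (Δ R : ℕ) (μ : ℝ) (a : ℕ) : Prop where
  two_le : 2 ≤ Δ
  degreesAtMost : DegreesAtMost G (Δ + 1)
  nonneg : 0 ≤ μ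
  le_tenth : μ ≤ 1 / 10
  sum_le : ∑ y, (1 - branchWeight G Δ R y) ≤ μ * Fintype.card V / 2
  pow_le : 8 * ((Δ : ℝ) + 1) ^ (a + 1) * (4 * Δ ^ R) ≤ μ * Fintype.card V / 2

variable {G G' : SimpleGraph V} {Δ R a n : ℕ} {μ : ℝ} {s t : V} {S : Finset V}

/-- Two sets of at least `m₀` vertices around `s` and `t` whose partners are not yet revealed both
grow to at least `K` vertices within distance `a + 1`, and then an edge of the matching joins
them. -/
lemma BranchesUpTo.matchingMean_le (hG : BranchesUpTo G Δ R μ a) {f : SimpleGraph V → ℝ}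
    (hf1 : ∀ H, f H ≤ 1) (hf : ∀ H : SimpleGraph V, H.edist s t ≤ (2 * a + 3 : ℕ) → f H = 0)
    (hna : n ≤ a) {m₀ K : ℝ} (hK0 : 0 ≤ K)
    (hK : 4 * ((1 + 5 * μ) / (Δ + 1)) ^ a * K ≤ m₀ * ((1 + 5 * μ) / (Δ + 1)) ^ n)
    (hE : IsExploration G s t a S G') {Qs Qt : Finset V} (hQs : Qs ⊆ S) (hQt : Qt ⊆ S)
    (hQ : Disjoint Qs Qt) (hs : ∀ z ∈ Qs, G'.edist s z ≤ n) (ht : ∀ z ∈ Qt, G'.edist t z ≤ n)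
    (hms : m₀ ≤ Qs.card) (hmt : m₀ ≤ Qt.card) :
    matchingMean f S G' ≤
      2 * Real.exp (-(m₀ / 16)) + Real.exp (-(K ^ 2 / (2 * Fintype.card V))) := by
  have hμ0 := hG.nonneg
  have hΔ0 : (0 : ℝ) ≤ Δ := Nat.cast_nonneg _
  set x : ℝ := (1 + 5 * μ) / (Δ + 1) with hx
  have hx0 : 0 < x := by positivity
  have hxa : 0 < x ^ a := pow_pos hx0 a
  have hxn : 0 < x ^ n := pow_pos hx0 n
  set E₁ := Real.exp (-(m₀ / 16)) with hE₁
  set E₂ := Real.exp (-(K ^ 2 / (2 * (Fintype.card V : ℝ)))) with hE₂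
  have hstart : ∀ Q : Finset V, m₀ ≤ Q.card → ∀ δ : ℝ,
      δ + Real.exp (-(1 / (8 * x ^ n) *
        (∑ _z ∈ Q, labelWeight Δ x a n - m₀ * x ^ n / 2))) ≤ δ + E₁ := by
    intro Q hQ δ
    rw [hE₁]
    gcongr
    rw [sum_const, nsmul_eq_mul, labelWeight_of_le hna]
    calc m₀ / 16 = 1 / (8 * x ^ n) * (m₀ * x ^ n - m₀ * x ^ n / 2) := by field_simp; ring
      _ ≤ _ := by gcongr
  have hfinal : ∀ Q : Finset V, m₀ * x ^ n / 2 ≤ 2 * x ^ a * Q.card → K ≤ Q.card := by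
    intro Q hQ
    refine le_of_mul_le_mul_left ?_ (by positivity : 0 < 4 * x ^ a)
    linarith
  have hθ : 1 / (8 * x ^ n) * x ^ n ≤ 1 / 8 := le_of_eq (by field_simp)
  have hf' : ∀ H : SimpleGraph V, H.edist t s ≤ (2 * a + 3 : ℕ) → f H = 0 := fun H h =>
    hf H (by rwa [H.edist_comm])
  have h1 := matchingMean_le_of_growth hG.two_le hG.degreesAtMost hf1 hf
    (n := n) (m := n) (by omega) hμ0 hG.le_tenth hG.sum_le hG.pow_le
    (θ := 1 / (8 * x ^ n)) (W := m₀ * x ^ n / 2) (δ := E₁ + E₂) (by positivity) hθ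
    (by positivity) (T := Qt) ?_ hE hQt hQs hQ ht (l := fun _ => n) (fun _ _ => le_rfl)
    (fun _ _ => by omega) hs
  · refine (h1.trans (hstart Qs hms _)).trans_eq (by ring)
  · intro S₁ G₁ Q₁ hE₁' hQtS₁ hQ₁S₁ hQ₁Qt ht₁ hs₁ hW₁
    have h2 := matchingMean_le_of_growth hG.two_le hG.degreesAtMost hf1 hf'
      (n := n) (m := a + 1) le_rfl hμ0 hG.le_tenth hG.sum_le hG.pow_le
      (θ := 1 / (8 * x ^ n)) (W := m₀ * x ^ n / 2) (δ := E₂) (by positivity) hθ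
      (by positivity) (T := Q₁) ?_ hE₁'.symm hQ₁S₁ hQtS₁ hQ₁Qt.symm hs₁ (l := fun _ => n)
      (fun _ _ => le_rfl) (fun _ _ => by omega) ht₁
    · exact (h2.trans (hstart Qt hmt _)).trans_eq (add_comm _ _)
    · intro S₂ G₂ Q₂ hE₂' hQ₁S₂ hQ₂S₂ hQ₂Q₁ hs₂ ht₂ hW₂
      refine (matchingMean_le_exp_of_disjoint hf1 hf hQ₁S₂ hQ₂S₂ hQ₂Q₁.symm hs₂ ht₂).trans ?_
      rw [hE₂]
      gcongr
      have h3 := hfinal Q₁ hW₁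
      have h4 := hfinal Q₂ hW₂
      nlinarith

/-- The distance of any two vertices, if the spheres of radius `n` in `G` are large. -/
lemma BranchesUpTo.matchingMean_le_of_sphere (hG : BranchesUpTo G Δ R μ a)
    {f : SimpleGraph V → ℝ} (hf1 : ∀ H, f H ≤ 1)
    (hf : ∀ H : SimpleGraph V, H.edist s t ≤ (2 * a + 3 : ℕ) → f H = 0)
    (hna : n ≤ a) {m₀ K : ℝ} (hK0 : 0 ≤ K)
    (hK : 4 * ((1 + 5 * μ) / (Δ + 1)) ^ a * K ≤ m₀ * ((1 + 5 * μ) / (Δ + 1)) ^ n)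
    (hms : m₀ ≤ (sphere G s n).card) (hmt : m₀ ≤ (sphere G t n).card) :
    matchingMean f univ G ≤
      2 * Real.exp (-(m₀ / 16)) + Real.exp (-(K ^ 2 / (2 * Fintype.card V))) := by
  by_cases hd : Disjoint (sphere G s n) (sphere G t n)
  · exact hG.matchingMean_le hf1 hf hna hK0 hK
      ⟨isMatchingExtension_self _ G, fun x hx => absurd (mem_univ x) hx⟩ (subset_univ _)
      (subset_univ _) hd (fun z hz => (mem_sphere.1 hz).le) (fun z hz => (mem_sphere.1 hz).le)
      hms hmt
  · obtain ⟨z, hzs, hzt⟩ := not_disjoint_iff.1 hd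
    rw [matchingMean_eq_zero_of_edist_le hf (mem_sphere.1 hzs).le (mem_sphere.1 hzt).le (by omega)]
    positivity

/-- If all vertices up to distance `n` from `s` or `t` have been revealed, a vertex at distance
`n + 2` from `s` in the final graph is one of the unrevealed vertices known to be that close to
`s`, or the partner of one of them. -/
lemma IsExploration.card_sphere_le (hE : IsExploration G s t n S G') {H : SimpleGraph V}
    (hH : IsMatchingExtension S G' H) (hS : ∀ u ∈ S, ¬ G'.edist s u ≤ n)
    (hst : ¬ H.edist s t ≤ (2 * n + 4 : ℕ)) :
    (sphere H s (n + 2)).card ≤ 2 * (S.filter fun u => G'.edist s u ≤ (n + 2 : ℕ)).card := by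
  set Q := S.filter fun u => G'.edist s u ≤ (n + 2 : ℕ) with hQ
  have hold : ∀ i ≤ n + 1, ∀ z, H.edist s z = i → G'.edist s z ≤ i := by
    intro i
    induction i with
    | zero =>
      intro _ z hz
      rw [Nat.cast_zero, SimpleGraph.edist_eq_zero_iff] at hz
      simp [hz]
    | succ i ih =>
      intro hi z hz
      obtain ⟨y, hyz, hy⟩ := exists_adj_edist_eq hz
      have h1 := ih (by omega) y hy
      have h2 : y ∉ S := fun h => hS y h (h1.trans (by exact_mod_cast (by omega)))
      refine (edist_le_add_one_of_adj (hH.2.1 y h2 z hyz)).trans ?_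
      push_cast
      gcongr
  have hsub : sphere H s (n + 2) ⊆
      Q ∪ Q.biUnion fun y => univ.filter fun z => H.Adj y z ∧ ¬ G'.Adj y z := by
    intro z hz
    rw [mem_sphere] at hz
    obtain ⟨y, hyz, hy⟩ := exists_adj_edist_eq (i := n + 1) hz
    have h1 := hold (n + 1) le_rfl y hy
    have hzS : z ∈ S := by
      by_contra hzS
      rcases hE.near z hzS with h | h
      · have := (SimpleGraph.edist_anti hH.1).trans h
        rw [hz] at this
        norm_cast at this
        omega
      · refine hst ((SimpleGraph.edist_triangle (v := z)).trans ?_)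
        have h2 := (SimpleGraph.edist_anti hH.1).trans h
        rw [H.edist_comm] at h2
        rw [hz]
        calc ((n + 2 : ℕ) : ℕ∞) + H.edist z t ≤ ((n + 2 : ℕ) : ℕ∞) + (n + 1 : ℕ) := by gcongr
          _ ≤ _ := by exact_mod_cast (by omega)
    by_cases hadj : G'.Adj y z
    · refine mem_union_left _ (mem_filter.2 ⟨hzS, ?_⟩)
      refine (edist_le_add_one_of_adj hadj).trans ?_
      calc G'.edist s y + 1 ≤ ((n + 1 : ℕ) : ℕ∞) + 1 := by gcongr
        _ = _ := by norm_cast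
    · have hyS : y ∈ S := by
        by_contra hyS
        exact hadj (hH.2.1 y hyS z hyz)
      refine mem_union_right _ (mem_biUnion.2 ⟨y, mem_filter.2 ⟨hyS, ?_⟩, ?_⟩)
      · exact h1.trans (by exact_mod_cast (by omega))
      · exact mem_filter.2 ⟨mem_univ _, hyz, hadj⟩
  have h1 : (Q.biUnion fun y => univ.filter fun z => H.Adj y z ∧ ¬ G'.Adj y z).card ≤
      Q.card * 1 := by
    refine card_biUnion_le_card_mul _ _ _ fun y _ => card_le_one.2 fun z hz z' hz' => ?_
    rw [mem_filter] at hz hz'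
    exact hH.2.2 y z z' hz.2.1 hz.2.2 hz'.2.1 hz'.2.2
  have h2 := (card_le_card hsub).trans (card_union_le _ _)
  omega

/-- The distance of two vertices that are not stunted in the final graph: first all vertices up to
distance `n` are revealed, after which the vertices that are not stunted have many unrevealed
vertices nearby. -/
lemma BranchesUpTo.matchingMean_le_of_stunted (hG : BranchesUpTo G Δ R μ a)
    {f : SimpleGraph V → ℝ} (hf1 : ∀ H, f H ≤ 1)
    (hf : ∀ H : SimpleGraph V, H.edist s t ≤ (2 * a + 3 : ℕ) → f H = 0) {k : ℕ}
    (hfs : ∀ H : SimpleGraph V, s ∈ stuntedVertices H k (n + 2) → f H = 0)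
    (hft : ∀ H : SimpleGraph V, t ∈ stuntedVertices H k (n + 2) → f H = 0)
    (hna : n + 2 ≤ a) {K : ℝ} (hK0 : 0 ≤ K)
    (hK : 4 * ((1 + 5 * μ) / (Δ + 1)) ^ a * K ≤
      (k : ℝ) ^ (n + 2) / 4 * ((1 + 5 * μ) / (Δ + 1)) ^ (n + 2))
    (hE : IsExploration G s t n S G') :
    matchingMean f S G' ≤ 2 * Real.exp (-((k : ℝ) ^ (n + 2) / 4 / 16)) +
      Real.exp (-(K ^ 2 / (2 * Fintype.card V))) := by
  set B := 2 * Real.exp (-((k : ℝ) ^ (n + 2) / 4 / 16)) +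
      Real.exp (-(K ^ 2 / (2 * Fintype.card V))) with hB
  have hB0 : 0 ≤ B := by positivity
  induction hS : S.card using Nat.strong_induction_on generalizing S G' with
  | _ c IH =>
  by_cases hu : ∃ u ∈ S, G'.edist s u ≤ n ∨ G'.edist t u ≤ n
  · obtain ⟨u, huS, hu⟩ := hu
    obtain ⟨p, hp0, hp1, -, -, hmean⟩ := exists_matchingMean_eq_sum huS
    rw [hmean]
    calc _ ≤ ∑ w ∈ S, p w * B := by
          refine sum_le_sum fun w hw => mul_le_mul_of_nonneg_left ?_ (hp0 w)
          have hlt : (S \ {u, w}).card < c := by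
            rw [← hS]
            exact card_lt_card ⟨sdiff_subset, fun h => by
              have := h huS
              simp at this⟩
          refine IH _ hlt ?_ rfl
          rcases hu with hu | hu
          · exact hE.sup_edge huS hw hu
          · exact (hE.symm.sup_edge huS hw hu).symm
      _ = B := by rw [← sum_mul, hp1, one_mul]
  · have hus : ∀ u ∈ S, ¬ G'.edist s u ≤ n := fun u huS h => hu ⟨u, huS, .inl h⟩
    have hut : ∀ u ∈ S, ¬ G'.edist t u ≤ n := fun u huS h => hu ⟨u, huS, .inr h⟩
    set Qs := S.filter fun u => G'.edist s u ≤ (n + 2 : ℕ) with hQs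
    set Qt := S.filter fun u => G'.edist t u ≤ (n + 2 : ℕ) with hQt
    by_cases hd : Disjoint Qs Qt
    swap
    · obtain ⟨z, hzs, hzt⟩ := not_disjoint_iff.1 hd
      rwa [matchingMean_eq_zero_of_edist_le hf (mem_filter.1 hzs).2 (mem_filter.1 hzt).2
        (by omega)]
    have hclose : ∀ H : SimpleGraph V, H.edist s t ≤ (2 * n + 4 : ℕ) → f H = 0 := fun H h =>
      hf H (h.trans (by exact_mod_cast (by omega)))
    -- otherwise `s` or `t` will be stunted, or they are close
    by_cases hms : (k : ℝ) ^ (n + 2) / 4 ≤ Qs.card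
    swap
    · rwa [matchingMean_eq_zero fun H hH => ?_]
      by_contra hfH
      have h1 : (sphere H s (n + 2)).card ≤ 2 * Qs.card := hE.card_sphere_le hH hus fun h =>
        hfH (hclose H h)
      refine hfH (hfs H (mem_filter.2 ⟨mem_univ _, ?_⟩))
      have h2 : ((4 * Qs.card : ℕ) : ℝ) < ((k ^ (n + 2) : ℕ) : ℝ) := by
        push_cast
        linarith
      have h3 : 4 * Qs.card < k ^ (n + 2) := by exact_mod_cast h2
      omega
    by_cases hmt : (k : ℝ) ^ (n + 2) / 4 ≤ Qt.card
    swap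
    · rwa [matchingMean_eq_zero fun H hH => ?_]
      by_contra hfH
      have h1 : (sphere H t (n + 2)).card ≤ 2 * Qt.card := hE.symm.card_sphere_le hH hut fun h =>
        hfH (hclose H (by rwa [H.edist_comm]))
      refine hfH (hft H (mem_filter.2 ⟨mem_univ _, ?_⟩))
      have h2 : ((4 * Qt.card : ℕ) : ℝ) < ((k ^ (n + 2) : ℕ) : ℝ) := by
        push_cast
        linarith
      have h3 : 4 * Qt.card < k ^ (n + 2) := by exact_mod_cast h2
      omega
    have hle : ((n + 1 : ℕ) : ℕ∞) ≤ (a + 1 : ℕ) := by exact_mod_cast (by omega)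
    exact hG.matchingMean_le hf1 hf hna hK0 hK
      ⟨hE.1, fun x hx => (hE.2 x hx).imp hle.trans' hle.trans'⟩ (filter_subset _ _)
      (filter_subset _ _) hd (fun z hz => (mem_filter.1 hz).2) (fun z hz => (mem_filter.1 hz).2)
      hms hmt

/-- The flow bound for a given number of vertices: `2 * a + 3` is the distance of two vertices
that are not stunted, `2 * a' + 3` the distance of any two vertices. -/
lemma ofReal_le_addRandomMatching_maxVertexFlow [Nonempty V] {a' : ℕ}
    (hG : BranchesUpTo G Δ R μ a) (hG' : BranchesUpTo G Δ R μ a') (hna : n + 2 ≤ a)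
    (hna' : n + 2 ≤ a') {m₀ K : ℝ} (hm₀k : m₀ ≤ ((Δ : ℝ) + 1) ^ (n + 2) / 4)
    (hK0 : 0 ≤ K)
    (hK : 4 * ((1 + 5 * μ) / (Δ + 1)) ^ a * K ≤
      ((Δ : ℝ) + 1) ^ (n + 2) / 4 * ((1 + 5 * μ) / (Δ + 1)) ^ (n + 2))
    (hK' : 4 * ((1 + 5 * μ) / (Δ + 1)) ^ a' * K ≤ m₀ * ((1 + 5 * μ) / (Δ + 1)) ^ (n + 2))
    (hsphere : ∀ x, m₀ ≤ (sphere G x (n + 2)).card) {η : ℝ}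
    (hη : 2 * (Fintype.card V : ℝ) ^ 2 * (2 * Real.exp (-(m₀ / 16)) +
      Real.exp (-(K ^ 2 / (2 * Fintype.card V)))) ≤ η) :
    ENNReal.ofReal (1 - η) ≤ (addRandomMatching G).toOuterMeasure
      {H | ∀ P, IsPairOrientation P → maxVertexFlow H P ≤
        8 * ((2 * a + 3 : ℕ) + 1) * ((Δ + 1 : ℕ) : ℝ) ^ (2 * a + 3) +
          8 * (1 + 4 * (n + 2 : ℕ)) * ((Δ + 1 : ℕ) : ℝ) ^ (2 * a' + 3)} := by
  refine ofReal_le_addRandomMatching (ι := V × V × Bool) univ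
    (fun i H => if i.2.2 then ¬ H.edist i.1 i.2.1 ≤ (2 * a' + 3 : ℕ) else
      i.1 ∉ stuntedVertices H (Δ + 1) (n + 2) ∧ i.2.1 ∉ stuntedVertices H (Δ + 1) (n + 2) ∧
        ¬ H.edist i.1 i.2.1 ≤ (2 * a + 3 : ℕ)) _ G ?_ (δ := 2 * Real.exp (-(m₀ / 16)) +
      Real.exp (-(K ^ 2 / (2 * Fintype.card V)))) ?_ ?_
  · intro H hH hgood P _
    refine maxVertexFlow_le_of_forall_card_le (fun v => ?_) P
    refine card_throughPairs_le (by have := hG.two_le; omega) (hH.degreesAtMost hG.degreesAtMost)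
      (fun s t => ?_) (fun s t hs ht => ?_) v
    · simpa using hgood (s, t, true) (mem_univ _)
    · by_contra hst
      exact hgood (s, t, false) (mem_univ _) (by simpa using ⟨hs, ht, by simpa using hst⟩)
  · rintro ⟨s, t, i⟩ -
    cases i with
    | true =>
      refine hG'.matchingMean_le_of_sphere (s := s) (t := t) (n := n + 2) (fun H => ?_)
        (fun H h => ?_) hna' hK0 hK' (hsphere s) (hsphere t)
      · split_ifs <;> norm_num
      · simp only [if_true, h, not_true_eq_false, if_false]
    | false =>
      refine (hG.matchingMean_le_of_stunted (s := s) (t := t) (n := n) (k := Δ + 1)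
        (fun H => ?_) (fun H h => ?_) (fun H h => ?_) (fun H h => ?_) hna hK0
        (by exact_mod_cast hK)
        ⟨isMatchingExtension_self _ G, fun x hx => absurd (mem_univ x) hx⟩).trans ?_
      · split_ifs <;> norm_num
      · have h1 : H.edist s t ≤ 2 * a + 3 := by exact_mod_cast h
        simp [h1]
      · simp [h]
      · simp [h]
      · push_cast
        gcongr
  · refine le_trans (le_of_eq ?_) hη
    rw [card_univ, Fintype.card_prod, Fintype.card_prod, Fintype.card_bool]
    push_cast
    ring

end Pairs

/-! ### The choice of the radii -/

section Asymptotics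

open Filter Finset

lemma eventually_le_log (A : ℝ) : ∀ᶠ N : ℕ in atTop, A ≤ Real.log N :=
  (Real.tendsto_log_atTop.comp tendsto_natCast_atTop_atTop).eventually_ge_atTop A

lemma eventually_mul_log_pow_le (A : ℝ) (p : ℕ) :
    ∀ᶠ N : ℕ in atTop, A * Real.log N ^ p ≤ (N : ℝ) ^ (1 / 64 : ℝ) := by
  have h := (isLittleO_log_rpow_rpow_atTop (s := 1 / 64) p (by norm_num)).const_mul_left A
  have h1 := tendsto_natCast_atTop_atTop.eventually (h.bound one_pos)
  filter_upwards [h1] with N hN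
  rw [Real.rpow_natCast, one_mul, Real.norm_of_nonneg (by positivity : 0 ≤ (N : ℝ) ^ (1 / 64 : ℝ))]
    at hN
  exact (le_abs_self _).trans hN

lemma rpow_one_div_pow (N : ℕ) : ((N : ℝ) ^ (1 / 64 : ℝ)) ^ 64 = N := by
  rw [← Real.rpow_natCast, ← Real.rpow_mul (Nat.cast_nonneg N)]
  norm_num

/-- The depth at which a tree in which every vertex has `Δ + 1` children outgrows one with `Δ`
children by a factor `L`; the latter has polynomially many vertices in `L` at that depth. -/
lemma exists_depth {Δ : ℕ} (hΔ : 2 ≤ Δ) :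
    ∃ p : ℕ, ∀ L : ℝ, 1 ≤ L → ∃ J : ℕ, L ≤ (((Δ : ℝ) + 1) / Δ) ^ J ∧
      (Δ : ℝ) ^ (2 * J) ≤ (2 * L) ^ p := by
  have hΔ' : (2 : ℝ) ≤ Δ := by exact_mod_cast hΔ
  have hy1 : 1 < ((Δ : ℝ) + 1) / Δ := (one_lt_div (by linarith)).2 (by linarith)
  have hy2 : ((Δ : ℝ) + 1) / Δ ≤ 2 := (div_le_iff₀ (by linarith)).2 (by linarith)
  obtain ⟨p, hp⟩ := pow_unbounded_of_one_lt (Δ : ℝ) hy1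
  refine ⟨2 * p, fun L hL => ?_⟩
  obtain ⟨j, hj1, hj2⟩ := exists_nat_pow_near hL hy1
  refine ⟨j + 1, hj2.le, ?_⟩
  set y := ((Δ : ℝ) + 1) / Δ
  calc (Δ : ℝ) ^ (2 * (j + 1)) ≤ (y ^ p) ^ (2 * (j + 1)) := by gcongr
    _ = (y * y ^ j) ^ (2 * p) := by
        rw [← pow_succ', ← pow_mul, ← pow_mul]
        congr 1
        ring
    _ ≤ (2 * L) ^ (2 * p) := by gcongr

/-- With spheres of nearly maximal growth, the mean defect of the branching is of order
`1 / log N`. -/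
lemma eventually_branchesUpTo {Δ : ℕ} (hΔ : 2 ≤ Δ) {b : ℝ} (hb : 0 < b) (hb1 : b ≤ 1) :
    ∃ C : ℝ, 0 < C ∧ ∀ᶠ N : ℕ in atTop, ∃ R : ℕ, ∀ G : SimpleGraph (Fin N),
      DegreesAtMost G (Δ + 1) →
      (∀ x (i : ℕ), 1 ≤ i → (i : ℝ) ≤ Real.logb Δ N / 2 →
        b * (Δ : ℝ) ^ i ≤ (sphere G x i).card) →
      ∀ a : ℕ, (((Δ : ℝ) + 1) ^ a) ^ 4 ≤ (N : ℝ) ^ 3 →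
        BranchesUpTo G Δ R (C / Real.log N) a := by
  have hΔ' : (2 : ℝ) ≤ Δ := by exact_mod_cast hΔ
  have hlogΔ : 0 < Real.log Δ := Real.log_pos (by linarith)
  obtain ⟨p, hp⟩ := exists_depth hΔ
  set C : ℝ := 2 * (6 + 32 * (Δ + 1) * Real.log Δ) / b with hC
  have hC2 : 2 ≤ C := by
    rw [hC, le_div_iff₀ hb]
    have : 0 ≤ 32 * ((Δ : ℝ) + 1) * Real.log Δ := by positivity
    linarith
  refine ⟨C, by linarith, ?_⟩
  filter_upwards [eventually_le_log 1, eventually_le_log (10 * C), eventually_mul_log_pow_le 1 1,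
    eventually_mul_log_pow_le (32 * (Δ + 1)) 0, eventually_mul_log_pow_le (2 ^ p) p]
    with N hl1 hlC hlt hΔt hpt
  obtain ⟨J, hJ1, hJ2⟩ := hp _ hl1
  set L := Real.log N with hL
  set t := (N : ℝ) ^ (1 / 64 : ℝ) with ht
  have htN : t ^ 64 = N := rpow_one_div_pow N
  rw [pow_zero, mul_one] at hΔt
  rw [pow_one, one_mul] at hlt
  rw [← mul_pow] at hpt
  have ht1 : 1 ≤ t := hl1.trans hlt
  have hN0 : (0 : ℝ) < N := by
    rw [← htN]
    positivity
  have hJt : (Δ : ℝ) ^ (2 * J) ≤ t := hJ2.trans hpt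
  set l := Real.logb Δ N with hl
  have hlL : l = L / Real.log Δ := rfl
  have hpow : ∀ m : ℕ, (Δ : ℝ) ^ m ≤ N → (m : ℝ) ≤ l := by
    intro m hm
    rw [hl, Real.le_logb_iff_rpow_le (by linarith) hN0, Real.rpow_natCast]
    exact hm
  have hl8 : 8 ≤ l := by
    have := hpow 8 ?_
    · exact_mod_cast this
    · rw [← htN]
      calc (Δ : ℝ) ^ 8 ≤ t ^ 8 := by
            gcongr
            linarith
        _ ≤ t ^ 64 := pow_le_pow_right₀ ht1 (by norm_num)
  have hJl : 4 * ((J : ℝ) + 1) ≤ l := by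
    have := hpow (4 * (J + 1)) ?_
    · exact_mod_cast this
    · rw [← htN]
      calc (Δ : ℝ) ^ (4 * (J + 1)) = (Δ : ℝ) ^ 4 * ((Δ : ℝ) ^ (2 * J)) ^ 2 := by ring
        _ ≤ t ^ 4 * t ^ 2 := by
            gcongr
            linarith
        _ = t ^ 6 := by ring
        _ ≤ t ^ 64 := pow_le_pow_right₀ ht1 (by norm_num)
  set M := ⌊l / 4⌋₊ with hM
  have hM1 : (M : ℝ) ≤ l / 4 := Nat.floor_le (by linarith)
  have hM2 : l / 8 ≤ M := by
    have := Nat.lt_floor_add_one (l / 4)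
    linarith
  have hM0 : (0 : ℝ) < M := by linarith
  refine ⟨2 * J, fun G hdeg hgrow a ha => ⟨hΔ, hdeg, by positivity, ?_, ?_, ?_⟩⟩
  · rw [div_le_iff₀ (by linarith)]
    linarith
  · have h1 := sum_one_sub_branchWeight_le hΔ hdeg (J := J) (M := M) (by exact_mod_cast hM0) hb
      fun x m hm => hgrow x _ (by omega) (by
        have : (m : ℝ) ≤ M := by exact_mod_cast hm.le
        push_cast
        linarith)
    rw [Fintype.card_fin] at h1 ⊢
    refine h1.trans ?_
    have h2 : ((Δ : ℝ) / (Δ + 1)) ^ J ≤ 1 / L := by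
      rw [← inv_div, inv_pow, inv_eq_one_div]
      exact one_div_le_one_div_of_le (by linarith) hJ1
    have h3 : 1 / (M : ℝ) ≤ 8 * Real.log Δ / L := by
      rw [div_le_div_iff₀ hM0 (by linarith), one_mul]
      rw [hlL, div_div, div_le_iff₀ (by positivity)] at hM2
      linarith
    calc (N : ℝ) * ((6 * ((Δ : ℝ) / (Δ + 1)) ^ J * M + 4 * (Δ + 1)) / (M * b))
        = N * ((6 * ((Δ : ℝ) / (Δ + 1)) ^ J + 4 * (Δ + 1) * (1 / M)) / b) := by
          field_simp
      _ ≤ N * ((6 * (1 / L) + 4 * (Δ + 1) * (8 * Real.log Δ / L)) / b) := by gcongr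
      _ = C / L * N / 2 := by
          rw [hC]
          field_simp
          ring
  · rw [Fintype.card_fin]
    have h1 : ((Δ : ℝ) + 1) ^ a ≤ t ^ 48 := by
      refine le_of_pow_le_pow_left₀ (n := 4) (by norm_num) (by positivity) (ha.trans_eq ?_)
      rw [← htN]
      ring
    calc 8 * ((Δ : ℝ) + 1) ^ (a + 1) * (4 * (Δ : ℝ) ^ (2 * J))
        = 32 * (Δ + 1) * ((Δ : ℝ) + 1) ^ a * (Δ : ℝ) ^ (2 * J) := by ring
      _ ≤ t * t ^ 48 * t := by gcongr
      _ = t ^ 50 := by ring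
      _ ≤ t ^ 63 := pow_le_pow_right₀ ht1 (by norm_num)
      _ ≤ 2 / L * N / 2 := by
          rw [← htN, div_mul_eq_mul_div, div_div, le_div_iff₀ (by linarith)]
          have h2 : t ^ 63 * L ≤ t ^ 63 * t := by gcongr
          calc t ^ 63 * (L * 2) = 2 * (t ^ 63 * L) := by ring
            _ ≤ 2 * (t ^ 63 * t) := by gcongr
            _ = _ := by ring
      _ ≤ C / L * N / 2 := by gcongr

lemma pow_four_le_two_pow (q : ℕ) : (1 + 4 * (q : ℝ)) ^ 4 ≤ 32 ^ 4 * 2 ^ q := by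
  have h1 := one_add_mul_le_pow (a := (1 / 8 : ℝ)) (by norm_num) q
  calc (1 + 4 * (q : ℝ)) ^ 4 ≤ (32 * (1 + q * (1 / 8))) ^ 4 := by
        gcongr
        linarith
    _ ≤ (32 * (1 + 1 / 8) ^ q) ^ 4 := by gcongr
    _ = 32 ^ 4 * ((1 + 1 / 8) ^ 4) ^ q := by rw [mul_pow, ← pow_mul, mul_comm q 4, pow_mul]
    _ ≤ 32 ^ 4 * 2 ^ q := by
        gcongr
        norm_num

/-- The number of vertices that an exploration with seeds of maximal size reaches. -/
lemma weight_le_of_le_pow {k g E K : ℝ} {a : ℕ} (q : ℕ) (hk : 0 < k) (hg : 1 ≤ g) (hK : 0 ≤ K)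
    (hgE : g ^ a ≤ E) (ha : 16 * E * K ≤ k ^ a) :
    4 * (g / k) ^ a * K ≤ k ^ q / 4 * (g / k) ^ q := by
  have hgq : 1 ≤ g ^ q := one_le_pow₀ hg
  calc 4 * (g / k) ^ a * K = 4 * g ^ a * K / k ^ a := by rw [div_pow]; ring
    _ ≤ 1 / 4 := by
        rw [div_le_iff₀ (by positivity)]
        nlinarith
    _ ≤ g ^ q / 4 := by gcongr
    _ = k ^ q / 4 * (g / k) ^ q := by
        rw [div_pow]
        field_simp

/-- The number of vertices that an exploration with seeds of minimal size reaches. -/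
lemma weight_le_of_mul_le_pow {k d b g E K : ℝ} {a q : ℕ} (hk : 0 < k) (hd : 0 < d) (hb : 0 < b)
    (hg : 1 ≤ g) (hK : 0 ≤ K) (hgE : g ^ a ≤ E) (ha : 4 * E / b * K * (k / d) ^ q ≤ k ^ a) :
    4 * (g / k) ^ a * K ≤ b * d ^ q * (g / k) ^ q := by
  have hgq : 1 ≤ g ^ q := one_le_pow₀ hg
  have hka : 0 < k ^ a := by positivity
  have hkd : 0 < (k / d) ^ q := by positivity
  calc 4 * (g / k) ^ a * K = 4 * g ^ a * K / k ^ a := by rw [div_pow]; ring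
    _ ≤ b / (k / d) ^ q := by
        rw [div_le_div_iff₀ hka hkd]
        calc 4 * g ^ a * K * (k / d) ^ q ≤ 4 * E * K * (k / d) ^ q := by gcongr
          _ = b * (4 * E / b * K * (k / d) ^ q) := by
              generalize (k / d) ^ q = ρ
              field_simp
          _ ≤ b * k ^ a := by gcongr
    _ ≤ b / (k / d) ^ q * g ^ q := le_mul_of_one_le_right (by positivity) hgq
    _ = b * d ^ q * (g / k) ^ q := by
        rw [div_pow, div_pow]
        field_simp

lemma failure_probability_le {N L m K η : ℝ} (hN : 0 < N) (hexp : Real.exp L = N) (hL : 0 ≤ L)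
    (hm : 48 * L ≤ m) (hK : K ^ 2 = 8 * N * L) (hη : 6 / η ≤ N) (hη0 : 0 < η) :
    2 * N ^ 2 * (2 * Real.exp (-(m / 16)) + Real.exp (-(K ^ 2 / (2 * N)))) ≤ η := by
  have h1 : Real.exp (-(m / 16)) ≤ Real.exp (-(3 * L)) := Real.exp_le_exp.2 (by linarith)
  have h2 : Real.exp (-(K ^ 2 / (2 * N))) ≤ Real.exp (-(3 * L)) := by
    rw [hK, show 8 * N * L / (2 * N) = 4 * L by field_simp; ring]
    exact Real.exp_le_exp.2 (by linarith)
  have h3 : Real.exp (-(3 * L)) = 1 / N ^ 3 := by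
    rw [Real.exp_neg, ← hexp, ← Real.exp_nat_mul, inv_eq_one_div]
    norm_num
  rw [h3] at h1 h2
  calc _ ≤ 2 * N ^ 2 * (2 * (1 / N ^ 3) + 1 / N ^ 3) := by gcongr
    _ = 6 / N := by
        field_simp
        norm_num
    _ ≤ η := by
        rw [div_le_iff₀ hη0] at hη
        rw [div_le_iff₀ hN]
        linarith

/-- The contribution of the pairs of vertices that are not stunted is of order `N (log N) ^ 2`. -/
lemma mul_pow_le_of_le_mul {k c K N L l : ℝ} {a : ℕ} (hk : 0 < k) (hN : 0 ≤ N) (hL : 1 ≤ L)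
    (hl : 0 < l) (haL : a ≤ L) (hak : k ^ a ≤ c * K) (hK : K ^ 2 = 8 * N * L)
    (hlarge : 2 * l ^ 2 * (48 * (8 * k ^ 3 * c ^ 2)) ≤ L) :
    8 * (((2 * a + 3 : ℕ) : ℝ) + 1) * k ^ (2 * a + 3) ≤ N * L * (L / l) ^ 2 / 2 := by
  have h1 : 48 * (8 * k ^ 3 * c ^ 2) ≤ L / (2 * l ^ 2) := by
    rw [le_div_iff₀ (by positivity)]
    linarith
  have h2 : (k ^ a) ^ 2 ≤ (c * K) ^ 2 := by gcongr
  calc 8 * (((2 * a + 3 : ℕ) : ℝ) + 1) * k ^ (2 * a + 3)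
      = 8 * (2 * a + 4) * (k ^ 3 * (k ^ a) ^ 2) := by push_cast; ring
    _ ≤ 48 * L * (k ^ 3 * (c * K) ^ 2) := by
        have h3 : 8 * (2 * (a : ℝ) + 4) ≤ 48 * L := by linarith
        have h4 : 0 ≤ k ^ 3 := by positivity
        exact mul_le_mul h3 (mul_le_mul_of_nonneg_left h2 h4) (by positivity) (by positivity)
    _ = 48 * (8 * k ^ 3 * c ^ 2) * (N * L ^ 2) := by rw [mul_pow, hK]; ring
    _ ≤ L / (2 * l ^ 2) * (N * L ^ 2) := mul_le_mul_of_nonneg_right h1 (by positivity)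
    _ = N * L * (L / l) ^ 2 / 2 := by field_simp

/-- The contribution of the other pairs: `ρ ^ 2` is of order at most `(log N) ^ (3 / 2)`, and `q` of
order `log log N`. -/
lemma mul_pow_le_of_le_mul_mul {k c K N L l ρ A : ℝ} {a q : ℕ} (hk : 0 < k) (hN : 0 ≤ N)
    (hL : 1 ≤ L) (hl : 0 < l) (hc : 0 < c) (hA : 0 ≤ A) (hak : k ^ a ≤ c * K * ρ)
    (hρ : ρ ^ 4 ≤ (A * L) ^ 3)
    (hq : 2 ^ q ≤ A * L) (hK : K ^ 2 = 8 * N * L)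
    (hlarge : (2 * l ^ 2 * (64 * k ^ 3 * c ^ 2)) ^ 4 * (32 ^ 4 * A ^ 7) ≤ L) :
    8 * (1 + 4 * (q : ℝ)) * k ^ (2 * a + 3) ≤ N * L * (L / l) ^ 2 / 2 := by
  set B := 64 * k ^ 3 * c ^ 2 with hB
  have hB0 : 0 < B := by positivity
  have hd0 : 0 < (2 * l ^ 2 * B) ^ 4 := by positivity
  have h2 : (1 + 4 * (q : ℝ)) * ρ ^ 2 ≤ L ^ 2 / (2 * l ^ 2 * B) := by
    refine le_of_pow_le_pow_left₀ (n := 4) (by norm_num) (by positivity) ?_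
    have h3 : (1 + 4 * (q : ℝ)) ^ 4 ≤ 32 ^ 4 * (A * L) :=
      (pow_four_le_two_pow q).trans (by gcongr)
    have h4 : (ρ ^ 4) ^ 2 ≤ ((A * L) ^ 3) ^ 2 := by gcongr
    calc ((1 + 4 * (q : ℝ)) * ρ ^ 2) ^ 4 = (1 + 4 * (q : ℝ)) ^ 4 * (ρ ^ 4) ^ 2 := by ring
      _ ≤ (32 ^ 4 * (A * L)) * ((A * L) ^ 3) ^ 2 :=
          mul_le_mul h3 h4 (by positivity) (by positivity)
      _ = 32 ^ 4 * A ^ 7 * L ^ 7 := by ring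
      _ ≤ L / (2 * l ^ 2 * B) ^ 4 * L ^ 7 := by
          refine mul_le_mul_of_nonneg_right ?_ (by positivity)
          rw [le_div_iff₀ hd0]
          linarith
      _ = _ := by
          rw [div_pow]
          ring
  have h5 : (k ^ a) ^ 2 ≤ (c * K * ρ) ^ 2 := by gcongr
  calc 8 * (1 + 4 * (q : ℝ)) * k ^ (2 * a + 3)
      = 8 * (1 + 4 * (q : ℝ)) * k ^ 3 * (k ^ a) ^ 2 := by ring
    _ ≤ 8 * (1 + 4 * (q : ℝ)) * k ^ 3 * (c * K * ρ) ^ 2 :=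
        mul_le_mul_of_nonneg_left h5 (by positivity)
    _ = B * (N * L) * ((1 + 4 * (q : ℝ)) * ρ ^ 2) := by rw [hB, mul_pow, mul_pow, hK]; ring
    _ ≤ B * (N * L) * (L ^ 2 / (2 * l ^ 2 * B)) := mul_le_mul_of_nonneg_left h2 (by positivity)
    _ = N * L * (L / l) ^ 2 / 2 := by field_simp

lemma succ_div_pow_pow_four_le {d : ℝ} (hd : 2 ≤ d) (q : ℕ) :
    (((d + 1) / d) ^ q) ^ 4 ≤ (d ^ q) ^ 3 := by
  rw [← pow_mul, ← pow_mul, mul_comm q 4, mul_comm q 3, pow_mul, pow_mul]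
  refine pow_le_pow_left₀ (by positivity) ?_ q
  have h1 : (d + 1) / d ≤ 3 / 2 := by
    rw [div_le_iff₀ (by linarith)]
    linarith
  calc ((d + 1) / d) ^ 4 ≤ (3 / 2) ^ 4 := by gcongr
    _ ≤ 2 ^ 3 := by norm_num
    _ ≤ d ^ 3 := by gcongr

lemma le_log_of_pow_le {k N : ℝ} (hk : 3 ≤ k) (hN : 0 < N) {m : ℕ} (hm : k ^ m ≤ N) :
    (m : ℝ) ≤ Real.log N := by
  rw [Real.le_log_iff_exp_le hN]
  calc Real.exp m = Real.exp 1 ^ m := by rw [← Real.exp_nat_mul, mul_one]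
    _ ≤ k ^ m := by
        gcongr
        linarith [Real.exp_one_lt_d9]
    _ ≤ N := hm

lemma one_add_pow_le_exp {C L : ℝ} (hC : 0 ≤ C) (hL : 0 < L) {m : ℕ} (hm : m ≤ L) :
    (1 + 5 * (C / L)) ^ m ≤ Real.exp (5 * C) := by
  calc (1 + 5 * (C / L)) ^ m ≤ Real.exp (5 * (C / L)) ^ m := by
        gcongr
        linarith [Real.add_one_le_exp (5 * (C / L))]
    _ = Real.exp (5 * C * (m / L)) := by
        rw [← Real.exp_nat_mul]
        congr 1
        ring
    _ ≤ Real.exp (5 * C) := by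
        rw [Real.exp_le_exp]
        exact mul_le_of_le_one_right (by positivity) ((div_le_one hL).2 hm)

/-- The radii of the explorations.  With `n + 2` of order `log log N` the seeds have at least a
constant times `log N` vertices, so that each pair fails with probability of order `1 / N ^ 3`;
`(Δ + 1) ^ (2 * a)` is of order `N log N`, and `(Δ + 1) ^ (2 * a')` of order at most
`N (log N) ^ (5 / 2)`, because `((Δ + 1) / Δ) ^ 4 ≤ Δ ^ 3`. -/
lemma eventually_exists_radii {Δ : ℕ} (hΔ : 2 ≤ Δ) {b : ℝ} (hb : 0 < b) (hb1 : b ≤ 1) {C : ℝ}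
    (hC : 0 < C) {η : ℝ} (hη : 0 < η) :
    ∀ᶠ N : ℕ in atTop, ∃ (n a a' : ℕ) (K : ℝ), n + 2 ≤ a ∧ n + 2 ≤ a' ∧ 0 ≤ K ∧
      ((n + 2 : ℕ) : ℝ) ≤ Real.logb Δ N / 2 ∧
      (((Δ : ℝ) + 1) ^ a) ^ 4 ≤ (N : ℝ) ^ 3 ∧ (((Δ : ℝ) + 1) ^ a') ^ 4 ≤ (N : ℝ) ^ 3 ∧
      4 * ((1 + 5 * (C / Real.log N)) / (Δ + 1)) ^ a * K ≤
        ((Δ : ℝ) + 1) ^ (n + 2) / 4 * ((1 + 5 * (C / Real.log N)) / (Δ + 1)) ^ (n + 2) ∧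
      4 * ((1 + 5 * (C / Real.log N)) / (Δ + 1)) ^ a' * K ≤
        b * (Δ : ℝ) ^ (n + 2) * ((1 + 5 * (C / Real.log N)) / (Δ + 1)) ^ (n + 2) ∧
      2 * (N : ℝ) ^ 2 * (2 * Real.exp (-(b * (Δ : ℝ) ^ (n + 2) / 16)) +
        Real.exp (-(K ^ 2 / (2 * N)))) ≤ η ∧
      8 * ((2 * a + 3 : ℕ) + 1) * ((Δ + 1 : ℕ) : ℝ) ^ (2 * a + 3) +
        8 * (1 + 4 * (n + 2 : ℕ)) * ((Δ + 1 : ℕ) : ℝ) ^ (2 * a' + 3) ≤ flowScale (Δ + 1) N := by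
  have hΔ' : (2 : ℝ) ≤ Δ := by exact_mod_cast hΔ
  obtain ⟨k, hk⟩ : ∃ k : ℝ, (Δ : ℝ) + 1 = k := ⟨_, rfl⟩
  obtain ⟨E, hE⟩ : ∃ E : ℝ, Real.exp (5 * C) = E := ⟨_, rfl⟩
  -- the number of vertices in a seed is at most `A * log N`
  obtain ⟨A, hA⟩ : ∃ A : ℝ, (Δ : ℝ) ^ 2 * (48 / b) = A := ⟨_, rfl⟩
  have hk3 : 3 ≤ k := by linarith
  have hk0 : 0 < k := by linarith
  have hkΔ : k ≤ (Δ : ℝ) ^ 2 := by nlinarith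
  have hlk0 : 0 < Real.log k := Real.log_pos (by linarith)
  have hE1 : 1 ≤ E := hE ▸ Real.one_le_exp (by positivity)
  have hA0 : 0 < A := hA ▸ by positivity
  have hbE : 0 < 4 * E / b := by positivity
  filter_upwards [eventually_le_log 1,
    eventually_le_log (2 * Real.log k ^ 2 * (48 * (8 * k ^ 3 * (16 * k * E) ^ 2))),
    eventually_le_log ((2 * Real.log k ^ 2 * (64 * k ^ 3 * (k * (4 * E / b)) ^ 2)) ^ 4 *
      (32 ^ 4 * A ^ 7)),
    eventually_mul_log_pow_le 1 1, eventually_mul_log_pow_le 8 0,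
    eventually_mul_log_pow_le (16 * k * E) 0, eventually_mul_log_pow_le (k * (4 * E / b)) 0,
    eventually_mul_log_pow_le A 1, eventually_ge_atTop ⌈6 / η⌉₊]
    with N hl1 hlA₂ hlA₄ hlt h8t hkt hkt' hAt hNη
  rw [hk]
  obtain ⟨L, hL⟩ : ∃ L : ℝ, Real.log N = L := ⟨_, rfl⟩
  obtain ⟨t, ht⟩ : ∃ t : ℝ, (N : ℝ) ^ (1 / 64 : ℝ) = t := ⟨_, rfl⟩
  have htN : t ^ 64 = N := ht ▸ rpow_one_div_pow N
  rw [pow_zero, mul_one, ht] at h8t hkt hkt'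
  rw [pow_one, hL, ht] at hlt hAt
  rw [one_mul] at hlt
  rw [hL] at hl1 hlA₂ hlA₄ ⊢
  have ht1 : 1 ≤ t := hl1.trans hlt
  have hN0 : (0 : ℝ) < N := by
    rw [← htN]
    positivity
  have hL0 : 0 < L := by linarith
  have hexpL : Real.exp L = N := hL ▸ Real.exp_log hN0
  -- the seeds
  obtain ⟨n, hn1, hn2⟩ := exists_nat_pow_near (x := 48 / b * L) (y := (Δ : ℝ))
    (by rw [div_mul_eq_mul_div, le_div_iff₀ hb]; linarith) (by linarith)
  have hq1 : 48 / b * L ≤ (Δ : ℝ) ^ (n + 2) :=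
    hn2.le.trans (pow_le_pow_right₀ (by linarith) (by omega))
  have hq2 : (Δ : ℝ) ^ (n + 2) ≤ A * L := by
    rw [pow_add, ← hA, mul_comm, mul_assoc]
    gcongr
  obtain ⟨ρ, hρ⟩ : ∃ ρ : ℝ, (k / Δ) ^ (n + 2) = ρ := ⟨_, rfl⟩
  have hρ1 : 1 ≤ ρ := hρ ▸ one_le_pow₀ ((one_le_div (by linarith)).2 (by linarith))
  have hρ4 : ρ ^ 4 ≤ (A * L) ^ 3 := by
    rw [← hρ, ← hk]
    exact (succ_div_pow_pow_four_le hΔ' _).trans (pow_le_pow_left₀ (by positivity) hq2 3)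
  have hρt : ρ ≤ t ^ 3 := by
    calc ρ ≤ ρ ^ 4 := le_self_pow₀ hρ1 (by norm_num)
      _ ≤ (A * L) ^ 3 := hρ4
      _ ≤ t ^ 3 := by gcongr
  -- the number of vertices that the explorations must reach
  obtain ⟨K, hK0, hK2⟩ : ∃ K : ℝ, 0 ≤ K ∧ K ^ 2 = 8 * N * L :=
    ⟨Real.sqrt (8 * N * L), Real.sqrt_nonneg _, Real.sq_sqrt (by positivity)⟩
  have hKt : K ≤ t ^ 33 := by
    refine le_of_pow_le_pow_left₀ (n := 2) (by norm_num) (by positivity) ?_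
    rw [hK2, ← htN]
    calc 8 * t ^ 64 * L ≤ t * t ^ 64 * t := by gcongr
      _ = (t ^ 33) ^ 2 := by ring
  have hKt' : t ^ 32 ≤ K := by
    refine le_of_pow_le_pow_left₀ (n := 2) (by norm_num) hK0 ?_
    rw [hK2, ← htN]
    calc (t ^ 32) ^ 2 = 1 * t ^ 64 * 1 := by ring
      _ ≤ 8 * t ^ 64 * L := by gcongr; norm_num
  have hK1 : 1 ≤ K := (one_le_pow₀ ht1).trans hKt'
  have h16E : 1 ≤ 16 * E := by linarith
  have h4E : 1 ≤ 4 * E / b := (one_le_div hb).2 (by linarith)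
  obtain ⟨a₀, ha1, ha2⟩ := exists_nat_pow_near (x := 16 * E * K) (y := k)
    (one_le_mul_of_one_le_of_one_le h16E hK1)
    (by linarith)
  obtain ⟨a₁, ha1', ha2'⟩ := exists_nat_pow_near (x := 4 * E / b * K * ρ) (y := k)
    (one_le_mul_of_one_le_of_one_le (one_le_mul_of_one_le_of_one_le h4E hK1) hρ1) (by linarith)
  have ha3 : 4 * E / b * K * (k / Δ) ^ (n + 2) ≤ k ^ (a₁ + 1) := by
    rw [hρ]
    exact ha2'.le
  have hak : k ^ (a₀ + 1) ≤ 16 * k * E * K := by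
    rw [pow_succ']
    exact (mul_le_mul_of_nonneg_left ha1 hk0.le).trans_eq (by ring)
  have hak' : k ^ (a₁ + 1) ≤ k * (4 * E / b) * K * ρ := by
    rw [pow_succ']
    exact (mul_le_mul_of_nonneg_left ha1' hk0.le).trans_eq (by ring)
  have hat : k ^ (a₀ + 1) ≤ t ^ 48 := by
    calc k ^ (a₀ + 1) ≤ t * t ^ 33 := hak.trans (by gcongr)
      _ = t ^ 34 := by ring
      _ ≤ t ^ 48 := pow_le_pow_right₀ ht1 (by norm_num)
  have hat' : k ^ (a₁ + 1) ≤ t ^ 48 := by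
    calc k ^ (a₁ + 1) ≤ t * t ^ 33 * t ^ 3 := hak'.trans (by gcongr)
      _ = t ^ 37 := by ring
      _ ≤ t ^ 48 := pow_le_pow_right₀ ht1 (by norm_num)
  have hN3 : ∀ m : ℕ, k ^ m ≤ t ^ 48 → (k ^ m) ^ 4 ≤ (N : ℝ) ^ 3 := by
    intro m hm
    calc (k ^ m) ^ 4 ≤ (t ^ 48) ^ 4 := by gcongr
      _ = (N : ℝ) ^ 3 := by rw [← htN]; ring
  have hmL : ∀ m : ℕ, k ^ m ≤ t ^ 48 → (m : ℝ) ≤ L := fun m hm => hL ▸ le_log_of_pow_le hk3 hN0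
    (hm.trans ((pow_le_pow_right₀ ht1 (by norm_num)).trans_eq htN))
  have hqk : k ^ (n + 2) ≤ K := by
    calc k ^ (n + 2) ≤ ((Δ : ℝ) ^ 2) ^ (n + 2) := pow_le_pow_left₀ hk0.le hkΔ _
      _ = ((Δ : ℝ) ^ (n + 2)) ^ 2 := by rw [← pow_mul, ← pow_mul, mul_comm]
      _ ≤ t ^ 2 := pow_le_pow_left₀ (by positivity) (hq2.trans hAt) 2
      _ ≤ t ^ 32 := pow_le_pow_right₀ ht1 (by norm_num)
      _ ≤ K := hKt'
  have hqa : n + 2 ≤ a₀ + 1 := by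
    refine (pow_le_pow_iff_right₀ (by linarith : 1 < k)).1 (hqk.trans (le_trans ?_ ha2.le))
    exact le_mul_of_one_le_left hK0 h16E
  have hqa' : n + 2 ≤ a₁ + 1 := by
    refine (pow_le_pow_iff_right₀ (by linarith : 1 < k)).1 (hqk.trans (le_trans ?_ ha2'.le))
    calc K = 1 * K * 1 := by ring
      _ ≤ 4 * E / b * K * ρ := by gcongr
  have hg1 : 1 ≤ 1 + 5 * (C / L) := by
    have : 0 ≤ 5 * (C / L) := by positivity
    linarith
  have hgE : ∀ m : ℕ, k ^ m ≤ t ^ 48 → (1 + 5 * (C / L)) ^ m ≤ E := fun m hm =>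
    hE ▸ one_add_pow_le_exp hC.le hL0 (hmL m hm)
  refine ⟨n, a₀ + 1, a₁ + 1, K, hqa, hqa', hK0, ?_, hN3 _ hat, hN3 _ hat',
    weight_le_of_le_pow _ hk0 hg1 hK0 (hgE _ hat) ha2.le,
    weight_le_of_mul_le_pow hk0 (by linarith) hb hg1 hK0 (hgE _ hat') ha3,
    failure_probability_le hN0 hexpL hL0.le ?_ hK2 (Nat.ceil_le.1 hNη) hη, ?_⟩
  · rw [le_div_iff₀ two_pos, Real.le_logb_iff_rpow_le (by linarith) hN0,
      show ((n + 2 : ℕ) : ℝ) * 2 = ((2 * (n + 2) : ℕ) : ℝ) by push_cast; ring, Real.rpow_natCast]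
    calc (Δ : ℝ) ^ (2 * (n + 2)) = ((Δ : ℝ) ^ (n + 2)) ^ 2 := by rw [← pow_mul, mul_comm]
      _ ≤ t ^ 2 := pow_le_pow_left₀ (by positivity) (hq2.trans hAt) 2
      _ ≤ t ^ 64 := pow_le_pow_right₀ ht1 (by norm_num)
      _ = N := htN
  · rw [div_mul_eq_mul_div, div_le_iff₀ hb] at hq1
    linarith
  · have hcast : ((Δ + 1 : ℕ) : ℝ) = k := by
      push_cast
      exact hk
    have hscale : flowScale (Δ + 1) N = N * L * (L / Real.log k) ^ 2 := by
      rw [flowScale, Real.logb, hcast, hL]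
    rw [hscale, hcast]
    have h1 := mul_pow_le_of_le_mul hk0 hN0.le hl1 hlk0 (hmL _ hat) hak hK2 hlA₂
    have h2 := mul_pow_le_of_le_mul_mul (q := n + 2) hk0 hN0.le hl1 hlk0 (by positivity) hA0.le
      hak' hρ4 ((pow_le_pow_left₀ two_pos.le hΔ' _).trans hq2) hK2 hlA₄
    linarith

end Asymptotics

/-! ### The bound for the maximum vertex flow -/

/-- The growth hypothesis in terms of the cardinality of spheres. -/
lemma NeighborhoodGrowth.le_card_sphere {V : Type*} [Fintype V] {G : SimpleGraph V} {Δ : ℕ}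
    (hΔ : 2 ≤ Δ) {ε c : ℝ} (hε : 0 ≤ ε) (h : NeighborhoodGrowth G (Δ + 1) ε c)
    (hlog : 0 ≤ Real.logb Δ (Fintype.card V)) {b : ℝ} (hb : b ≤ c * (Δ + 1) / (Δ : ℝ) ^ 2)
    (x : V) {i : ℕ} (hi : 1 ≤ i) (hi' : (i : ℝ) ≤ Real.logb Δ (Fintype.card V) / 2) :
    b * (Δ : ℝ) ^ i ≤ (sphere G x i).card := by
  have hΔ0 : (Δ : ℝ) ≠ 0 := by positivity
  have h1 := h x i hi
  push_cast at h1
  rw [add_sub_cancel_right] at h1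
  have h2 := h1 (by nlinarith)
  have h3 : {y | G.edist x y = i}.ncard = (sphere G x i).card := by
    rw [← Set.ncard_coe_finset]
    congr 1
    ext y
    simp [mem_sphere]
  rw [h3, zpow_sub₀ hΔ0, zpow_natCast] at h2
  refine le_trans ?_ h2
  calc b * (Δ : ℝ) ^ i ≤ c * (Δ + 1) / (Δ : ℝ) ^ 2 * (Δ : ℝ) ^ i := by gcongr
    _ = _ := by
      norm_cast
      ring

end GeodesicFlow

theorem mainTheorem4 (ε c : ℝ) (hε : 0 < ε) (hc : 0 < c) :
    ∃ C : ℝ, ∀ k : ℕ, 3 ≤ k →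
      ∃ err : ℕ → ℝ, err =o[atTop] (fun N : ℕ => GeodesicFlow.flowScale k N) ∧
        ∀ η : ℝ, 0 < η → ∀ᶠ N : ℕ in atTop, ∀ G : SimpleGraph (Fin N),
          GeodesicFlow.DegreesAtMost G k → GeodesicFlow.NeighborhoodGrowth G k ε c →
            ENNReal.ofReal (1 - η) ≤ (GeodesicFlow.addRandomMatching G).toOuterMeasure
              {H : SimpleGraph (Fin N) |
                ∀ P : Finset (Fin N × Fin N), GeodesicFlow.IsPairOrientation P →
                  GeodesicFlow.maxVertexFlow H P ≤
                    (k : ℝ) ^ C * GeodesicFlow.flowScale k N + err N} := by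
  -- for fixed `k` the scale is of order `N (log N) ^ 3`, and the flow is of smaller order, so that
  -- neither a constant factor nor an error term is needed
  refine ⟨0, fun k hk => ⟨fun _ => 0, Asymptotics.isLittleO_zero _ _, fun η hη => ?_⟩⟩
  obtain ⟨Δ, rfl⟩ : ∃ Δ, k = Δ + 1 := ⟨k - 1, by omega⟩
  have hΔ : 2 ≤ Δ := by omega
  have hΔ' : (2 : ℝ) ≤ Δ := by exact_mod_cast hΔ
  -- with the factor `1 / 4`, the seeds in `G` are not larger than those of vertices that are
  -- not stunted
  set b : ℝ := min (c * (Δ + 1) / (Δ : ℝ) ^ 2) (1 / 4) with hb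
  have hb0 : 0 < b := by positivity
  have hb4 : b ≤ 1 / 4 := min_le_right _ _
  obtain ⟨C, hC, hbranch⟩ := GeodesicFlow.eventually_branchesUpTo hΔ hb0 (by linarith)
  filter_upwards [hbranch, GeodesicFlow.eventually_exists_radii hΔ hb0 (by linarith) hC hη,
    eventually_ge_atTop 1] with N hN hradii hN1 G hdeg hgrow
  obtain ⟨R, hR⟩ := hN
  obtain ⟨n, a, a', K, hna, hna', hK0, hn, ha, ha', hK, hK', hfail, hflow⟩ := hradii
  have : Nonempty (Fin N) := ⟨⟨0, hN1⟩⟩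
  have hlog : 0 ≤ Real.logb Δ N := Real.logb_nonneg (by linarith) (by exact_mod_cast hN1)
  have hsphere : ∀ (x : Fin N) (i : ℕ), 1 ≤ i → (i : ℝ) ≤ Real.logb Δ N / 2 →
      b * (Δ : ℝ) ^ i ≤ (GeodesicFlow.sphere G x i).card := fun x i hi hi' =>
    hgrow.le_card_sphere hΔ hε.le (by simpa using hlog) (min_le_left _ _) x hi (by simpa using hi')
  refine (GeodesicFlow.ofReal_le_addRandomMatching_maxVertexFlow (hR G hdeg hsphere a ha)
    (hR G hdeg hsphere a' ha') hna hna' (m₀ := b * (Δ : ℝ) ^ (n + 2)) ?_ hK0 hK hK'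
    (fun x => hsphere x (n + 2) (by omega) hn) (by simpa using hfail)).trans ?_
  · calc b * (Δ : ℝ) ^ (n + 2) ≤ 1 / 4 * ((Δ : ℝ) + 1) ^ (n + 2) := by
          gcongr
          linarith
      _ = _ := by ring
  · refine MeasureTheory.OuterMeasure.mono _ fun H hH P hP => (hH P hP).trans ?_
    rw [Real.rpow_zero, one_mul, add_zero]
    exact hflow
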